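/- Let $t_1<0$, $C_0>0$ and $V_0\in[0,\infty]$. There is a constant $C>0$, depending only on $t_1$, $C_0$ and $V_0$, such that the following holds. Let $(M,g)$ be a connected smooth $(1+3)$-dimensional Lorentzian manifold of signature $(-,+,+,+)$, with Levi-Civita connection $D$ and Ricci curvature $R_{\alpha\beta}$ (scalar curvature $R$), which together with a matter field $\Phi$ is an Einstein-scalar or an Einstein-Maxwell spacetime: $R_{\alpha\beta}-\frac12 R\,g_{\alpha\beta}=Q_{\alpha\beta}$, where either - $\Phi=\phi\in C^\infty(M)$, $\Box_g\phi=0$ and $Q_{\alpha\beta}=D_\alpha\phi D_\beta\phi-\frac12 g_{\alpha\beta}D^\mu\phi D_\mu\phi$ (put $\mathfrak F=D\phi$), or - $\Phi=F$ is a smooth $2$-form, $D^\beta F_{\alpha\beta}=0$, $D_\alpha F_{\beta\gamma}+D_\beta F_{\gamma\alpha}+D_\gamma F_{\alpha\beta}=0$ and $Q_{\alpha\beta}=F_{\alpha\mu}F_\beta{}^\mu-\frac14 g_{\alpha\beta}F^{\mu\nu}F_{\mu\nu}$ (put $\mathfrak F=F$). Let $t\in C^\infty(M)$ be a time function: its gradient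 is everywhere timelike ($M$ is time-oriented so that $\operatorname{grad}t$ is past directed), and every nonempty level set $\Sigma_\tau=\{t=\tau\}$ is a Cauchy hypersurface, i.e. every inextendible causal curve meets it exactly once. Denote by $n=|g(\operatorname{grad}t,\operatorname{grad}t)|^{-1/2}$ the lapse, by $T=-n\operatorname{grad}t$ the future unit normal of the $\Sigma_\tau$, by $\gamma$ and $\nabla$ their induced metric and connection, by $V(\Sigma_\tau)$ their Riemannian volume, and by $k(X,Y)=-g(D_XT,Y)$ ($X,Y$ tangent to the $\Sigma_\tau$) their second fundamental form. Suppose that, for some $t_0<t_1$, the CMC condition holds: $t(M)=(t_0,t_1)$, every $\Sigma_\tau$ is compact, and $\operatorname{tr}_\gamma k=t$ on $M$. Suppose also that $$\|k\|_{L^\infty(M)}+\|\nabla(\log n)\|_{L^\infty(M)}+\|\mathfrak F\|_{L^\infty(M)}\le C_0,$$ where pointwise norms are taken with respect to the Riemannian metric $h(X,Y)=g(X,Y)+2g(T,X)g(T,Y)$. Finally let $\max(t_0,2t_1)<\tau_0<t_1$ and $V(\Sigma_{\tau_0})=V_0$. Then, for every $\tau_0\le\tau<t_1$, $$C^{-1}\le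 |n|\le C\ \text{ on }\Sigma_\tau,\qquad C^{-1}\le V(\Sigma_\tau)\le C.$$ -/

import Mathlib

open scoped Manifold ContDiff ENNReal Topology

noncomputable section

namespace CMCFoliation

/-- The model space `ℝ⁴` of the spacetime. -/
abbrev E4 := EuclideanSpace ℝ (Fin 4)

/-- The model space `ℝ³` of the timeslices, with its Lebesgue measure. -/
abbrev E3 := EuclideanSpace ℝ (Fin 3)

/-! ### Coordinate expressions on open sets of `ℝ⁴`

`G y` is the matrix `(g_{ab})` of a Lorentzian metric of signature `(-,+,+,+)` in a coordinate
system, `(G y)⁻¹` the matrix `(g^{ab})`; `u` is the coordinate expression of a time function. -/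

/-- The coordinate derivative `∂_a f`. -/
def pd (a : Fin 4) (f : E4 → ℝ) (y : E4) : ℝ :=
  fderiv ℝ f y (EuclideanSpace.single a 1)

/-- The Christoffel symbols `Γ^a_{bc}` of the Levi-Civita connection. -/
def christoffel (G : E4 → Matrix (Fin 4) (Fin 4) ℝ) (a b c : Fin 4) (y : E4) : ℝ :=
  (1 / 2) * ∑ d, (G y)⁻¹ a d *
    (pd b (fun z => G z d c) y + pd c (fun z => G z d b) y - pd d (fun z => G z b c) y)

/-- The Ricci curvature
`R_{bc} = ∂_a Γ^a_{bc} - ∂_c Γ^a_{ba} + Γ^a_{ad} Γ^d_{bc} - Γ^a_{cd} Γ^d_{ba}`. -/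
def ricci (G : E4 → Matrix (Fin 4) (Fin 4) ℝ) (b c : Fin 4) (y : E4) : ℝ :=
  ∑ a, (pd a (christoffel G a b c) y - pd c (christoffel G a b a) y +
    ∑ d, (christoffel G a a d y * christoffel G d b c y -
      christoffel G a c d y * christoffel G d b a y))

/-- The scalar curvature `R = g^{ab} R_{ab}`. -/
def scalarCurvature (G : E4 → Matrix (Fin 4) (Fin 4) ℝ) (y : E4) : ℝ :=
  ∑ a, ∑ b, (G y)⁻¹ a b * ricci G a b y

/-- The Einstein tensor `R_{ab} - (1/2) R g_{ab}`. -/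
def einsteinTensor (G : E4 → Matrix (Fin 4) (Fin 4) ℝ) (a b : Fin 4) (y : E4) : ℝ :=
  ricci G a b y - (1 / 2) * scalarCurvature G y * G y a b

/-- The components `g^{ab} ∂_b f` of the gradient of `f`. -/
def grad (G : E4 → Matrix (Fin 4) (Fin 4) ℝ) (f : E4 → ℝ) (a : Fin 4) (y : E4) : ℝ :=
  ∑ b, (G y)⁻¹ a b * pd b f y

/-- `g(grad f, grad f)`. -/
def gradSq (G : E4 → Matrix (Fin 4) (Fin 4) ℝ) (f : E4 → ℝ) (y : E4) : ℝ :=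
  ∑ a, ∑ b, G y a b * grad G f a y * grad G f b y

/-- The lapse `n = |g(grad t, grad t)|^{-1/2}`. -/
def lapseLoc (G : E4 → Matrix (Fin 4) (Fin 4) ℝ) (u : E4 → ℝ) (y : E4) : ℝ :=
  (Real.sqrt |gradSq G u y|)⁻¹

/-- The components of the future unit normal `T = -n grad t`. -/
def normal (G : E4 → Matrix (Fin 4) (Fin 4) ℝ) (u : E4 → ℝ) (a : Fin 4) (y : E4) : ℝ :=
  -(lapseLoc G u y * grad G u a y)

/-- The components `k_{bc} = -g(D_b T, ∂_c)`. This is a bilinear form on all vectors; the second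
fundamental form is its restriction to horizontal vectors, and it enters below only through
contractions with the inverse `horizInv` of the horizontal metric, which see no other part. -/
def sff (G : E4 → Matrix (Fin 4) (Fin 4) ℝ) (u : E4 → ℝ) (b c : Fin 4) (y : E4) : ℝ :=
  -∑ a, G y a c * (pd b (normal G u a) y + ∑ d, christoffel G a b d y * normal G u d y)

/-- The inverse `γ^{ab} = g^{ab} + T^a T^b` of the horizontal metric (as a spacetime tensor). -/
def horizInv (G : E4 → Matrix (Fin 4) (Fin 4) ℝ) (u : E4 → ℝ) (a b : Fin 4) (y : E4) : ℝ :=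
  (G y)⁻¹ a b + normal G u a y * normal G u b y

/-- The inverse `h^{ab} = g^{ab} + 2 T^a T^b` of the Riemannian metric
`h(X, Y) = g(X, Y) + 2 g(T, X) g(T, Y)`. -/
def riemInv (G : E4 → Matrix (Fin 4) (Fin 4) ℝ) (u : E4 → ℝ) (a b : Fin 4) (y : E4) : ℝ :=
  (G y)⁻¹ a b + 2 * normal G u a y * normal G u b y

/-- The mean curvature `tr k = γ^{ab} k_{ab}`. -/
def traceSff (G : E4 → Matrix (Fin 4) (Fin 4) ℝ) (u : E4 → ℝ) (y : E4) : ℝ :=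
  ∑ a, ∑ b, horizInv G u a b y * sff G u a b y

/-- The tensor norm `|k| = (γ^{ac} γ^{bd} k_{ab} k_{cd})^{1/2}`. -/
def normSff (G : E4 → Matrix (Fin 4) (Fin 4) ℝ) (u : E4 → ℝ) (y : E4) : ℝ :=
  Real.sqrt (∑ a, ∑ b, ∑ c, ∑ d,
    horizInv G u a c y * horizInv G u b d y * sff G u a b y * sff G u c d y)

/-- The norm `|∇ (log n)| = (γ^{ab} ∂_a (log n) ∂_b (log n))^{1/2}` of the horizontal gradient. -/
def normGradLogLapse (G : E4 → Matrix (Fin 4) (Fin 4) ℝ) (u : E4 → ℝ) (y : E4) : ℝ :=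
  Real.sqrt (∑ a, ∑ b, horizInv G u a b y *
    pd a (fun z => Real.log (lapseLoc G u z)) y * pd b (fun z => Real.log (lapseLoc G u z)) y)

/-- The norm of `D φ` with respect to `h`. -/
def normDScalar (G : E4 → Matrix (Fin 4) (Fin 4) ℝ) (u φ : E4 → ℝ) (y : E4) : ℝ :=
  Real.sqrt (∑ a, ∑ b, riemInv G u a b y * pd a φ y * pd b φ y)

/-- The norm of a two-form `F` with respect to `h`. -/
def normTwoForm (G : E4 → Matrix (Fin 4) (Fin 4) ℝ) (u : E4 → ℝ)
    (F : E4 → Matrix (Fin 4) (Fin 4) ℝ) (y : E4) : ℝ :=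
  Real.sqrt (∑ a, ∑ b, ∑ c, ∑ d, riemInv G u a c y * riemInv G u b d y * F y a b * F y c d)

/-- The wave operator `g^{ab} D_{ab} φ`. -/
def box (G : E4 → Matrix (Fin 4) (Fin 4) ℝ) (φ : E4 → ℝ) (y : E4) : ℝ :=
  ∑ a, ∑ b, (G y)⁻¹ a b * (pd a (pd b φ) y - ∑ c, christoffel G c a b y * pd c φ y)

/-- The energy-momentum tensor of a scalar field. -/
def emScalar (G : E4 → Matrix (Fin 4) (Fin 4) ℝ) (φ : E4 → ℝ) (a b : Fin 4) (y : E4) : ℝ :=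
  pd a φ y * pd b φ y - (1 / 2) * G y a b * ∑ c, ∑ d, (G y)⁻¹ c d * pd c φ y * pd d φ y

/-- The covariant derivative `D_c F_{ab}` of a two-form. -/
def covDerivTwoForm (G F : E4 → Matrix (Fin 4) (Fin 4) ℝ) (c a b : Fin 4) (y : E4) : ℝ :=
  pd c (fun z => F z a b) y -
    ∑ d, (christoffel G d c a y * F y d b + christoffel G d c b y * F y a d)

/-- The energy-momentum tensor `F_{am} F_b^m - (1/4) g_{ab} F^{mn} F_{mn}` of a Maxwell field. -/
def emMaxwell (G F : E4 → Matrix (Fin 4) (Fin 4) ℝ) (a b : Fin 4) (y : E4) : ℝ :=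
  (∑ m, ∑ n, (G y)⁻¹ m n * F y a m * F y b n) -
    (1 / 4) * G y a b *
      ∑ m, ∑ n, ∑ p, ∑ q, (G y)⁻¹ m p * (G y)⁻¹ n q * F y m n * F y p q

/-! ### Objects on the spacetime manifold -/

section Manifold

variable {M : Type*} [TopologicalSpace M] [ChartedSpace E4 M]

/-- The component matrix, in a chart `e`, of a field of bilinear forms on the tangent spaces. -/
def components
    (B : ∀ p : M, TangentSpace (𝓡 4) p →L[ℝ] TangentSpace (𝓡 4) p →L[ℝ] ℝ)
    (e : OpenPartialHomeomorph M E4) (y : E4) : Matrix (Fin 4) (Fin 4) ℝ :=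
  Matrix.of fun i j =>
    B (e.symm y) (mfderiv (𝓡 4) (𝓡 4) e.symm y (EuclideanSpace.single i 1))
      (mfderiv (𝓡 4) (𝓡 4) e.symm y (EuclideanSpace.single j 1))

variable (M) in
/-- A smooth Lorentzian metric of signature `(-,+,+,+)`. -/
structure LorentzMetric where
  /-- The metric on each tangent space. -/
  form : ∀ p : M, TangentSpace (𝓡 4) p →L[ℝ] TangentSpace (𝓡 4) p →L[ℝ] ℝ
  symm : ∀ p v w, form p v w = form p w v
  signature : ∀ p : M, ∃ b : Module.Basis (Fin 4) ℝ (TangentSpace (𝓡 4) p),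
    ∀ i j, form p (b i) (b j) = if i = j then (if i = 0 then -1 else 1) else 0
  smooth : ∀ e ∈ IsManifold.maximalAtlas (𝓡 4) ∞ M, ∀ i j,
    ContDiffOn ℝ ∞ (fun y => components form e y i j) e.target

/-- The matrix `(g_{ab})` in the chart `e`. -/
def LorentzMetric.comp (g : LorentzMetric M) (e : OpenPartialHomeomorph M E4) :
    E4 → Matrix (Fin 4) (Fin 4) ℝ :=
  components g.form e

/-- A function on `M` in the chart `e`. -/
def inChart (f : M → ℝ) (e : OpenPartialHomeomorph M E4) (y : E4) : ℝ := f (e.symm y)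

variable (M) in
/-- A smooth two-form. -/
structure TwoForm where
  /-- The alternating form on each tangent space. -/
  form : ∀ p : M, TangentSpace (𝓡 4) p →L[ℝ] TangentSpace (𝓡 4) p →L[ℝ] ℝ
  antisymm : ∀ p v w, form p v w = -form p w v
  smooth : ∀ e ∈ IsManifold.maximalAtlas (𝓡 4) ∞ M, ∀ i j,
    ContDiffOn ℝ ∞ (fun y => components form e y i j) e.target

variable (M) in
/-- The matter field: a scalar field (Einstein-scalar case) or a two-form
(Einstein-Maxwell case). -/
inductive MatterField where
  | scalar (φ : M → ℝ) : MatterField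
  | maxwell (F : TwoForm M) : MatterField

/-- `(M, g, Φ)` is an Einstein-scalar or an Einstein-Maxwell spacetime: the Einstein equations and
the field equations of `Φ` hold in every smooth chart. -/
def IsEinsteinSpacetime (g : LorentzMetric M) : MatterField M → Prop
  | .scalar φ =>
      ContMDiff (𝓡 4) 𝓘(ℝ, ℝ) ∞ φ ∧
      ∀ e ∈ IsManifold.maximalAtlas (𝓡 4) ∞ M, ∀ y ∈ e.target,
        (∀ a b, einsteinTensor (g.comp e) a b y = emScalar (g.comp e) (inChart φ e) a b y) ∧
        box (g.comp e) (inChart φ e) y = 0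
  | .maxwell F =>
      ∀ e ∈ IsManifold.maximalAtlas (𝓡 4) ∞ M, ∀ y ∈ e.target,
        (∀ a b, einsteinTensor (g.comp e) a b y =
          emMaxwell (g.comp e) (components F.form e) a b y) ∧
        (∀ a, ∑ b, ∑ m, (g.comp e y)⁻¹ b m *
          covDerivTwoForm (g.comp e) (components F.form e) m a b y = 0) ∧
        (∀ a b c, covDerivTwoForm (g.comp e) (components F.form e) a b c y +
          covDerivTwoForm (g.comp e) (components F.form e) b c a y +
          covDerivTwoForm (g.comp e) (components F.form e) c a b y = 0)

/-! ### Time functions -/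

/-- A causal curve of class `C¹` on an open interval `J`, without endpoint in either direction. -/
structure IsInextendibleCausalCurve (g : LorentzMetric M) (J : Set ℝ) (c : ℝ → M) : Prop where
  isOpen : IsOpen J
  nonempty : J.Nonempty
  ordConnected : J.OrdConnected
  contMDiffOn : ContMDiffOn 𝓘(ℝ, ℝ) (𝓡 4) 1 c J
  velocity_ne_zero : ∀ s ∈ J, mfderiv 𝓘(ℝ, ℝ) (𝓡 4) c s (1 : ℝ) ≠ 0
  causal : ∀ s ∈ J, g.form (c s) (mfderiv 𝓘(ℝ, ℝ) (𝓡 4) c s (1 : ℝ))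
    (mfderiv 𝓘(ℝ, ℝ) (𝓡 4) c s (1 : ℝ)) ≤ 0
  no_endpoint_right : ¬ ∃ p : M, ∀ U ∈ 𝓝 p, ∃ s₀ ∈ J, ∀ s ∈ J, s₀ ≤ s → c s ∈ U
  no_endpoint_left : ¬ ∃ p : M, ∀ U ∈ 𝓝 p, ∃ s₀ ∈ J, ∀ s ∈ J, s ≤ s₀ → c s ∈ U

/-- Every inextendible causal curve meets `S` exactly once. -/
def IsCauchyHypersurface (g : LorentzMetric M) (S : Set M) : Prop :=
  ∀ (J : Set ℝ) (c : ℝ → M), IsInextendibleCausalCurve g J c → ∃! s, s ∈ J ∧ c s ∈ S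

/-- The timeslice `Σ_τ`. -/
def slice (t : M → ℝ) (τ : ℝ) : Set M := {p | t p = τ}

/-- `t` is a time function. The gradient of `t` being timelike, there is exactly one time
orientation of `(M, g)` for which it is past directed; this is the time orientation used. -/
structure IsTimeFunction (g : LorentzMetric M) (t : M → ℝ) : Prop where
  smooth : ContMDiff (𝓡 4) 𝓘(ℝ, ℝ) ∞ t
  grad_timelike : ∀ e ∈ IsManifold.maximalAtlas (𝓡 4) ∞ M, ∀ y ∈ e.target,
    gradSq (g.comp e) (inChart t e) y < 0
  cauchy : ∀ τ, (slice t τ).Nonempty → IsCauchyHypersurface g (slice t τ)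

/-- The condition `CMC(t, t₀, t₁)`, for a time function `t`. -/
structure IsCMC (g : LorentzMetric M) (t : M → ℝ) (t₀ t₁ : ℝ) : Prop where
  timeFunction : IsTimeFunction g t
  lt : t₀ < t₁
  neg : t₁ < 0
  range_eq : Set.range t = Set.Ioo t₀ t₁
  compact_slice : ∀ τ, IsCompact (slice t τ)
  cmc : ∀ e ∈ IsManifold.maximalAtlas (𝓡 4) ∞ M, ∀ y ∈ e.target,
    traceSff (g.comp e) (inChart t e) y = inChart t e y

/-! ### Scalar quantities on `M`

The value at `p` is computed in the preferred chart at `p`; it does not depend on the chart. -/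

/-- The lapse function `n`. -/
def lapse (g : LorentzMetric M) (t : M → ℝ) (p : M) : ℝ :=
  lapseLoc (g.comp (chartAt E4 p)) (inChart t (chartAt E4 p)) (chartAt E4 p p)

/-- The pointwise norm `|k|`. -/
def pointNormSff (g : LorentzMetric M) (t : M → ℝ) (p : M) : ℝ :=
  normSff (g.comp (chartAt E4 p)) (inChart t (chartAt E4 p)) (chartAt E4 p p)

/-- The pointwise norm `|∇ (log n)|`. -/
def pointNormGradLogLapse (g : LorentzMetric M) (t : M → ℝ) (p : M) : ℝ :=
  normGradLogLapse (g.comp (chartAt E4 p)) (inChart t (chartAt E4 p)) (chartAt E4 p p)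

/-- The pointwise norm of `D φ` (Einstein-scalar case) or of `F` (Einstein-Maxwell case). -/
def pointNormMatter (g : LorentzMetric M) (t : M → ℝ) (p : M) : MatterField M → ℝ
  | .scalar φ => normDScalar (g.comp (chartAt E4 p)) (inChart t (chartAt E4 p))
      (inChart φ (chartAt E4 p)) (chartAt E4 p p)
  | .maxwell F => normTwoForm (g.comp (chartAt E4 p)) (inChart t (chartAt E4 p))
      (components F.form (chartAt E4 p)) (chartAt E4 p p)

/-- The breakdown criterion with constant `C₀`. The `L^∞` norms are suprema, since all the
quantities are continuous. -/
def BreakdownCriterion (g : LorentzMetric M) (t : M → ℝ) (Φ : MatterField M) (C₀ : ℝ) : Prop :=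
  (⨆ p : M, ENNReal.ofReal (pointNormSff g t p)) +
    (⨆ p : M, ENNReal.ofReal (pointNormGradLogLapse g t p)) +
    (⨆ p : M, ENNReal.ofReal (pointNormMatter g t p Φ)) ≤ ENNReal.ofReal C₀

/-! ### The volume of a hypersurface -/

/-- A measurable subset `K` of the domain `U` of a local parametrization `ψ` of `S` by an open
subset of `ℝ³`. -/
structure Piece (S : Set M) where
  /-- The domain of the parametrization. -/
  U : Set E3
  /-- The parametrization. -/
  ψ : E3 → M
  /-- The measurable subset. -/
  K : Set E3
  isOpen : IsOpen U
  contMDiffOn : ContMDiffOn (𝓡 3) (𝓡 4) 1 ψ U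
  injOn : Set.InjOn ψ U
  immersion : ∀ x ∈ U, Function.Injective (mfderiv (𝓡 3) (𝓡 4) ψ x)
  mapsTo : Set.MapsTo ψ U S
  measurable : MeasurableSet K
  subset : K ⊆ U

/-- The matrix of the pulled back metric `ψ^* g` at `x`. -/
def pullbackGram (g : LorentzMetric M) (ψ : E3 → M) (x : E3) : Matrix (Fin 3) (Fin 3) ℝ :=
  Matrix.of fun i j =>
    g.form (ψ x) (mfderiv (𝓡 3) (𝓡 4) ψ x (EuclideanSpace.single i 1))
      (mfderiv (𝓡 3) (𝓡 4) ψ x (EuclideanSpace.single j 1))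

/-- The volume `∫_K (det (ψ^* g))^{1/2}` of the set `ψ(K)`. -/
def Piece.volume (g : LorentzMetric M) {S : Set M} (P : Piece S) : ℝ≥0∞ :=
  ∫⁻ x in P.K, ENNReal.ofReal (Real.sqrt (pullbackGram g P.ψ x).det)

/-- The Riemannian volume, for the metric induced by `g`, of a spacelike hypersurface `S`: the
supremum of the total volumes of finitely many disjoint parametrized pieces of `S`. -/
def hypersurfaceVolume (g : LorentzMetric M) (S : Set M) : ℝ≥0∞ :=
  ⨆ (m : ℕ) (P : Fin m → Piece S)
    (_ : Pairwise fun i j => Disjoint ((P i).ψ '' (P i).K) ((P j).ψ '' (P j).K)),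
    ∑ i, (P i).volume g

end Manifold

end CMCFoliation

end

/-! The lapse is controlled by a maximum principle, the volume by the flow that carries one slice to
another.

Raychaudhuri's identity for the unit normal expresses `T(div T)` through `D_b T^c D_c T^b`,
`Ric(T,T)` and the divergence of the acceleration `D_T T`. For a hypersurface-orthogonal `T` the
acceleration is the horizontal gradient of `log n`, the quadratic term is `|k|²` and `div T = -tr
k`. Since `tr k = t` and `T(t) = 1/n`, this becomes an elliptic equation on the slices
(`IsTimeOn.lapse_equation`): `1/n = |k|² + Ric(T,T) - div(D_T T)`. At a maximum of `n` on a compact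
slice the divergence is nonpositive, so `|k|² + Ric(T,T) ≤ 1/n`; at a minimum the inequality is
reversed (`IsTimeOn.le_inv_lapse_of_max`, `IsTimeOn.inv_lapse_le_of_min`). The Einstein equations
give `Ric(T,T) = (Tφ)²` for a scalar field and a quarter of the squared `h`-norm of `F` for a
Maxwell field, in both cases a number between `0` and `|𝔉|²`. With `t² = (tr k)² ≤ 4|k|²` the
maximum yields `n ≤ 4/t²`, and with the breakdown criterion the minimum yields `1/n ≤ 2C₀²`.

For the volume, the vector field `nT = grad t / g(grad t, grad t)` increases `t` at unit speed. A
maximal integral curve is an inextendible timelike curve, hence meets every nonempty slice, so the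
flow exists for all times that the range of `t` permits (`IsTimeFunction.exists_curve`) and maps
slices to slices. Along the flow the determinant of the induced metric satisfies `(det)' = -2 n t
det` (`IsTimeFlow.hasDerivAt_det_pullbackGram`). As `t < t₁ < 0` and `n ≤ 4/t²`, the factor `-2nt`
lies between `0` and `8/|t₁|`. Hence the volume is nondecreasing in time and grows at a bounded
exponential rate (`IsTimeFlow.volume_bounds`). The condition `2t₁ < τ₀` limits the elapsed time to
`|t₁|`, which gives the factor `e^8`.

The volume is a supremum over disjoint families of parametrized pieces, so two further facts are
needed for `V₀` to be a usable constant: a nonempty slice has positive volume and a compact one has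
finite volume (`IsTimeFunction.hypersurfaceVolume_pos`, `IsTimeFunction.hypersurfaceVolume_lt_top`).
They rule out `V₀ = 0` and `V₀ = ∞`. -/

noncomputable section

namespace CMCFoliation

section

/-! ### Lorentzian linear algebra -/

open Matrix

/-- The matrix of a Lorentzian scalar product of signature `(-,+,+,+)`. -/
def IsLorentz (A : Matrix (Fin 4) (Fin 4) ℝ) : Prop :=
  A.IsSymm ∧ ∃ P : Matrix (Fin 4) (Fin 4) ℝ,
    Pᵀ * A * P = diagonal (fun i : Fin 4 => if i = 0 then (-1 : ℝ) else 1)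

/-- The signature matrix has determinant `-1`. This makes both the metric and the change of frame
invertible. -/
lemma IsLorentz.det_frame {A P : Matrix (Fin 4) (Fin 4) ℝ}
    (h : Pᵀ * A * P = diagonal (fun i : Fin 4 => if i = 0 then (-1 : ℝ) else 1)) :
    P.det * P.det * A.det = -1 := by
  have := congrArg Matrix.det h
  rw [det_mul, det_mul, det_transpose, det_diagonal] at this
  simp at this
  linarith

lemma IsLorentz.det_ne_zero {A : Matrix (Fin 4) (Fin 4) ℝ} (hA : IsLorentz A) : A.det ≠ 0 := by
  obtain ⟨-, P, hP⟩ := hA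
  intro h
  have := IsLorentz.det_frame hP
  rw [h] at this
  norm_num at this

lemma IsLorentz.isUnit_det {A : Matrix (Fin 4) (Fin 4) ℝ} (hA : IsLorentz A) : IsUnit A.det :=
  hA.det_ne_zero.isUnit

lemma IsLorentz.dotProduct_comm {A : Matrix (Fin 4) (Fin 4) ℝ} (hA : IsLorentz A)
    (v w : Fin 4 → ℝ) : v ⬝ᵥ A *ᵥ w = w ⬝ᵥ A *ᵥ v := by
  rw [dotProduct_mulVec, ← mulVec_transpose, hA.1.eq, _root_.dotProduct_comm]

/-- A nonzero vector orthogonal to a timelike one is spacelike. -/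
lemma IsLorentz.pos_of_orthogonal {A : Matrix (Fin 4) (Fin 4) ℝ} (hA : IsLorentz A)
    {T v : Fin 4 → ℝ} (hT : T ⬝ᵥ A *ᵥ T < 0) (hTv : T ⬝ᵥ A *ᵥ v = 0) (hv : v ≠ 0) :
    0 < v ⬝ᵥ A *ᵥ v := by
  obtain ⟨-, P, hP⟩ := hA
  have hdet : P.det ≠ 0 := by
    intro h
    have := IsLorentz.det_frame hP
    rw [h] at this
    norm_num at this
  have hPP : P * P⁻¹ = 1 := mul_nonsing_inv _ hdet.isUnit
  have key : ∀ x y : Fin 4 → ℝ, x ⬝ᵥ A *ᵥ y = (P⁻¹ *ᵥ x) ⬝ᵥ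
      (diagonal (fun i : Fin 4 => if i = 0 then (-1 : ℝ) else 1)) *ᵥ (P⁻¹ *ᵥ y) := by
    intro x y
    rw [← hP]
    rw [mulVec_mulVec, Matrix.mul_assoc _ P, hPP, Matrix.mul_one, ← mulVec_mulVec,
      dotProduct_mulVec _ Pᵀ, vecMul_transpose, mulVec_mulVec, hPP, one_mulVec]
  rw [key] at hT hTv ⊢
  have hv' : P⁻¹ *ᵥ v ≠ 0 := by
    intro h
    apply hv
    have := congrArg (fun z => P *ᵥ z) h
    simpa [mulVec_mulVec, hPP] using this
  generalize P⁻¹ *ᵥ T = S at *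
  generalize P⁻¹ *ᵥ v = w at *
  simp only [dotProduct, mulVec_diagonal, Fin.sum_univ_four] at *
  simp at hT hTv ⊢
  -- In an orthonormal frame, orthogonality reads `S₀ w₀ = S'·w'` for the spatial parts. If `w` were
  -- not spacelike, then `|w'|² ≤ w₀²`, and Cauchy-Schwarz gives `S₀² w₀² ≤ |S'|² w₀²`. As `|S'|² <
  -- S₀²`, this forces `w₀ = 0` and then `w = 0`.
  by_contra! hneg
  have hc : (S 1 * w 1 + S 2 * w 2 + S 3 * w 3) ^ 2 ≤
      (S 1 ^ 2 + S 2 ^ 2 + S 3 ^ 2) * (w 1 ^ 2 + w 2 ^ 2 + w 3 ^ 2) := by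
    nlinarith [sq_nonneg (S 1 * w 2 - S 2 * w 1), sq_nonneg (S 1 * w 3 - S 3 * w 1),
      sq_nonneg (S 2 * w 3 - S 3 * w 2)]
  have h1 : S 1 * w 1 + S 2 * w 2 + S 3 * w 3 = S 0 * w 0 := by linarith
  rw [h1] at hc
  have h2 : w 1 ^ 2 + w 2 ^ 2 + w 3 ^ 2 ≤ w 0 ^ 2 := by nlinarith
  have h3 : S 1 ^ 2 + S 2 ^ 2 + S 3 ^ 2 < S 0 ^ 2 := by nlinarith
  have h4 : (S 0 ^ 2 - (S 1 ^ 2 + S 2 ^ 2 + S 3 ^ 2)) * w 0 ^ 2 ≤ 0 := by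
    nlinarith [mul_le_mul_of_nonneg_left h2
      (by positivity : 0 ≤ S 1 ^ 2 + S 2 ^ 2 + S 3 ^ 2)]
  have h5 : w 0 = 0 := by
    by_contra h
    have : 0 < w 0 ^ 2 := by positivity
    nlinarith
  rw [h5] at h2
  apply hv'
  ext i
  fin_cases i <;> simp <;> nlinarith [sq_nonneg (w 1), sq_nonneg (w 2), sq_nonneg (w 3)]

/-- The inverse of the metric induced on the orthogonal complement of a unit timelike vector
is positive semidefinite. -/
lemma IsLorentz.posSemidef {A : Matrix (Fin 4) (Fin 4) ℝ} (hA : IsLorentz A)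
    {T : Fin 4 → ℝ} (hT : T ⬝ᵥ A *ᵥ T = -1) : (A⁻¹ + vecMulVec T T).PosSemidef := by
  refine PosSemidef.of_dotProduct_mulVec_nonneg ?_ fun x => ?_
  · rw [IsHermitian, conjTranspose_add, conjTranspose_eq_transpose_of_trivial,
      conjTranspose_eq_transpose_of_trivial, transpose_nonsing_inv, hA.1.eq]
    congr 1
    ext i j
    simp [vecMulVec_apply, mul_comm]
  -- After raising the index of `x` to get `w`, the quadratic form at `x` is the metric evaluated on
  -- `w + c T`, the orthogonal projection of `w` to the complement of `T`.
  · set w := A⁻¹ *ᵥ x with hw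
    have hx : x = A *ᵥ w := by rw [hw, mulVec_mulVec, mul_nonsing_inv _ hA.isUnit_det, one_mulVec]
    set c := T ⬝ᵥ A *ᵥ w with hc
    have h0 : T ⬝ᵥ A *ᵥ (w + c • T) = 0 := by
      rw [mulVec_add, mulVec_smul, dotProduct_add, dotProduct_smul, hT, ← hc]; simp
    have h1 : (w + c • T) ⬝ᵥ A *ᵥ (w + c • T) = w ⬝ᵥ A *ᵥ w + c * c := by
      rw [mulVec_add, mulVec_smul, dotProduct_add, add_dotProduct, dotProduct_smul,
        add_dotProduct, smul_dotProduct, smul_dotProduct, hT, hA.dotProduct_comm w T, ← hc]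
      simp only [smul_eq_mul]; ring
    have h2 : star x ⬝ᵥ (A⁻¹ + vecMulVec T T) *ᵥ x = w ⬝ᵥ A *ᵥ w + c * c := by
      rw [add_mulVec, dotProduct_add, ← hw, star_trivial]
      congr 1
      · rw [hx, _root_.dotProduct_comm]
      · rw [vecMulVec_mulVec, hc, ← hx]
        simp [_root_.dotProduct_comm]
    rw [h2, ← h1]
    by_cases hz : w + c • T = 0
    · simp [hz]
    · exact (hA.pos_of_orthogonal (by rw [hT]; norm_num) h0 hz).le

-- A positive semidefinite matrix is of the form `Bᵀ B`. The rows of `B` serve as a substitute for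
-- an orthonormal horizontal frame: contractions with the inverse horizontal metric become sums over
-- `i`, and positivity becomes visible.
open scoped MatrixOrder in
lemma IsLorentz.exists_factor {A : Matrix (Fin 4) (Fin 4) ℝ} (hA : IsLorentz A)
    {T : Fin 4 → ℝ} (hT : T ⬝ᵥ A *ᵥ T = -1) :
    ∃ B : Matrix (Fin 4) (Fin 4) ℝ, ∀ a b, A⁻¹ a b + T a * T b = ∑ i, B i a * B i b := by
  obtain ⟨B, hB⟩ := CStarAlgebra.nonneg_iff_eq_star_mul_self.mp (hA.posSemidef hT).nonneg
  refine ⟨B, fun a b => ?_⟩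
  have := congrFun (congrFun hB a) b
  simpa [mul_apply, vecMulVec_apply, star_eq_conjTranspose] using this

/-- Reordering of sums. -/
lemma sum_rotate {ι : Type*} [Fintype ι] (f : ι → ι → ι → ℝ) :
    ∑ x, ∑ i, ∑ j, f x i j = ∑ i, ∑ j, ∑ x, f x i j := by
  rw [Finset.sum_comm]
  exact Finset.sum_congr rfl fun i _ => Finset.sum_comm

/-- The squared norm of `k` is the sum of the squares of its components in the frame given by the
rows of `B`. -/
lemma sum_factor_sq (B k : Matrix (Fin 4) (Fin 4) ℝ) (γ : Fin 4 → Fin 4 → ℝ)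
    (hγ : ∀ a b, γ a b = ∑ i, B i a * B i b) :
    ∑ a, ∑ b, ∑ c, ∑ d, γ a c * γ b d * k a b * k c d =
      ∑ i, ∑ j, (∑ a, ∑ b, B i a * B j b * k a b) ^ 2 := by
  have h1 : ∀ a b c d, γ a c * γ b d * k a b * k c d =
      ∑ i, ∑ j, (B i a * B j b * k a b) * (B i c * B j d * k c d) := by
    intro a b c d
    rw [hγ, hγ, Finset.sum_mul_sum, Finset.sum_mul, Finset.sum_mul]
    refine Finset.sum_congr rfl fun i _ => ?_
    rw [Finset.sum_mul, Finset.sum_mul]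
    exact Finset.sum_congr rfl fun j _ => by ring
  have h2 : ∀ i j, (∑ a, ∑ b, B i a * B j b * k a b) ^ 2 =
      ∑ a, ∑ b, ∑ c, ∑ d, (B i a * B j b * k a b) * (B i c * B j d * k c d) := by
    intro i j
    rw [sq, Finset.sum_mul]
    refine Finset.sum_congr rfl fun a _ => ?_
    rw [Finset.sum_mul]
    refine Finset.sum_congr rfl fun b _ => ?_
    rw [Finset.mul_sum]
    exact Finset.sum_congr rfl fun c _ => by rw [Finset.mul_sum]
  simp only [h1, h2]
  set F := fun a b c d i j => (B i a * B j b * k a b) * (B i c * B j d * k c d)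
  calc ∑ a, ∑ b, ∑ c, ∑ d, ∑ i, ∑ j, F a b c d i j
      = ∑ a, ∑ b, ∑ c, ∑ i, ∑ j, ∑ d, F a b c d i j :=
        Finset.sum_congr rfl fun a _ => Finset.sum_congr rfl fun b _ =>
          Finset.sum_congr rfl fun c _ => sum_rotate _
    _ = ∑ a, ∑ b, ∑ i, ∑ j, ∑ c, ∑ d, F a b c d i j :=
        Finset.sum_congr rfl fun a _ => Finset.sum_congr rfl fun b _ => sum_rotate _
    _ = ∑ a, ∑ i, ∑ j, ∑ b, ∑ c, ∑ d, F a b c d i j :=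
        Finset.sum_congr rfl fun a _ => sum_rotate _
    _ = ∑ i, ∑ j, ∑ a, ∑ b, ∑ c, ∑ d, F a b c d i j := sum_rotate _

lemma sum_factor_trace (B k : Matrix (Fin 4) (Fin 4) ℝ) (γ : Fin 4 → Fin 4 → ℝ)
    (hγ : ∀ a b, γ a b = ∑ i, B i a * B i b) :
    ∑ a, ∑ b, γ a b * k a b = ∑ i, ∑ a, ∑ b, B i a * B i b * k a b := by
  simp only [hγ, Finset.sum_mul]
  exact (sum_rotate (fun i a b => B i a * B i b * k a b)).symm

/-- Cauchy-Schwarz for the diagonal components of `k` in the frame `B`, followed by dropping the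
off-diagonal squares. The constant is `4` because `B` has four rows, although the horizontal space
has dimension three. -/
lemma IsLorentz.trace_sq_le {A : Matrix (Fin 4) (Fin 4) ℝ} (hA : IsLorentz A)
    {T : Fin 4 → ℝ} (hT : T ⬝ᵥ A *ᵥ T = -1) (k : Matrix (Fin 4) (Fin 4) ℝ) :
    (∑ a, ∑ b, (A⁻¹ a b + T a * T b) * k a b) ^ 2 ≤
      4 * ∑ a, ∑ b, ∑ c, ∑ d,
        (A⁻¹ a c + T a * T c) * (A⁻¹ b d + T b * T d) * k a b * k c d := by
  obtain ⟨B, hB⟩ := hA.exists_factor hT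
  rw [sum_factor_trace B k (fun a b => A⁻¹ a b + T a * T b) hB,
    sum_factor_sq B k (fun a b => A⁻¹ a b + T a * T b) hB]
  have h1 := sq_sum_le_card_mul_sum_sq (s := (Finset.univ : Finset (Fin 4)))
    (f := fun i => ∑ a, ∑ b, B i a * B i b * k a b)
  simp only [Finset.card_univ, Fintype.card_fin] at h1
  refine h1.trans ?_
  push_cast
  gcongr with i
  exact Finset.single_le_sum (f := fun j => (∑ a, ∑ b, B i a * B j b * k a b) ^ 2)
    (fun j _ => sq_nonneg _) (Finset.mem_univ i)

lemma IsLorentz.norm_nonneg {A : Matrix (Fin 4) (Fin 4) ℝ} (hA : IsLorentz A)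
    {T : Fin 4 → ℝ} (hT : T ⬝ᵥ A *ᵥ T = -1) (k : Matrix (Fin 4) (Fin 4) ℝ) :
    0 ≤ ∑ a, ∑ b, ∑ c, ∑ d,
        (A⁻¹ a c + T a * T c) * (A⁻¹ b d + T b * T d) * k a b * k c d := by
  obtain ⟨B, hB⟩ := hA.exists_factor hT
  rw [sum_factor_sq B k (fun a b => A⁻¹ a b + T a * T b) hB]
  positivity

lemma IsLorentz.horiz_nonneg {A : Matrix (Fin 4) (Fin 4) ℝ} (hA : IsLorentz A)
    {T : Fin 4 → ℝ} (hT : T ⬝ᵥ A *ᵥ T = -1) (v : Fin 4 → ℝ) :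
    0 ≤ ∑ a, ∑ b, (A⁻¹ a b + T a * T b) * v a * v b := by
  have := (hA.posSemidef hT).dotProduct_mulVec_nonneg v
  rw [star_trivial] at this
  refine this.trans_eq ?_
  simp only [dotProduct, mulVec, Finset.mul_sum, Matrix.add_apply, vecMulVec_apply]
  exact Finset.sum_congr rfl fun a _ => Finset.sum_congr rfl fun b _ => by ring

/-- The inverse metric in terms of a unit normal `T` and a basis of the horizontal vectors. -/
lemma inv_eq_of_adapted_frame {A : Matrix (Fin 4) (Fin 4) ℝ} {T : Fin 4 → ℝ}
    {V : Matrix (Fin 3) (Fin 4) ℝ} (hA : IsLorentz A) (hT : T ⬝ᵥ A *ᵥ T = -1)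
    (hV : ∀ i, T ⬝ᵥ A *ᵥ (V i) = 0) (hdet : (V * A * Vᵀ).det ≠ 0) :
    Vᵀ * (V * A * Vᵀ)⁻¹ * V = A⁻¹ + vecMulVec T T := by
  set W : Matrix (Unit ⊕ Fin 3) (Fin 4) ℝ := fromRows (Matrix.of fun _ => T) V with hW
  set R := V * A * Vᵀ with hR
  -- In the full frame consisting of `T` and the rows of `V` the metric is block diagonal, so its
  -- inverse can be read off and transformed back.
  have h1 : W * A * Wᵀ = fromBlocks (-1) 0 0 R := by
    rw [hW, fromRows_mul, transpose_fromRows, fromRows_mul_fromCols]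
    congr 1
    · ext i j
      have : (of (fun _ : Unit => T) * A * (of fun _ : Unit => T)ᵀ) i j = T ⬝ᵥ A *ᵥ T := by
        rw [Matrix.mul_assoc, mul_apply, dotProduct]
        simp [mulVec, dotProduct, mul_apply]
      rw [this, hT]
      simp
    · ext i j
      have : (of (fun _ : Unit => T) * A * Vᵀ) i j = T ⬝ᵥ A *ᵥ (V j) := by
        rw [Matrix.mul_assoc, mul_apply, dotProduct]
        simp [mulVec, dotProduct, mul_apply]
      rw [this, hV]; rfl
    · ext i j
      have : (V * A * (of fun _ : Unit => T)ᵀ) i j = V i ⬝ᵥ A *ᵥ T := by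
        rw [Matrix.mul_assoc, mul_apply, dotProduct]
        simp [mulVec, dotProduct, mul_apply]
      rw [this, hA.dotProduct_comm, hV]; rfl
  set D : Matrix (Unit ⊕ Fin 3) (Unit ⊕ Fin 3) ℝ := fromBlocks (-1) 0 0 R⁻¹ with hD
  have h2 : (W * A) * (Wᵀ * D) = 1 := by
    rw [← Matrix.mul_assoc, h1, hD, fromBlocks_multiply, mul_nonsing_inv _ hdet.isUnit]
    simp
  -- The two factors are square only up to the bijection between `Unit ⊕ Fin 3` and `Fin 4`; through
  -- it a right inverse is also a left inverse.
  have h3 : (Wᵀ * D) * (W * A) = 1 := by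
    have e : Unit ⊕ Fin 3 ≃ Fin 4 := Fintype.equivOfCardEq (by simp)
    exact (mul_eq_one_comm_of_equiv e).1 h2
  rw [← Matrix.mul_assoc] at h3
  have h4 := inv_eq_left_inv h3
  rw [h4, hW, hD, transpose_fromRows, fromCols_mul_fromBlocks, fromCols_mul_fromRows]
  ext a b
  simp [vecMulVec_apply, mul_apply]

end

/-! ### Calculus of coordinate derivatives -/

section Calculus

variable {Ω : Set E4} {f h : E4 → ℝ} {y : E4}

lemma pd_add (a : Fin 4) (hf : DifferentiableAt ℝ f y) (hh : DifferentiableAt ℝ h y) :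
    pd a (fun z => f z + h z) y = pd a f y + pd a h y := by
  simp only [pd]; rw [fderiv_fun_add hf hh]; rfl

lemma pd_neg (a : Fin 4) : pd a (fun z => -f z) y = -pd a f y := by
  simp only [pd]; rw [fderiv_fun_neg]; rfl

lemma pd_mul (a : Fin 4) (hf : DifferentiableAt ℝ f y) (hh : DifferentiableAt ℝ h y) :
    pd a (fun z => f z * h z) y = pd a f y * h y + f y * pd a h y := by
  simp only [pd]; rw [fderiv_fun_mul hf hh]
  simp only [_root_.add_apply, _root_.smul_apply, smul_eq_mul]; ring

lemma pd_sum {ι : Type*} (s : Finset ι) (F : ι → E4 → ℝ) (a : Fin 4)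
    (hF : ∀ i ∈ s, DifferentiableAt ℝ (F i) y) :
    pd a (fun z => ∑ i ∈ s, F i z) y = ∑ i ∈ s, pd a (F i) y := by
  simp only [pd]; rw [fderiv_fun_sum hF]; simp

lemma pd_const (a : Fin 4) (c : ℝ) : pd a (fun _ => c) y = 0 := by
  simp [pd]

lemma pd_congr (a : Fin 4) (hΩ : IsOpen Ω) (hfh : ∀ z ∈ Ω, f z = h z) (hy : y ∈ Ω) :
    pd a f y = pd a h y := by
  simp only [pd]
  rw [Filter.EventuallyEq.fderiv_eq (Filter.eventuallyEq_of_mem (hΩ.mem_nhds hy) hfh)]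

lemma differentiableAt_of_smooth (hΩ : IsOpen Ω) (hf : ContDiffOn ℝ ∞ f Ω) (hy : y ∈ Ω) :
    DifferentiableAt ℝ f y :=
  (hf.contDiffAt (hΩ.mem_nhds hy)).differentiableAt (by simp)

lemma smooth_pd (hΩ : IsOpen Ω) (hf : ContDiffOn ℝ ∞ f Ω) (a : Fin 4) :
    ContDiffOn ℝ ∞ (pd a f) Ω := by
  have h1 : ContDiffOn ℝ ∞ (fderiv ℝ f) Ω := hf.fderiv_of_isOpen hΩ (by simp)
  exact h1.clm_apply contDiffOn_const

lemma pd_comm (hΩ : IsOpen Ω) (hf : ContDiffOn ℝ ∞ f Ω) (hy : y ∈ Ω) (a b : Fin 4) :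
    pd a (pd b f) y = pd b (pd a f) y := by
  have hfy := hf.contDiffAt (hΩ.mem_nhds hy)
  have hsymm : IsSymmSndFDerivAt ℝ f y :=
    hfy.isSymmSndFDerivAt (by
      rw [minSmoothness_of_isRCLikeNormedField]
      exact WithTop.coe_le_coe.2 (le_top : (2 : ℕ∞) ≤ ⊤))
  have hd : DifferentiableAt ℝ (fderiv ℝ f) y :=
    ((hf.fderiv_of_isOpen hΩ (m := ∞) (by simp)).contDiffAt (hΩ.mem_nhds hy)).differentiableAt
      (by simp)
  have key : ∀ a b, pd a (pd b f) y =
      fderiv ℝ (fderiv ℝ f) y (EuclideanSpace.single a 1) (EuclideanSpace.single b 1) := by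
    intro a b
    have : fderiv ℝ (fun z => fderiv ℝ f z (EuclideanSpace.single b 1)) y =
        (fderiv ℝ (fderiv ℝ f) y).flip (EuclideanSpace.single b 1) := by
      rw [fderiv_clm_apply hd (differentiableAt_const _)]
      ext; simp
    change fderiv ℝ (fun z => fderiv ℝ f z (EuclideanSpace.single b 1)) y _ = _
    rw [this]; rfl
  rw [key, key, hsymm.eq]

lemma fderiv_eq_sum_pd (f : E4 → ℝ) (y v : E4) : fderiv ℝ f y v = ∑ a, v a * pd a f y := by
  have hv : v = ∑ a, v a • EuclideanSpace.single a (1 : ℝ) := by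
    ext i
    simp [Finset.sum_apply, Pi.single_apply]
  conv_lhs => rw [hv]
  simp [pd]

end Calculus

/-! ### Metrics and time functions on open sets of `ℝ⁴` -/

/-- `G` is a smooth Lorentzian metric on the open set `Ω`. -/
structure IsLorentzOn (Ω : Set E4) (G : E4 → Matrix (Fin 4) (Fin 4) ℝ) : Prop where
  isOpen : IsOpen Ω
  smooth : ∀ a b, ContDiffOn ℝ ∞ (fun y => G y a b) Ω
  lorentz : ∀ y ∈ Ω, IsLorentz (G y)

/-- `u` is a smooth function with timelike gradient on `Ω`. -/
structure IsTimeOn (Ω : Set E4) (G : E4 → Matrix (Fin 4) (Fin 4) ℝ) (u : E4 → ℝ) : Prop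
    extends IsLorentzOn Ω G where
  smooth_time : ContDiffOn ℝ ∞ u Ω
  timelike : ∀ y ∈ Ω, gradSq G u y < 0

section Local

variable {Ω : Set E4} {G : E4 → Matrix (Fin 4) (Fin 4) ℝ} {u : E4 → ℝ} {y : E4}

lemma IsLorentzOn.symm (h : IsLorentzOn Ω G) (hy : y ∈ Ω) (a b : Fin 4) : G y a b = G y b a :=
  (h.lorentz y hy).1.apply b a

lemma IsLorentzOn.inv_symm (h : IsLorentzOn Ω G) (hy : y ∈ Ω) (a b : Fin 4) :
    (G y)⁻¹ a b = (G y)⁻¹ b a := by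
  have : ((G y)⁻¹).transpose = (G y)⁻¹ := by rw [Matrix.transpose_nonsing_inv, (h.lorentz y hy).1.eq]
  exact congrFun (congrFun this.symm a) b

lemma IsLorentzOn.mul_inv (h : IsLorentzOn Ω G) (hy : y ∈ Ω) (a b : Fin 4) :
    ∑ c, G y a c * (G y)⁻¹ c b = if a = b then 1 else 0 := by
  have := congrFun (congrFun (Matrix.mul_nonsing_inv _ (h.lorentz y hy).isUnit_det) a) b
  rwa [Matrix.mul_apply, Matrix.one_apply] at this

lemma IsLorentzOn.inv_mul (h : IsLorentzOn Ω G) (hy : y ∈ Ω) (a b : Fin 4) :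
    ∑ c, (G y)⁻¹ a c * G y c b = if a = b then 1 else 0 := by
  have := congrFun (congrFun (Matrix.nonsing_inv_mul _ (h.lorentz y hy).isUnit_det) a) b
  rwa [Matrix.mul_apply, Matrix.one_apply] at this

lemma contDiffOn_det {n : ℕ} {A : E4 → Matrix (Fin n) (Fin n) ℝ}
    (hA : ∀ a b, ContDiffOn ℝ ∞ (fun y => A y a b) Ω) : ContDiffOn ℝ ∞ (fun y => (A y).det) Ω := by
  simp only [Matrix.det_apply]
  refine ContDiffOn.sum fun σ _ => ContDiffOn.const_smul _ ?_
  exact contDiffOn_prod fun i _ => hA _ _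

lemma IsLorentzOn.smooth_inv (h : IsLorentzOn Ω G) (a b : Fin 4) :
    ContDiffOn ℝ ∞ (fun y => (G y)⁻¹ a b) Ω := by
  simp only [Matrix.inv_def, Matrix.smul_apply, smul_eq_mul, Ring.inverse_eq_inv',
    Matrix.adjugate_apply]
  refine ContDiffOn.mul (ContDiffOn.inv (contDiffOn_det h.smooth)
    fun y hy => (h.lorentz y hy).det_ne_zero) (contDiffOn_det fun c d => ?_)
  simp only [Matrix.updateRow_apply]
  split_ifs
  · exact contDiffOn_const
  · exact h.smooth _ _

lemma IsLorentzOn.smooth_christoffel (h : IsLorentzOn Ω G) (a b c : Fin 4) :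
    ContDiffOn ℝ ∞ (christoffel G a b c) Ω := by
  unfold christoffel
  refine contDiffOn_const.mul (ContDiffOn.sum fun d _ => (h.smooth_inv a d).mul ?_)
  exact ((smooth_pd h.isOpen (h.smooth d c) b).add (smooth_pd h.isOpen (h.smooth d b) c)).sub
    (smooth_pd h.isOpen (h.smooth b c) d)

lemma IsTimeOn.smooth_grad (h : IsTimeOn Ω G u) (a : Fin 4) :
    ContDiffOn ℝ ∞ (grad G u a) Ω :=
  ContDiffOn.sum fun b _ => (h.smooth_inv a b).mul (smooth_pd h.isOpen h.smooth_time b)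

lemma IsTimeOn.smooth_gradSq (h : IsTimeOn Ω G u) : ContDiffOn ℝ ∞ (gradSq G u) Ω :=
  ContDiffOn.sum fun a _ => ContDiffOn.sum fun b _ =>
    ((h.smooth a b).mul (h.smooth_grad a)).mul (h.smooth_grad b)

lemma IsTimeOn.lapse_eq (h : IsTimeOn Ω G u) (hy : y ∈ Ω) :
    lapseLoc G u y = (Real.sqrt (-gradSq G u y))⁻¹ := by
  rw [lapseLoc, abs_of_neg (h.timelike y hy)]

lemma IsTimeOn.lapse_pos (h : IsTimeOn Ω G u) (hy : y ∈ Ω) : 0 < lapseLoc G u y := by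
  rw [h.lapse_eq hy]
  exact inv_pos.2 (Real.sqrt_pos.2 (by linarith [h.timelike y hy]))

lemma IsTimeOn.lapse_sq_mul (h : IsTimeOn Ω G u) (hy : y ∈ Ω) :
    lapseLoc G u y * lapseLoc G u y * gradSq G u y = -1 := by
  have h1 : 0 < -gradSq G u y := by linarith [h.timelike y hy]
  have h2 := Real.mul_self_sqrt h1.le
  have h3 := Real.sqrt_pos.2 h1
  rw [h.lapse_eq hy]
  have h4 : gradSq G u y = -(√(-gradSq G u y) * √(-gradSq G u y)) := by linarith
  generalize √(-gradSq G u y) = s at *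
  rw [h4]
  field_simp

lemma IsTimeOn.smooth_lapse (h : IsTimeOn Ω G u) : ContDiffOn ℝ ∞ (lapseLoc G u) Ω := by
  have h1 : ContDiffOn ℝ ∞ (fun y => (Real.sqrt (-gradSq G u y))⁻¹) Ω := by
    refine ContDiffOn.inv (ContDiffOn.sqrt h.smooth_gradSq.neg fun y hy => ?_) fun y hy => ?_
    · linarith [h.timelike y hy]
    · exact (Real.sqrt_pos.2 (by linarith [h.timelike y hy])).ne'
  exact h1.congr fun y hy => h.lapse_eq hy

lemma IsTimeOn.smooth_log_lapse (h : IsTimeOn Ω G u) :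
    ContDiffOn ℝ ∞ (fun z => Real.log (lapseLoc G u z)) Ω :=
  h.smooth_lapse.log fun _ hy => (h.lapse_pos hy).ne'

lemma IsTimeOn.smooth_normal (h : IsTimeOn Ω G u) (a : Fin 4) :
    ContDiffOn ℝ ∞ (normal G u a) Ω :=
  (h.smooth_lapse.mul (h.smooth_grad a)).neg

lemma IsLorentzOn.lower_grad (h : IsLorentzOn Ω G) (hy : y ∈ Ω) (a : Fin 4) :
    ∑ b, G y a b * grad G u b y = pd a u y := by
  simp only [grad, Finset.mul_sum]
  rw [Finset.sum_comm]
  have : ∀ c, ∑ b, G y a b * ((G y)⁻¹ b c * pd c u y) = (if a = c then 1 else 0) * pd c u y := by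
    intro c
    rw [← h.mul_inv hy, Finset.sum_mul]
    exact Finset.sum_congr rfl fun b _ => by ring
  simp [this]

lemma IsLorentzOn.gradSq_eq (h : IsLorentzOn Ω G) (hy : y ∈ Ω) :
    gradSq G u y = ∑ a, grad G u a y * pd a u y := by
  simp only [gradSq]
  refine Finset.sum_congr rfl fun a _ => ?_
  rw [← h.lower_grad hy, Finset.mul_sum]
  exact Finset.sum_congr rfl fun b _ => by ring

lemma IsLorentzOn.lower_normal (h : IsLorentzOn Ω G) (hy : y ∈ Ω) (a : Fin 4) :
    ∑ b, G y a b * normal G u b y = -(lapseLoc G u y * pd a u y) := by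
  rw [← h.lower_grad hy, Finset.mul_sum, ← Finset.sum_neg_distrib]
  exact Finset.sum_congr rfl fun b _ => by rw [normal]; ring

lemma IsTimeOn.normal_time (h : IsTimeOn Ω G u) (hy : y ∈ Ω) :
    ∑ a, normal G u a y * pd a u y = (lapseLoc G u y)⁻¹ := by
  have h1 : ∑ a, normal G u a y * pd a u y = -(lapseLoc G u y * gradSq G u y) := by
    rw [h.gradSq_eq hy, Finset.mul_sum, ← Finset.sum_neg_distrib]
    exact Finset.sum_congr rfl fun b _ => by rw [normal]; ring
  rw [h1]
  have := h.lapse_sq_mul hy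
  have h2 := (h.lapse_pos hy).ne'
  field_simp
  linarith

lemma IsTimeOn.normal_unit (h : IsTimeOn Ω G u) (hy : y ∈ Ω) :
    ∑ a, normal G u a y * ∑ b, G y a b * normal G u b y = -1 := by
  have h2 := (h.lapse_pos hy).ne'
  calc _ = ∑ a, -lapseLoc G u y * (normal G u a y * pd a u y) :=
        Finset.sum_congr rfl fun a _ => by rw [h.lower_normal hy]; ring
    _ = -1 := by rw [← Finset.mul_sum, h.normal_time hy]; field_simp

lemma IsTimeOn.normal_unit' (h : IsTimeOn Ω G u) (hy : y ∈ Ω) :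
    (fun a => normal G u a y) ⬝ᵥ (G y).mulVec (fun a => normal G u a y) = -1 :=
  h.normal_unit hy

/-- The differential of `u` is a multiple of the covector dual to `T`, which the projection
annihilates. All terms containing `du` therefore disappear from horizontal contractions. -/
lemma IsTimeOn.horizInv_time (h : IsTimeOn Ω G u) (hy : y ∈ Ω) (a : Fin 4) :
    ∑ b, horizInv G u a b y * pd b u y = 0 := by
  have h2 := (h.lapse_pos hy).ne'
  have h1 : ∑ b, horizInv G u a b y * pd b u y =
      grad G u a y + normal G u a y * ∑ b, normal G u b y * pd b u y := by
    rw [grad, Finset.mul_sum, ← Finset.sum_add_distrib]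
    exact Finset.sum_congr rfl fun b _ => by rw [horizInv]; ring
  rw [h1, h.normal_time hy, normal]
  field_simp
  ring

lemma IsTimeOn.smooth_horizInv (h : IsTimeOn Ω G u) (a b : Fin 4) :
    ContDiffOn ℝ ∞ (horizInv G u a b) Ω :=
  (h.smooth_inv a b).add ((h.smooth_normal a).mul (h.smooth_normal b))

/-! ### The Levi-Civita connection -/

lemma IsLorentzOn.pd_symm (h : IsLorentzOn Ω G) (hy : y ∈ Ω) (a b c : Fin 4) :
    pd a (fun z => G z b c) y = pd a (fun z => G z c b) y :=
  pd_congr a h.isOpen (fun _ hz => h.symm hz b c) hy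

lemma IsLorentzOn.christoffel_symm (h : IsLorentzOn Ω G) (hy : y ∈ Ω) (a b c : Fin 4) :
    christoffel G a b c y = christoffel G a c b y := by
  simp only [christoffel]
  congr 1
  refine Finset.sum_congr rfl fun d _ => ?_
  rw [h.pd_symm hy d b c]
  ring

lemma IsLorentzOn.lower_christoffel (h : IsLorentzOn Ω G) (hy : y ∈ Ω) (e b c : Fin 4) :
    ∑ a, G y e a * christoffel G a b c y =
      (1 / 2) * (pd b (fun z => G z e c) y + pd c (fun z => G z e b) y -
        pd e (fun z => G z b c) y) := by
  simp only [christoffel]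
  set Q := fun d => pd b (fun z => G z d c) y + pd c (fun z => G z d b) y -
        pd d (fun z => G z b c) y with hQ
  have h1 : ∀ a, G y e a * (1 / 2 * ∑ d, (G y)⁻¹ a d * Q d) =
      ∑ d, (1 / 2) * ((G y e a * (G y)⁻¹ a d) * Q d) := by
    intro a
    rw [Finset.mul_sum, Finset.mul_sum]
    exact Finset.sum_congr rfl fun d _ => by ring
  change ∑ a, G y e a * (1 / 2 * ∑ d, (G y)⁻¹ a d * Q d) = (1 / 2) * Q e
  simp only [h1]
  rw [Finset.sum_comm]
  have h2 : ∀ d, ∑ a, (1 / 2) * ((G y e a * (G y)⁻¹ a d) * Q d) =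
      (if e = d then 1 else 0) * ((1 / 2) * Q d) := by
    intro d
    rw [← h.mul_inv hy, Finset.sum_mul]
    exact Finset.sum_congr rfl fun a _ => by ring
  simp only [h2, ite_mul, one_mul, zero_mul, Finset.sum_ite_eq, Finset.mem_univ, if_true]

/-- The identity `Dg = 0`, obtained by adding two lowered Christoffel symbols: the derivatives other
than `∂_c g_ab` cancel in pairs. -/
lemma IsLorentzOn.metric_compat (h : IsLorentzOn Ω G) (hy : y ∈ Ω) (a b c : Fin 4) :
    pd c (fun z => G z a b) y =
      ∑ d, (G y a d * christoffel G d c b y + G y b d * christoffel G d c a y) := by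
  rw [Finset.sum_add_distrib, h.lower_christoffel hy, h.lower_christoffel hy,
    h.pd_symm hy a b c, h.pd_symm hy c b a, h.pd_symm hy b a c]
  ring

end Local

section

lemma pd_sum_mul {F H : Fin 4 → E4 → ℝ} {y : E4} (a : Fin 4)
    (hF : ∀ i, DifferentiableAt ℝ (F i) y) (hH : ∀ i, DifferentiableAt ℝ (H i) y) :
    pd a (fun z => ∑ i, F i z * H i z) y =
      ∑ i, (pd a (F i) y * H i y + F i y * pd a (H i) y) := by
  rw [pd_sum Finset.univ (fun i z => F i z * H i z) a fun i _ => (hF i).mul (hH i)]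
  exact Finset.sum_congr rfl fun i _ => pd_mul a (hF i) (hH i)

/-! ### The lapse equation -/

/-- The Raychaudhuri identity, as an algebraic identity between the derivatives of a vector
field `T` and the connection coefficients `Γ` at a point; `M c b` is `D_c T^b`. -/
lemma raychaudhuri_algebra (T : Fin 4 → ℝ) (dT : Fin 4 → Fin 4 → ℝ)
    (ddT : Fin 4 → Fin 4 → Fin 4 → ℝ) (Γ : Fin 4 → Fin 4 → Fin 4 → ℝ)
    (dΓ : Fin 4 → Fin 4 → Fin 4 → Fin 4 → ℝ) (M : Fin 4 → Fin 4 → ℝ)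
    (hM : ∀ b a, M b a = dT b a + ∑ d, Γ a b d * T d)
    (hddT : ∀ a b c, ddT a b c = ddT b a c) (hΓ : ∀ a b c, Γ a b c = Γ a c b)
    (hdΓ : ∀ e a b c, dΓ e a b c = dΓ e a c b) :
    ∑ c, T c * ∑ b, (ddT c b b + ∑ d, (dΓ c b b d * T d + Γ b b d * dT c d)) =
      ∑ b, ∑ c, (dT b c * M c b +
          T c * (ddT b c b + ∑ d, (dΓ b b c d * T d + Γ b c d * dT b d)))
        + ∑ b, ∑ d, Γ b b d * ∑ c, T c * M c d
        - ∑ b, ∑ c, M c b * M b c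
        - ∑ b, ∑ c, (∑ a, (dΓ a a b c - dΓ c a b a +
            ∑ d, (Γ a a d * Γ d b c - Γ a c d * Γ d b a))) * T b * T c := by
  -- Both sides are expanded into monomials in `T`, `Γ` and their derivatives, by `e1` to `e5`. The
  -- identities `f1` to `f7` then match them by renaming indices, using the symmetry of second
  -- derivatives and of `Γ`. The products `dT b c * M c b` are left unexpanded because they cancel
  -- as they stand.
  have e1 : ∑ c, T c * ∑ b, (ddT c b b + ∑ d, (dΓ c b b d * T d + Γ b b d * dT c d)) =
      ∑ c, ∑ b, T c * ddT c b b + ∑ c, ∑ b, ∑ d, T c * dΓ c b b d * T d +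
      ∑ c, ∑ b, ∑ d, T c * Γ b b d * dT c d := by
    simp only [Finset.mul_sum, ← Finset.sum_add_distrib, mul_add, mul_assoc]
    simp only [Finset.sum_add_distrib]; ring
  have e2 : ∑ b, ∑ c, (dT b c * M c b +
          T c * (ddT b c b + ∑ d, (dΓ b b c d * T d + Γ b c d * dT b d))) =
      ∑ b, ∑ c, dT b c * M c b + ∑ b, ∑ c, T c * ddT b c b +
      ∑ b, ∑ c, ∑ d, T c * dΓ b b c d * T d + ∑ b, ∑ c, ∑ d, T c * Γ b c d * dT b d := by
    simp only [Finset.mul_sum, mul_add, mul_assoc, Finset.sum_add_distrib]; ring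
  have e3 : ∑ b, ∑ d, Γ b b d * ∑ c, T c * M c d =
      ∑ b, ∑ d, ∑ c, Γ b b d * T c * dT c d +
      ∑ b, ∑ d, ∑ c, ∑ e, Γ b b d * T c * Γ d c e * T e := by
    simp only [hM, Finset.mul_sum, mul_add, mul_assoc, Finset.sum_add_distrib]
  have e4 : ∑ b, ∑ c, M c b * M b c = ∑ b, ∑ c, dT b c * M c b +
      ∑ b, ∑ c, ∑ d, Γ c b d * T d * dT c b +
      ∑ b, ∑ c, ∑ d, ∑ e, Γ c b d * T d * Γ b c e * T e := by
    have : ∀ b c, M c b * M b c = dT b c * M c b + ∑ d, Γ c b d * T d * dT c b +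
        ∑ d, ∑ e, Γ c b d * T d * Γ b c e * T e := by
      intro b c
      have h1 : ∑ d, Γ c b d * T d * dT c b + ∑ d, ∑ e, Γ c b d * T d * Γ b c e * T e =
          (∑ d, Γ c b d * T d) * M c b := by
        rw [hM c b, Finset.sum_mul, ← Finset.sum_add_distrib]
        refine Finset.sum_congr rfl fun d _ => ?_
        rw [mul_add, Finset.mul_sum]
        congr 1
        exact Finset.sum_congr rfl fun e _ => by ring
      rw [add_assoc, h1, hM b c]
      ring
    simp only [this, Finset.sum_add_distrib]
  have e5 : ∑ b, ∑ c, (∑ a, (dΓ a a b c - dΓ c a b a +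
            ∑ d, (Γ a a d * Γ d b c - Γ a c d * Γ d b a))) * T b * T c =
      ∑ b, ∑ c, ∑ a, dΓ a a b c * T b * T c - ∑ b, ∑ c, ∑ a, dΓ c a b a * T b * T c +
      (∑ b, ∑ c, ∑ a, ∑ d, Γ a a d * Γ d b c * T b * T c -
      ∑ b, ∑ c, ∑ a, ∑ d, Γ a c d * Γ d b a * T b * T c) := by
    simp only [Finset.sum_mul, add_mul, sub_mul, Finset.sum_add_distrib, Finset.sum_sub_distrib]
  have f1 : ∑ c, ∑ b, T c * ddT c b b = ∑ b, ∑ c, T c * ddT b c b := by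
    rw [Finset.sum_comm]
    exact Finset.sum_congr rfl fun b _ => Finset.sum_congr rfl fun c _ => by rw [hddT c b b]
  have f2 : ∑ c, ∑ b, ∑ d, T c * dΓ c b b d * T d =
      ∑ b, ∑ c, ∑ a, dΓ c a b a * T b * T c := by
    rw [Finset.sum_comm]
    calc _ = ∑ b, ∑ d, ∑ c, T c * dΓ c b b d * T d :=
          Finset.sum_congr rfl fun b _ => Finset.sum_comm
      _ = ∑ d, ∑ c, ∑ b, T c * dΓ c b b d * T d := sum_rotate _
      _ = _ := by
          refine Finset.sum_congr rfl fun b _ => Finset.sum_congr rfl fun c _ =>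
            Finset.sum_congr rfl fun a _ => ?_
          rw [hdΓ c a a b]; ring
  have f3 : ∑ b, ∑ c, ∑ d, T c * dΓ b b c d * T d = ∑ b, ∑ c, ∑ a, dΓ a a b c * T b * T c := by
    rw [sum_rotate (fun b c d => T c * dΓ b b c d * T d)]
    exact Finset.sum_congr rfl fun b _ => Finset.sum_congr rfl fun c _ =>
      Finset.sum_congr rfl fun a _ => by ring
  have f4 : ∑ c, ∑ b, ∑ d, T c * Γ b b d * dT c d = ∑ b, ∑ d, ∑ c, Γ b b d * T c * dT c d := by
    rw [sum_rotate (fun c b d => T c * Γ b b d * dT c d)]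
    exact Finset.sum_congr rfl fun b _ => Finset.sum_congr rfl fun c _ =>
      Finset.sum_congr rfl fun a _ => by ring
  have f5 : ∑ b, ∑ c, ∑ d, Γ c b d * T d * dT c b = ∑ b, ∑ c, ∑ d, T c * Γ b c d * dT b d := by
    rw [sum_rotate (fun b c d => Γ c b d * T d * dT c b)]
    refine Finset.sum_congr rfl fun b _ => Finset.sum_congr rfl fun c _ =>
      Finset.sum_congr rfl fun a _ => ?_
    rw [hΓ b a c]; ring
  have f6 : ∑ b, ∑ d, ∑ c, ∑ e, Γ b b d * T c * Γ d c e * T e =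
      ∑ b, ∑ c, ∑ a, ∑ d, Γ a a d * Γ d b c * T b * T c := by
    calc _ = ∑ b, ∑ c, ∑ e, ∑ d, Γ b b d * T c * Γ d c e * T e :=
          Finset.sum_congr rfl fun b _ => sum_rotate _
      _ = ∑ c, ∑ e, ∑ b, ∑ d, Γ b b d * T c * Γ d c e * T e := sum_rotate _
      _ = _ := Finset.sum_congr rfl fun b _ => Finset.sum_congr rfl fun c _ =>
        Finset.sum_congr rfl fun a _ => Finset.sum_congr rfl fun d _ => by ring
  have f7 : ∑ b, ∑ c, ∑ d, ∑ e, Γ c b d * T d * Γ b c e * T e =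
      ∑ b, ∑ c, ∑ a, ∑ d, Γ a c d * Γ d b a * T b * T c := by
    calc _ = ∑ b, ∑ d, ∑ e, ∑ c, Γ c b d * T d * Γ b c e * T e :=
          Finset.sum_congr rfl fun b _ => sum_rotate _
      _ = ∑ d, ∑ e, ∑ b, ∑ c, Γ c b d * T d * Γ b c e * T e := sum_rotate _
      _ = ∑ e, ∑ d, ∑ b, ∑ c, Γ c b d * T d * Γ b c e * T e := Finset.sum_comm
      _ = ∑ e, ∑ d, ∑ c, ∑ b, Γ c b d * T d * Γ b c e * T e :=
        Finset.sum_congr rfl fun e _ => Finset.sum_congr rfl fun d _ => Finset.sum_comm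
      _ = _ := by
        refine Finset.sum_congr rfl fun b _ => Finset.sum_congr rfl fun c _ =>
          Finset.sum_congr rfl fun a _ => Finset.sum_congr rfl fun d _ => ?_
        rw [hΓ a c d, hΓ d b a]; ring
  rw [e1, e2, e3, e4, e5, f1, f2, f3, f4, f5, f6, f7]
  ring


open Matrix in
/-- If `P` is, up to the terms with `ν` and `Tl`, symmetric, the square of the horizontal part of
`P` is the trace of the square of `P`. -/
lemma horiz_sq_eq_trace_sq (I P : Matrix (Fin 4) (Fin 4) ℝ) (T Tl ν : Fin 4 → ℝ) (t : ℝ)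
    (hI : Iᵀ = I) (hIT : I *ᵥ Tl = T) (hPT : P *ᵥ T = 0)
    (hsym : Pᵀ = P - vecMulVec ν Tl + vecMulVec Tl ν) (hA : T ᵥ* P = ν + t • Tl) :
    ∑ a, ∑ b, ∑ c, ∑ d, (I a c + T a * T c) * (I b d + T b * T d) * P a b * P c d =
      ∑ b, ∑ c, (P * I) c b * (P * I) b c := by
  have h1 : ∑ a, ∑ b, ∑ c, ∑ d, (I a c + T a * T c) * (I b d + T b * T d) * P a b * P c d =
      trace ((I + vecMulVec T T) * P * (I + vecMulVec T T) * Pᵀ) := by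
    have hs : ∀ c a, (I + vecMulVec T T) c a = I a c + T a * T c := by
      intro c a
      rw [Matrix.add_apply, vecMulVec_apply, ← congrFun (congrFun hI c) a, transpose_apply,
        mul_comm (T a)]
    have hs' : ∀ c a, (I + vecMulVec T T) c a = I c a + T c * T a := fun c a => by
      rw [Matrix.add_apply, vecMulVec_apply]
    simp only [trace, diag_apply, mul_apply, Finset.sum_mul, transpose_apply]
    calc _ = ∑ a, ∑ c, ∑ d, ∑ b, (I a c + T a * T c) * (I b d + T b * T d) * P a b * P c d :=
          Finset.sum_congr rfl fun a _ => sum_rotate _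
      _ = ∑ c, ∑ d, ∑ a, ∑ b, (I a c + T a * T c) * (I b d + T b * T d) * P a b * P c d :=
          sum_rotate _
      _ = ∑ c, ∑ d, ∑ b, ∑ a, (I a c + T a * T c) * (I b d + T b * T d) * P a b * P c d :=
          Finset.sum_congr rfl fun c _ => Finset.sum_congr rfl fun d _ => Finset.sum_comm
      _ = _ := by
          refine Finset.sum_congr rfl fun c _ => Finset.sum_congr rfl fun d _ =>
            Finset.sum_congr rfl fun b _ => Finset.sum_congr rfl fun a _ => ?_
          rw [hs, hs']; ring
  have h2 : ∑ b, ∑ c, (P * I) c b * (P * I) b c = trace (P * I * (P * I)) := by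
    simp only [trace, diag_apply]
    refine Finset.sum_congr rfl fun b _ => ?_
    rw [mul_apply]
    exact Finset.sum_congr rfl fun c _ => mul_comm _ _
  have hTI : Tl ᵥ* I = T := by rw [← mulVec_transpose, hI, hIT]
  have hAT : (ν + t • Tl) ⬝ᵥ T = 0 := by rw [← hA, ← dotProduct_mulVec, hPT, dotProduct_zero]
  -- Since `P T = 0`, the projection in the second slot may be dropped. In the first slot it costs
  -- the square of the acceleration covector `ν + t Tl`. Replacing `Pᵀ` by `P` in `h4` subtracts the
  -- same amount, because the acceleration is orthogonal to `T` (`h5`).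
  have h3 : trace ((I + vecMulVec T T) * P * (I + vecMulVec T T) * Pᵀ) =
      trace (I * P * I * Pᵀ) + (ν + t • Tl) ⬝ᵥ I *ᵥ (ν + t • Tl) := by
    have e1 : P * (I + vecMulVec T T) = P * I := by
      rw [Matrix.mul_add, mul_vecMulVec, hPT]
      ext; simp
    rw [Matrix.mul_assoc (I + _), e1, Matrix.add_mul, Matrix.add_mul, trace_add,
      ← Matrix.mul_assoc I P I]
    congr 1
    rw [vecMulVec_mul, vecMulVec_mul, trace_vecMulVec, ← vecMul_vecMul, hA, vecMul_transpose,
      dotProduct_mulVec, ← mulVec_transpose I, hI, hA]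
  have h4 : trace (I * P * I * Pᵀ) = trace (P * I * (P * I)) - (ν + t • Tl) ⬝ᵥ I *ᵥ ν := by
    rw [hsym, Matrix.mul_add, Matrix.mul_sub, trace_add, trace_sub, mul_vecMulVec, mul_vecMulVec,
      trace_vecMulVec, trace_vecMulVec, ← mulVec_mulVec Tl, hIT, ← mulVec_mulVec T, hPT,
      mulVec_zero, zero_dotProduct, add_zero]
    congr 1
    · rw [Matrix.mul_assoc, Matrix.mul_assoc, trace_mul_comm]
      simp only [Matrix.mul_assoc]
    · rw [dotProduct_comm, ← mulVec_mulVec, ← mulVec_mulVec, dotProduct_mulVec, hTI,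
        dotProduct_mulVec, hA]
  have h5 : (ν + t • Tl) ⬝ᵥ I *ᵥ (ν + t • Tl) = (ν + t • Tl) ⬝ᵥ I *ᵥ ν := by
    rw [mulVec_add, mulVec_smul, hIT, dotProduct_add, dotProduct_smul, hAT]; simp
  rw [h1, h2, h3, h4, h5]; ring

section Local

variable {Ω : Set E4} {G : E4 → Matrix (Fin 4) (Fin 4) ℝ} {u : E4 → ℝ} {y : E4}

/-- The covariant derivative `D_b T^a` of the unit normal. -/
def derivNormal (G : E4 → Matrix (Fin 4) (Fin 4) ℝ) (u : E4 → ℝ) (b a : Fin 4) (y : E4) : ℝ :=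
  pd b (normal G u a) y + ∑ d, christoffel G a b d y * normal G u d y

lemma sff_eq (b c : Fin 4) : sff G u b c y = -∑ a, G y a c * derivNormal G u b a y := rfl

/-- The logarithm of the lapse. -/
def logLapse (G : E4 → Matrix (Fin 4) (Fin 4) ℝ) (u : E4 → ℝ) (y : E4) : ℝ :=
  Real.log (lapseLoc G u y)

lemma IsTimeOn.pd_lapse (h : IsTimeOn Ω G u) (hy : y ∈ Ω) (b : Fin 4) :
    pd b (lapseLoc G u) y = lapseLoc G u y * pd b (logLapse G u) y := by
  have h1 := (h.lapse_pos hy).ne'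
  have h2 := differentiableAt_of_smooth h.isOpen h.smooth_lapse hy
  have : pd b (logLapse G u) y = (lapseLoc G u y)⁻¹ * pd b (lapseLoc G u) y := by
    change fderiv ℝ (fun z => Real.log (lapseLoc G u z)) y _ = _
    rw [fderiv.log h2 h1]; rfl
  rw [this]; field_simp

/-- The components `D_b T_c` in terms of the Hessian of `u`. -/
lemma IsTimeOn.neg_sff_eq (h : IsTimeOn Ω G u) (hy : y ∈ Ω) (b c : Fin 4) :
    -sff G u b c y = -(lapseLoc G u y * (pd b (pd c u) y - ∑ d, christoffel G d b c y * pd d u y))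
      - pd b (logLapse G u) y * (lapseLoc G u y * pd c u y) := by
  have hT : ∀ a, DifferentiableAt ℝ (normal G u a) y := fun a =>
    differentiableAt_of_smooth h.isOpen (h.smooth_normal a) hy
  have hG : ∀ a b, DifferentiableAt ℝ (fun z => G z a b) y := fun a b =>
    differentiableAt_of_smooth h.isOpen (h.smooth a b) hy
  -- The relation `T_c = -n ∂_c u` is differentiated in two ways, as a lowered vector and as a
  -- product of functions. Metric compatibility then turns the derivatives of the metric into
  -- Christoffel symbols.
  have e1 : pd b (fun z => ∑ a, G z c a * normal G u a z) y =
      ∑ a, (pd b (fun z => G z c a) y * normal G u a y + G y c a * pd b (normal G u a) y) :=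
    pd_sum_mul b (fun a => hG c a) hT
  have e2 : pd b (fun z => ∑ a, G z c a * normal G u a z) y =
      -(pd b (lapseLoc G u) y * pd c u y + lapseLoc G u y * pd b (pd c u) y) := by
    rw [pd_congr b h.isOpen (fun z hz => h.lower_normal hz c) hy, pd_neg, pd_mul]
    · exact differentiableAt_of_smooth h.isOpen h.smooth_lapse hy
    · exact differentiableAt_of_smooth h.isOpen (smooth_pd h.isOpen h.smooth_time c) hy
  have e3 : ∑ a, pd b (fun z => G z c a) y * normal G u a y =
      ∑ a, G y c a * ∑ d, christoffel G a b d y * normal G u d y -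
        lapseLoc G u y * ∑ d, christoffel G d b c y * pd d u y := by
    have : ∀ a, pd b (fun z => G z c a) y * normal G u a y =
        ∑ d, G y c d * (christoffel G d b a y * normal G u a y) +
        ∑ d, christoffel G d b c y * (G y d a * normal G u a y) := by
      intro a
      rw [h.metric_compat hy c a b, Finset.sum_mul, ← Finset.sum_add_distrib]
      refine Finset.sum_congr rfl fun d _ => ?_
      rw [h.symm hy a d]; ring
    simp only [this, Finset.sum_add_distrib, Finset.mul_sum]
    rw [Finset.sum_comm, sub_eq_add_neg]
    congr 1
    rw [Finset.sum_comm, ← Finset.sum_neg_distrib]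
    refine Finset.sum_congr rfl fun d _ => ?_
    rw [← Finset.mul_sum, h.lower_normal hy]; ring
  have e4 : -sff G u b c y = ∑ a, G y c a * pd b (normal G u a) y +
      ∑ a, G y c a * ∑ d, christoffel G a b d y * normal G u d y := by
    rw [sff_eq, neg_neg, ← Finset.sum_add_distrib]
    refine Finset.sum_congr rfl fun a _ => ?_
    rw [derivNormal, h.symm hy a c]; ring
  rw [e1, Finset.sum_add_distrib, e3, h.pd_lapse hy] at e2
  rw [e4]
  linarith

/-- Each side is `-n` times a component of the Hessian of `u`, which is symmetric. The bilinear form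
on all vectors is itself not symmetric; its defect comes from the acceleration. -/
lemma IsTimeOn.sff_symm (h : IsTimeOn Ω G u) (hy : y ∈ Ω) (b c : Fin 4) :
    -sff G u b c y + pd b (logLapse G u) y * (lapseLoc G u y * pd c u y) =
    -sff G u c b y + pd c (logLapse G u) y * (lapseLoc G u y * pd b u y) := by
  rw [h.neg_sff_eq hy, h.neg_sff_eq hy, pd_comm h.isOpen h.smooth_time hy b c]
  simp only [h.christoffel_symm hy _ b c]
  ring

/-- The contraction is `-g(D_b T, T)`, which vanishes because `T` has constant length. -/
lemma IsTimeOn.sff_normal (h : IsTimeOn Ω G u) (hy : y ∈ Ω) (b : Fin 4) :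
    ∑ c, sff G u b c y * normal G u c y = 0 := by
  have hT : ∀ a, DifferentiableAt ℝ (normal G u a) y := fun a =>
    differentiableAt_of_smooth h.isOpen (h.smooth_normal a) hy
  have hu : ∀ a, DifferentiableAt ℝ (pd a u) y := fun a =>
    differentiableAt_of_smooth h.isOpen (smooth_pd h.isOpen h.smooth_time a) hy
  have hn := (h.lapse_pos hy).ne'
  have hdn : DifferentiableAt ℝ (lapseLoc G u) y :=
    differentiableAt_of_smooth h.isOpen h.smooth_lapse hy
  -- the derivative of `n T^a u_a = 1`
  have e1 : ∑ a, (pd b (normal G u a) y * pd a u y + normal G u a y * pd b (pd a u) y) =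
      -pd b (logLapse G u) y * ∑ a, normal G u a y * pd a u y := by
    have e : pd b (fun z => lapseLoc G u z * ∑ a, normal G u a z * pd a u z) y = 0 := by
      rw [pd_congr (h := fun _ => 1) b h.isOpen (fun z hz => by
        rw [h.normal_time hz, mul_inv_cancel₀ (h.lapse_pos hz).ne']) hy, pd_const]
    rw [pd_mul (h := fun z => ∑ a, normal G u a z * pd a u z) b hdn
      (DifferentiableAt.fun_sum fun a _ => (hT a).mul (hu a)), pd_sum_mul b hT hu, h.pd_lapse hy] at e
    have : lapseLoc G u y * (pd b (logLapse G u) y * (∑ a, normal G u a y * pd a u y) +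
      ∑ a, (pd b (normal G u a) y * pd a u y + normal G u a y * pd b (pd a u) y)) = 0 := by
      rw [← e]; ring
    rcases mul_eq_zero.1 this with h0 | h0
    · exact absurd h0 hn
    · linarith
  have e2 : ∑ c, sff G u b c y * normal G u c y = lapseLoc G u y *
      ∑ a, derivNormal G u b a y * pd a u y := by
    simp only [sff_eq, Finset.sum_mul, Finset.mul_sum, neg_mul, Finset.sum_neg_distrib]
    rw [Finset.sum_comm, ← Finset.sum_neg_distrib]
    refine Finset.sum_congr rfl fun a _ => ?_
    have := h.lower_normal (u := u) hy a
    calc _ = -(derivNormal G u b a y * ∑ c, G y a c * normal G u c y) := by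
          rw [Finset.mul_sum]
          congr 1
          exact Finset.sum_congr rfl fun c _ => by ring
      _ = _ := by rw [this]; ring
  have e3 : ∑ c, -sff G u b c y * normal G u c y =
      ∑ c, (-(lapseLoc G u y * (pd b (pd c u) y - ∑ d, christoffel G d b c y * pd d u y))
      - pd b (logLapse G u) y * (lapseLoc G u y * pd c u y)) * normal G u c y :=
    Finset.sum_congr rfl fun c _ => by rw [h.neg_sff_eq hy]
  have e4 : ∑ c, (-(lapseLoc G u y * (pd b (pd c u) y - ∑ d, christoffel G d b c y * pd d u y))
      - pd b (logLapse G u) y * (lapseLoc G u y * pd c u y)) * normal G u c y =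
      -lapseLoc G u y * (∑ c, normal G u c y * pd b (pd c u) y
        - ∑ c, (∑ d, christoffel G c b d y * normal G u d y) * pd c u y
        + pd b (logLapse G u) y * ∑ c, normal G u c y * pd c u y) := by
    have : ∑ c, (∑ d, christoffel G c b d y * normal G u d y) * pd c u y =
        ∑ c, (∑ d, christoffel G d b c y * pd d u y) * normal G u c y := by
      simp only [Finset.sum_mul]
      rw [Finset.sum_comm]
      exact Finset.sum_congr rfl fun c _ => Finset.sum_congr rfl fun d _ => by ring
    rw [this]
    simp only [Finset.mul_sum, ← Finset.sum_sub_distrib, ← Finset.sum_add_distrib]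
    exact Finset.sum_congr rfl fun c _ => by ring
  rw [e4] at e3
  have e5 : ∑ a, derivNormal G u b a y * pd a u y = ∑ a, pd b (normal G u a) y * pd a u y +
      ∑ a, (∑ d, christoffel G a b d y * normal G u d y) * pd a u y := by
    rw [← Finset.sum_add_distrib]
    exact Finset.sum_congr rfl fun a _ => by rw [derivNormal]; ring
  rw [Finset.sum_add_distrib] at e1
  rw [e5] at e2
  simp only [neg_mul, Finset.sum_neg_distrib] at e3 e1
  -- `X` is computed once from the definition (`e2`), and `-X` from the Hessian formula and the
  -- derivative of `n T(u) = 1` (`e3`, `e1`). The right sides agree, so `2X = 0`.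
  set X := ∑ c, sff G u b c y * normal G u c y
  have : 2 * X = 0 := by linear_combination e2 - e3 + lapseLoc G u y * e1
  linarith

/-- The left side is the acceleration covector `T^b D_b T_c`. By the symmetry relation its slots can
be exchanged at the cost of terms in `d(log n)`, and the exchanged contraction vanishes. The result
is `d(log n)` projected orthogonally to `T`. -/
lemma IsTimeOn.normal_sff (h : IsTimeOn Ω G u) (hy : y ∈ Ω) (c : Fin 4) :
    ∑ b, normal G u b y * -sff G u b c y = pd c (logLapse G u) y -
      (∑ b, normal G u b y * pd b (logLapse G u) y) * (lapseLoc G u y * pd c u y) := by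
  have hn := (h.lapse_pos hy).ne'
  have e1 : ∀ b, normal G u b y * -sff G u b c y = -(sff G u c b y * normal G u b y) +
      lapseLoc G u y * pd c (logLapse G u) y * (normal G u b y * pd b u y) -
      (normal G u b y * pd b (logLapse G u) y) * (lapseLoc G u y * pd c u y) := by
    intro b
    linear_combination normal G u b y * h.sff_symm hy b c
  simp only [e1, Finset.sum_sub_distrib, Finset.sum_add_distrib, Finset.sum_neg_distrib,
    h.sff_normal hy, ← Finset.mul_sum, ← Finset.sum_mul, h.normal_time hy]
  field_simp
  ring

lemma IsTimeOn.raise_sff (h : IsTimeOn Ω G u) (hy : y ∈ Ω) (b a : Fin 4) :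
    ∑ c, -sff G u b c y * (G y)⁻¹ c a = derivNormal G u b a y := by
  simp only [sff_eq, neg_neg, Finset.sum_mul]
  rw [Finset.sum_comm]
  have : ∀ d, ∑ c, G y d c * derivNormal G u b d y * (G y)⁻¹ c a =
      (if d = a then 1 else 0) * derivNormal G u b d y := by
    intro d
    rw [← h.mul_inv hy, Finset.sum_mul]
    exact Finset.sum_congr rfl fun c _ => by ring
  simp [this]

lemma raise_time (a : Fin 4) :
    ∑ c, (G y)⁻¹ a c * -(lapseLoc G u y * pd c u y) = normal G u a y := by
  rw [normal, grad, Finset.mul_sum, ← Finset.sum_neg_distrib]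
  exact Finset.sum_congr rfl fun c _ => by ring

/-- The acceleration of the normal observers is the horizontal gradient of `log n`. -/
lemma IsTimeOn.acceleration_eq (h : IsTimeOn Ω G u) (hy : y ∈ Ω) (a : Fin 4) :
    ∑ b, normal G u b y * derivNormal G u b a y =
      ∑ c, horizInv G u a c y * pd c (logLapse G u) y := by
  have e1 : ∑ b, normal G u b y * derivNormal G u b a y =
      ∑ c, (∑ b, normal G u b y * -sff G u b c y) * (G y)⁻¹ c a := by
    simp only [← h.raise_sff hy, Finset.mul_sum, Finset.sum_mul]
    rw [Finset.sum_comm]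
    exact Finset.sum_congr rfl fun c _ => Finset.sum_congr rfl fun d _ => by ring
  rw [e1]
  simp only [h.normal_sff hy]
  have e2 : ∑ c, horizInv G u a c y * pd c (logLapse G u) y =
      ∑ c, (G y)⁻¹ a c * pd c (logLapse G u) y + normal G u a y *
      ∑ b, normal G u b y * pd b (logLapse G u) y := by
    rw [Finset.mul_sum, ← Finset.sum_add_distrib]
    exact Finset.sum_congr rfl fun c _ => by rw [horizInv]; ring
  rw [e2, ← raise_time a, Finset.sum_mul, ← Finset.sum_add_distrib]
  refine Finset.sum_congr rfl fun c _ => ?_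
  rw [h.inv_symm hy c a]; ring

/-- The part `T^a T^b` of the projection contributes nothing because `k(·, T) = 0`, so the mean
curvature is minus the spacetime divergence of `T`. -/
lemma IsTimeOn.traceSff_eq (h : IsTimeOn Ω G u) (hy : y ∈ Ω) :
    traceSff G u y = -∑ b, derivNormal G u b b y := by
  have e1 : traceSff G u y = ∑ a, (∑ b, sff G u a b y * (G y)⁻¹ b a) +
      ∑ a, normal G u a y * ∑ b, sff G u a b y * normal G u b y := by
    rw [traceSff, ← Finset.sum_add_distrib]
    refine Finset.sum_congr rfl fun a _ => ?_
    rw [Finset.mul_sum, ← Finset.sum_add_distrib]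
    refine Finset.sum_congr rfl fun b _ => ?_
    rw [horizInv, h.inv_symm hy a b]; ring
  rw [e1]
  simp only [h.sff_normal hy, ← h.raise_sff hy, neg_mul, Finset.sum_neg_distrib]
  simp

/-- The form in which `|k|²` appears in Raychaudhuri's identity. The nonhorizontal components of
`D_b T_c` and its failure to be symmetric cancel each other, by `horiz_sq_eq_trace_sq`. -/
lemma IsTimeOn.normSff_sq (h : IsTimeOn Ω G u) (hy : y ∈ Ω) :
    normSff G u y ^ 2 = ∑ b, ∑ c, derivNormal G u c b y * derivNormal G u b c y := by
  have h0 : 0 ≤ ∑ a, ∑ b, ∑ c, ∑ d,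
    horizInv G u a c y * horizInv G u b d y * sff G u a b y * sff G u c d y :=
    (h.lorentz y hy).norm_nonneg (h.normal_unit' hy) (fun a b => sff G u a b y)
  rw [normSff, Real.sq_sqrt h0]
  have key := horiz_sq_eq_trace_sq (G y)⁻¹ (Matrix.of fun a b => -sff G u a b y)
    (fun a => normal G u a y) (fun a => -(lapseLoc G u y * pd a u y))
    (fun a => pd a (logLapse G u) y) (∑ b, normal G u b y * pd b (logLapse G u) y)
    (by rw [Matrix.transpose_nonsing_inv, (h.lorentz y hy).1.eq])
    (by ext a; exact raise_time a)
    (by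
      ext a
      simp only [Matrix.mulVec, dotProduct, Matrix.of_apply, neg_mul, Finset.sum_neg_distrib,
        h.sff_normal hy]
      simp)
    (by
      ext b c
      simp only [Matrix.transpose_apply, Matrix.of_apply, Matrix.add_apply, Matrix.sub_apply,
        Matrix.vecMulVec_apply]
      linarith [h.sff_symm hy b c])
    (by
      ext c
      simp only [Matrix.vecMul, dotProduct, Matrix.of_apply, h.normal_sff hy, Pi.add_apply,
        Pi.smul_apply, smul_eq_mul]
      ring)
  have e1 : ∀ b a, ((Matrix.of fun a b => -sff G u a b y) * (G y)⁻¹) b a =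
      derivNormal G u b a y := fun b a => by
    rw [Matrix.mul_apply]; exact h.raise_sff hy b a
  simp only [e1, Matrix.of_apply] at key
  rw [← key]
  refine Finset.sum_congr rfl fun a _ => Finset.sum_congr rfl fun b _ =>
    Finset.sum_congr rfl fun c _ => Finset.sum_congr rfl fun d _ => ?_
  rw [horizInv, horizInv]; ring

/-- The contraction `R_{ab} T^a T^b`. -/
def ricciNormal (G : E4 → Matrix (Fin 4) (Fin 4) ℝ) (u : E4 → ℝ) (y : E4) : ℝ :=
  ∑ b, ∑ c, ricci G b c y * normal G u b y * normal G u c y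

/-- The component `∑_c γ^{bc} ∂_c (log n)` of the acceleration. -/
def accel (G : E4 → Matrix (Fin 4) (Fin 4) ℝ) (u : E4 → ℝ) (b : Fin 4) (y : E4) : ℝ :=
  ∑ c, horizInv G u b c y * pd c (logLapse G u) y

/-- The lapse equation of a constant mean curvature foliation. -/
lemma IsTimeOn.lapse_equation (h : IsTimeOn Ω G u) (hcmc : ∀ z ∈ Ω, traceSff G u z = u z)
    (hy : y ∈ Ω) :
    (lapseLoc G u y)⁻¹ = normSff G u y ^ 2 + ricciNormal G u y
      - (∑ b, pd b (accel G u b) y + ∑ b, ∑ d, christoffel G b b d y * accel G u d y) := by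
  have hT : ∀ a, DifferentiableAt ℝ (normal G u a) y := fun a =>
    differentiableAt_of_smooth h.isOpen (h.smooth_normal a) hy
  have hΓ : ∀ a b c, DifferentiableAt ℝ (christoffel G a b c) y := fun a b c =>
    differentiableAt_of_smooth h.isOpen (h.smooth_christoffel a b c) hy
  have hdT : ∀ b a, DifferentiableAt ℝ (pd b (normal G u a)) y := fun b a =>
    differentiableAt_of_smooth h.isOpen (smooth_pd h.isOpen (h.smooth_normal a) b) hy
  have hM : ∀ b a, DifferentiableAt ℝ (derivNormal G u b a) y := fun b a =>
    (hdT b a).add (DifferentiableAt.fun_sum fun d _ => (hΓ a b d).mul (hT d))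
  have dM : ∀ e b a, pd e (derivNormal G u b a) y = pd e (pd b (normal G u a)) y +
      ∑ d, (pd e (christoffel G a b d) y * normal G u d y +
        christoffel G a b d y * pd e (normal G u d) y) := by
    intro e b a
    have hs : ∀ d ∈ Finset.univ,
        DifferentiableAt ℝ (fun z => christoffel G a b d z * normal G u d z) y :=
      fun d _ => (hΓ a b d).mul (hT d)
    change pd e (fun z => pd b (normal G u a) z +
      ∑ d, christoffel G a b d z * normal G u d z) y = _
    rw [pd_add e (hdT b a) (DifferentiableAt.fun_sum hs), pd_sum_mul e (fun d => hΓ a b d) hT]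
  -- The only use of constant mean curvature: `div T = -tr k = -u` near `y`, so `T(div T) = -T(u) =
  -- -1/n`.
  have e1 : ∑ c, normal G u c y * ∑ b, pd c (derivNormal G u b b) y =
      -(lapseLoc G u y)⁻¹ := by
    rw [← h.normal_time hy, ← Finset.sum_neg_distrib]
    refine Finset.sum_congr rfl fun c _ => ?_
    rw [← pd_sum Finset.univ (fun b => derivNormal G u b b) c fun b _ => hM b b, pd_congr (h := fun z => -u z) c h.isOpen
      (fun z hz => by linarith [h.traceSff_eq hz, hcmc z hz]) hy, pd_neg]
    ring
  -- The identity between the horizontal gradient of `log n` and `T^c D_c T^b` holds in a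
  -- neighbourhood and may be differentiated.
  have e2 : ∀ b, pd b (accel G u b) y = ∑ c, (pd b (normal G u c) y * derivNormal G u c b y +
      normal G u c y * pd b (derivNormal G u c b) y) := by
    intro b
    rw [pd_congr (f := accel G u b) b h.isOpen
      (fun z hz => (h.acceleration_eq hz b).symm) hy]
    exact pd_sum_mul b hT fun c => hM c b
  have key := raychaudhuri_algebra (fun a => normal G u a y) (fun b a => pd b (normal G u a) y)
    (fun e b a => pd e (pd b (normal G u a)) y) (fun a b c => christoffel G a b c y)
    (fun e a b c => pd e (christoffel G a b c) y) (fun b a => derivNormal G u b a y)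
    (fun b a => rfl) (fun a b c => pd_comm h.isOpen (h.smooth_normal c) hy a b)
    (fun a b c => h.christoffel_symm hy a b c)
    (fun e a b c => pd_congr e h.isOpen (fun z hz => h.christoffel_symm hz a b c) hy)
  simp only [← dM] at key
  rw [e1] at key
  simp only [e2]
  have e3 : ∀ d, accel G u d y = ∑ c, normal G u c y * derivNormal G u c d y := fun d =>
    (h.acceleration_eq hy d).symm
  simp only [e3]
  rw [h.normSff_sq hy, ricciNormal]
  change _ = _ + ∑ b, ∑ c, (∑ a, (pd a (christoffel G a b c) y - pd c (christoffel G a b a) y +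
    ∑ d, (christoffel G a a d y * christoffel G d b c y -
      christoffel G a c d y * christoffel G d b a y))) * normal G u b y * normal G u c y - _
  linarith

end Local

end

/-! ### The energy condition -/

section Matter

variable {Ω : Set E4} {G : E4 → Matrix (Fin 4) (Fin 4) ℝ} {u : E4 → ℝ} {y : E4}

lemma IsLorentzOn.trace_metric (h : IsLorentzOn Ω G) (hy : y ∈ Ω) :
    ∑ a, ∑ b, (G y)⁻¹ a b * G y a b = 4 := by
  have : ∀ a, ∑ b, (G y)⁻¹ a b * G y a b = 1 := by
    intro a
    have := h.inv_mul hy a a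
    simp only [if_true] at this
    rw [← this]
    exact Finset.sum_congr rfl fun b _ => by rw [h.symm hy a b]
  simp [this]

/-- The scalar curvature is minus the trace of the energy-momentum tensor. -/
lemma IsLorentzOn.scalarCurvature_eq (h : IsLorentzOn Ω G) (hy : y ∈ Ω) {Q : Fin 4 → Fin 4 → ℝ}
    (hQ : ∀ a b, einsteinTensor G a b y = Q a b) :
    scalarCurvature G y = -∑ a, ∑ b, (G y)⁻¹ a b * Q a b := by
  have e : ∑ a, ∑ b, (G y)⁻¹ a b * Q a b = scalarCurvature G y -
      (1 / 2) * scalarCurvature G y * ∑ a, ∑ b, (G y)⁻¹ a b * G y a b := by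
    conv_rhs => rw [scalarCurvature]
    rw [Finset.mul_sum, ← Finset.sum_sub_distrib]
    refine Finset.sum_congr rfl fun a _ => ?_
    rw [Finset.mul_sum, ← Finset.sum_sub_distrib]
    refine Finset.sum_congr rfl fun b _ => ?_
    rw [← hQ, einsteinTensor, ← scalarCurvature]; ring
  rw [h.trace_metric hy] at e
  linarith

lemma IsTimeOn.metric_normal_normal (h : IsTimeOn Ω G u) (hy : y ∈ Ω) :
    ∑ b, ∑ c, G y b c * normal G u b y * normal G u c y = -1 := by
  rw [← h.normal_unit hy]
  refine Finset.sum_congr rfl fun a _ => ?_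
  rw [Finset.mul_sum]
  exact Finset.sum_congr rfl fun b _ => by ring

/-- Contraction of the Einstein equation with `T` twice, using `g(T,T) = -1` and the fact that the
scalar curvature is minus the trace of `Q`. -/
lemma IsTimeOn.ricciNormal_of_ricci_eq (h : IsTimeOn Ω G u) (hy : y ∈ Ω)
    {Q : Fin 4 → Fin 4 → ℝ} (hQ : ∀ a b, einsteinTensor G a b y = Q a b) :
    ricciNormal G u y = ∑ b, ∑ c, Q b c * normal G u b y * normal G u c y
      + (1 / 2) * ∑ a, ∑ b, (G y)⁻¹ a b * Q a b := by
  have e : ricciNormal G u y = ∑ b, ∑ c, Q b c * normal G u b y * normal G u c y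
      + (1 / 2) * scalarCurvature G y *
        ∑ b, ∑ c, G y b c * normal G u b y * normal G u c y := by
    rw [ricciNormal, Finset.mul_sum, ← Finset.sum_add_distrib]
    refine Finset.sum_congr rfl fun b _ => ?_
    rw [Finset.mul_sum, ← Finset.sum_add_distrib]
    refine Finset.sum_congr rfl fun c _ => ?_
    rw [← hQ, einsteinTensor]; ring
  rw [e, h.metric_normal_normal hy, h.scalarCurvature_eq hy hQ]; ring

lemma sum_mul_sum_expand (α β : Fin 4 → ℝ) :
    ∑ b, ∑ c, α b * α c * β b * β c = (∑ b, β b * α b) ^ 2 := by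
  rw [sq, Finset.sum_mul_sum]
  exact Finset.sum_congr rfl fun b _ => Finset.sum_congr rfl fun c _ => by ring

/-- The trace of `Q` is `-|Dφ|²_g` in dimension four, so the trace correction cancels the Lagrangian
term of `Q(T,T)`. -/
lemma IsTimeOn.ricciNormal_scalar (h : IsTimeOn Ω G u) (hy : y ∈ Ω) {φ : E4 → ℝ}
    (hQ : ∀ a b, einsteinTensor G a b y = emScalar G φ a b y) :
    ricciNormal G u y = (∑ a, normal G u a y * pd a φ y) ^ 2 := by
  set D := ∑ c, ∑ d, (G y)⁻¹ c d * pd c φ y * pd d φ y with hD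
  have e1 : ∑ b, ∑ c, emScalar G φ b c y * normal G u b y * normal G u c y =
      (∑ a, normal G u a y * pd a φ y) ^ 2 -
        (1 / 2) * D * ∑ b, ∑ c, G y b c * normal G u b y * normal G u c y := by
    rw [← sum_mul_sum_expand, Finset.mul_sum, ← Finset.sum_sub_distrib]
    refine Finset.sum_congr rfl fun b _ => ?_
    rw [Finset.mul_sum, ← Finset.sum_sub_distrib]
    refine Finset.sum_congr rfl fun c _ => ?_
    rw [emScalar, ← hD]; ring
  have e2 : ∑ a, ∑ b, (G y)⁻¹ a b * emScalar G φ a b y =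
      D - (1 / 2) * D * ∑ a, ∑ b, (G y)⁻¹ a b * G y a b := by
    conv_rhs => rw [hD]
    rw [Finset.mul_sum, ← Finset.sum_sub_distrib]
    refine Finset.sum_congr rfl fun b _ => ?_
    rw [Finset.mul_sum, ← Finset.sum_sub_distrib]
    refine Finset.sum_congr rfl fun c _ => ?_
    rw [emScalar, ← hD]; ring
  rw [h.ricciNormal_of_ricci_eq hy hQ, e1, e2, h.metric_normal_normal hy, h.trace_metric hy]
  ring

/-- The `h`-norm of `Dφ` splits into its horizontal part, which is nonnegative, and `(Tφ)²`. -/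
lemma IsTimeOn.scalar_le_norm (h : IsTimeOn Ω G u) (hy : y ∈ Ω) (φ : E4 → ℝ) :
    (∑ a, normal G u a y * pd a φ y) ^ 2 ≤ normDScalar G u φ y ^ 2 := by
  have e : ∑ a, ∑ b, riemInv G u a b y * pd a φ y * pd b φ y =
      ∑ a, ∑ b, horizInv G u a b y * pd a φ y * pd b φ y +
        (∑ a, normal G u a y * pd a φ y) ^ 2 := by
    rw [sq, Finset.sum_mul_sum, ← Finset.sum_add_distrib]
    refine Finset.sum_congr rfl fun b _ => ?_
    rw [← Finset.sum_add_distrib]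
    refine Finset.sum_congr rfl fun c _ => ?_
    rw [riemInv, horizInv]; ring
  have h1 : 0 ≤ ∑ a, ∑ b, horizInv G u a b y * pd a φ y * pd b φ y :=
    (h.lorentz y hy).horiz_nonneg (h.normal_unit' hy) fun a => pd a φ y
  have h2 : 0 ≤ (∑ a, normal G u a y * pd a φ y) ^ 2 := sq_nonneg _
  rw [normDScalar, Real.sq_sqrt (by rw [e]; positivity), e]
  linarith

/-- Decomposition of the square of a two-form into its electric and magnetic parts. -/
lemma twoForm_sq_decomp (γ : Fin 4 → Fin 4 → ℝ) (T : Fin 4 → ℝ) (F : Fin 4 → Fin 4 → ℝ)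
    (hF : ∀ a b, F a b = -F b a) (s : ℝ) :
    ∑ m, ∑ n, ∑ p, ∑ q, (γ m p + s * (T m * T p)) * (γ n q + s * (T n * T q)) * F m n * F p q =
      ∑ m, ∑ n, ∑ p, ∑ q, γ m p * γ n q * F m n * F p q +
        2 * s * ∑ m, ∑ n, γ m n * (∑ a, T a * F a m) * (∑ a, T a * F a n) := by
  -- By antisymmetry `F(T,T) = 0`. This removes the term quadratic in `s`.
  have hTT : ∑ m, ∑ n, T m * T n * F m n = 0 := by
    have : ∑ m, ∑ n, T m * T n * F m n = -∑ m, ∑ n, T m * T n * F m n := by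
      conv_lhs => rw [Finset.sum_comm]
      simp only [← Finset.sum_neg_distrib]
      exact Finset.sum_congr rfl fun m _ => Finset.sum_congr rfl fun n _ => by rw [hF]; ring
    linarith
  have e0 : ∑ m, ∑ n, ∑ p, ∑ q, (γ m p + s * (T m * T p)) * (γ n q + s * (T n * T q)) *
      F m n * F p q = ∑ m, ∑ n, ∑ p, ∑ q, γ m p * γ n q * F m n * F p q +
      s * ∑ m, ∑ n, ∑ p, ∑ q, T m * T p * γ n q * F m n * F p q +
      s * ∑ m, ∑ n, ∑ p, ∑ q, γ m p * T n * T q * F m n * F p q +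
      s ^ 2 * ∑ m, ∑ n, ∑ p, ∑ q, (T m * T n * F m n) * (T p * T q * F p q) := by
    simp only [Finset.mul_sum, ← Finset.sum_add_distrib]
    exact Finset.sum_congr rfl fun m _ => Finset.sum_congr rfl fun n _ =>
      Finset.sum_congr rfl fun p _ => Finset.sum_congr rfl fun q _ => by ring
  have e1 : ∑ m, ∑ n, ∑ p, ∑ q, (T m * T n * F m n) * (T p * T q * F p q) = 0 := by
    simp only [← Finset.mul_sum, hTT, mul_zero, Finset.sum_const_zero]
  have e2 : ∑ m, ∑ n, ∑ p, ∑ q, T m * T p * γ n q * F m n * F p q =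
      ∑ m, ∑ n, γ m n * (∑ a, T a * F a m) * (∑ a, T a * F a n) := by
    have : ∀ n q, γ n q * (∑ a, T a * F a n) * (∑ a, T a * F a q) =
        ∑ m, ∑ p, T m * T p * γ n q * F m n * F p q := by
      intro n q
      rw [mul_assoc, Finset.sum_mul_sum, Finset.mul_sum]
      refine Finset.sum_congr rfl fun m _ => ?_
      rw [Finset.mul_sum]
      exact Finset.sum_congr rfl fun p _ => by ring
    simp only [this]
    rw [Finset.sum_comm]
    refine Finset.sum_congr rfl fun n _ => ?_
    rw [sum_rotate (fun q m p => T m * T p * γ n q * F m n * F p q)]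
  have e3 : ∑ m, ∑ n, ∑ p, ∑ q, γ m p * T n * T q * F m n * F p q =
      ∑ m, ∑ n, ∑ p, ∑ q, T m * T p * γ n q * F m n * F p q := by
    rw [Finset.sum_comm]
    refine Finset.sum_congr rfl fun n _ => Finset.sum_congr rfl fun m _ => ?_
    rw [Finset.sum_comm]
    refine Finset.sum_congr rfl fun q _ => Finset.sum_congr rfl fun p _ => ?_
    rw [hF n m, hF q p]; ring
  rw [e0, e1, e3, e2]; ring

lemma IsTimeOn.horiz_norm_nonneg (h : IsTimeOn Ω G u) (hy : y ∈ Ω) (k : Fin 4 → Fin 4 → ℝ) :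
    0 ≤ ∑ a, ∑ b, ∑ c, ∑ d, horizInv G u a c y * horizInv G u b d y * k a b * k c d :=
  (h.lorentz y hy).norm_nonneg (h.normal_unit' hy) (Matrix.of k)

lemma IsTimeOn.horiz_nonneg (h : IsTimeOn Ω G u) (hy : y ∈ Ω) (v : Fin 4 → ℝ) :
    0 ≤ ∑ a, ∑ b, horizInv G u a b y * v a * v b :=
  (h.lorentz y hy).horiz_nonneg (h.normal_unit' hy) v

/-- The Maxwell tensor is trace free in dimension four, so `Ric(T,T) = Q(T,T)`. With `X` the squared
norm of the horizontal part of `F` and `Y` that of the electric part `E = F(T,·)`, the `g`-square of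
`F` is `X - 2Y` and the `h`-square is `X + 2Y`. Hence `Q(T,T) = Y + (X - 2Y)/4 = (X + 2Y)/4`. -/
lemma IsTimeOn.ricciNormal_maxwell (h : IsTimeOn Ω G u) (hy : y ∈ Ω)
    {F : E4 → Matrix (Fin 4) (Fin 4) ℝ} (hF : ∀ a b, F y a b = -F y b a)
    (hQ : ∀ a b, einsteinTensor G a b y = emMaxwell G F a b y) :
    0 ≤ ricciNormal G u y ∧ ricciNormal G u y ≤ normTwoForm G u F y ^ 2 := by
  set I := (G y)⁻¹ with hI
  set T := fun a => normal G u a y with hT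
  set γ : Fin 4 → Fin 4 → ℝ := fun a b => horizInv G u a b y with hγ
  set E : Fin 4 → ℝ := fun m => ∑ a, T a * F y a m with hE
  set S := ∑ m, ∑ n, ∑ p, ∑ q, I m p * I n q * F y m n * F y p q with hS
  have hTE : ∑ m, T m * E m = 0 := by
    have : ∑ m, T m * E m = -∑ m, T m * E m := by
      simp only [hE, Finset.mul_sum]
      conv_lhs => rw [Finset.sum_comm]
      simp only [← Finset.sum_neg_distrib]
      exact Finset.sum_congr rfl fun m _ => Finset.sum_congr rfl fun n _ => by rw [hF]; ring
    linarith
  have e1 : ∑ b, ∑ c, emMaxwell G F b c y * T b * T c = ∑ m, ∑ n, I m n * E m * E n -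
      (1 / 4) * S * ∑ b, ∑ c, G y b c * T b * T c := by
    have e : ∑ m, ∑ n, I m n * E m * E n =
        ∑ b, ∑ c, (∑ m, ∑ n, I m n * F y b m * F y c n) * T b * T c := by
      have : ∀ m n, I m n * E m * E n = ∑ b, ∑ c, I m n * F y b m * F y c n * T b * T c := by
        intro m n
        rw [mul_assoc, hE, Finset.sum_mul_sum, Finset.mul_sum]
        refine Finset.sum_congr rfl fun b _ => ?_
        rw [Finset.mul_sum]
        exact Finset.sum_congr rfl fun p _ => by ring
      simp only [this, Finset.sum_mul]
      calc _ = ∑ m, ∑ b, ∑ c, ∑ n, I m n * F y b m * F y c n * T b * T c :=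
            Finset.sum_congr rfl fun m _ => sum_rotate _
        _ = _ := sum_rotate _
    rw [e, Finset.mul_sum, ← Finset.sum_sub_distrib]
    refine Finset.sum_congr rfl fun b _ => ?_
    rw [Finset.mul_sum, ← Finset.sum_sub_distrib]
    refine Finset.sum_congr rfl fun c _ => ?_
    rw [emMaxwell, ← hI, ← hS]; ring
  have e2 : ∑ a, ∑ b, I a b * emMaxwell G F a b y = 0 := by
    have e : ∑ a, ∑ b, I a b * emMaxwell G F a b y =
        ∑ a, ∑ b, I a b * ∑ m, ∑ n, I m n * F y a m * F y b n -
        (1 / 4) * S * ∑ a, ∑ b, I a b * G y a b := by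
      rw [Finset.mul_sum, ← Finset.sum_sub_distrib]
      refine Finset.sum_congr rfl fun b _ => ?_
      rw [Finset.mul_sum, ← Finset.sum_sub_distrib]
      refine Finset.sum_congr rfl fun c _ => ?_
      rw [emMaxwell, ← hI, ← hS]; ring
    have e' : ∑ a, ∑ b, I a b * ∑ m, ∑ n, I m n * F y a m * F y b n = S := by
      rw [hS]
      refine Finset.sum_congr rfl fun a _ => ?_
      simp only [Finset.mul_sum]
      rw [Finset.sum_comm]
      exact Finset.sum_congr rfl fun m _ => Finset.sum_congr rfl fun b _ =>
        Finset.sum_congr rfl fun n _ => by ring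
    rw [e, e', h.trace_metric hy]; ring
  have hIγ : ∀ a b, I a b = γ a b + (-1) * (T a * T b) := fun a b => by
    simp only [hγ, hT, hI, horizInv]; ring
  have hhγ : ∀ a b, riemInv G u a b y = γ a b + 1 * (T a * T b) := fun a b => by
    simp only [hγ, hT, riemInv, horizInv]; ring
  -- The inverse metrics of `g` and `h` are `γ - T⊗T` and `γ + T⊗T`, so the same decomposition
  -- applies with `s = -1` and `s = 1`.
  have e3 : S = ∑ m, ∑ n, ∑ p, ∑ q, γ m p * γ n q * F y m n * F y p q +
        2 * (-1) * ∑ m, ∑ n, γ m n * E m * E n := by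
    rw [hS]; simp only [hIγ]
    exact twoForm_sq_decomp γ T (F y) hF (-1)
  have e4 : ∑ m, ∑ n, ∑ p, ∑ q, riemInv G u m p y * riemInv G u n q y * F y m n * F y p q =
      ∑ m, ∑ n, ∑ p, ∑ q, γ m p * γ n q * F y m n * F y p q +
        2 * 1 * ∑ m, ∑ n, γ m n * E m * E n := by
    simp only [hhγ]
    exact twoForm_sq_decomp γ T (F y) hF 1
  have e5 : ∑ m, ∑ n, I m n * E m * E n = ∑ m, ∑ n, γ m n * E m * E n := by
    have : ∑ m, ∑ n, I m n * E m * E n = ∑ m, ∑ n, γ m n * E m * E n -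
        (∑ m, T m * E m) * (∑ m, T m * E m) := by
      rw [Finset.sum_mul_sum, ← Finset.sum_sub_distrib]
      refine Finset.sum_congr rfl fun b _ => ?_
      rw [← Finset.sum_sub_distrib]
      exact Finset.sum_congr rfl fun c _ => by rw [hIγ]; ring
    rw [this, hTE]; ring
  have p1 : 0 ≤ ∑ m, ∑ n, ∑ p, ∑ q, γ m p * γ n q * F y m n * F y p q :=
    h.horiz_norm_nonneg hy (F y)
  have p2 : 0 ≤ ∑ m, ∑ n, γ m n * E m * E n :=
    h.horiz_nonneg hy E
  have e6 := h.ricciNormal_of_ricci_eq hy hQ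
  rw [e1, e2, h.metric_normal_normal hy, e5, e3] at e6
  rw [normTwoForm, e6, e4]
  generalize ∑ m, ∑ n, ∑ p, ∑ q, γ m p * γ n q * F y m n * F y p q = X at p1
  generalize ∑ m, ∑ n, γ m n * E m * E n = Y at p2
  rw [Real.sq_sqrt (by linarith)]
  constructor <;> linarith

end Matter

/-! ### Constrained extrema -/

section Constrained

variable {u f : E4 → ℝ} {y : E4}

/-- A map with derivative the identity at `y` that straightens the level sets of `u`. -/
def straighten (u : E4 → ℝ) (y e z : E4) : E4 :=
  z + (u z - u y - fderiv ℝ u y (z - y)) • e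

lemma straighten_self (u : E4 → ℝ) (y e : E4) : straighten u y e y = y := by
  simp [straighten]

lemma contDiffAt_straighten {z : E4} (hu : ContDiffAt ℝ ∞ u z) (e : E4) :
    ContDiffAt ℝ ∞ (straighten u y e) z :=
  contDiffAt_id.add (((hu.sub contDiffAt_const).sub
    ((fderiv ℝ u y).contDiff.contDiffAt.comp z (contDiffAt_id.sub contDiffAt_const))).smul
      contDiffAt_const)

lemma hasFDerivAt_straighten {z : E4} (hu : DifferentiableAt ℝ u z) (e : E4) :
    HasFDerivAt (straighten u y e)
      (ContinuousLinearMap.id ℝ E4 + (fderiv ℝ u z - fderiv ℝ u y).smulRight e) z := by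
  have h1 : HasFDerivAt (fun z => fderiv ℝ u y (z - y)) (fderiv ℝ u y) z :=
    (fderiv ℝ u y).hasFDerivAt.comp z ((hasFDerivAt_id z).sub_const y)
  exact (hasFDerivAt_id z).add (((hu.hasFDerivAt.sub_const (u y)).sub h1).smul_const e)

/-- The reason for the name: the map sends the level set of `u` through `y` into the affine
hyperplane `y + ker du`, so its local inverse carries lines in that hyperplane to curves in the
level set. -/
lemma fderiv_straighten {e : E4} (he : fderiv ℝ u y e = 1) (z : E4) :
    fderiv ℝ u y (straighten u y e z - y) = u z - u y := by
  rw [straighten, add_sub_right_comm, map_add, map_smul, he]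
  simp

/-- Curves in the level sets of a function. -/
lemma exists_curve_in_level (hu : ContDiffAt ℝ ∞ u y) (hdu : fderiv ℝ u y ≠ 0) {v : E4}
    (hv : fderiv ℝ u y v = 0) :
    ∃ c : ℝ → E4, ContDiffAt ℝ ∞ c 0 ∧ c 0 = y ∧ HasDerivAt c v 0 ∧ ∀ᶠ s in 𝓝 0, u (c s) = u y := by
  obtain ⟨e, he⟩ : ∃ e, fderiv ℝ u y e = 1 := by
    obtain ⟨w, hw⟩ : ∃ w, fderiv ℝ u y w ≠ 0 := by
      by_contra! h
      exact hdu (ContinuousLinearMap.ext h)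
    exact ⟨(fderiv ℝ u y w)⁻¹ • w, by rw [map_smul, smul_eq_mul, inv_mul_cancel₀ hw]⟩
  have hΨ := contDiffAt_straighten (y := y) hu e
  have hΨ' : HasFDerivAt (straighten u y e) (ContinuousLinearEquiv.refl ℝ E4 : E4 →L[ℝ] E4) y := by
    convert hasFDerivAt_straighten (y := y) (hu.differentiableAt (by simp)) e using 1
    ext; simp
  have hs := hΨ.hasStrictFDerivAt' hΨ' (by simp)
  set ι := hΨ.localInverse hΨ' (by simp)
  have hι : ContDiffAt ℝ ∞ ι y := by
    have := hΨ.to_localInverse hΨ' (by simp)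
    rwa [straighten_self] at this
  have hιy : ι y = y := by
    have := hΨ.localInverse_apply_image hΨ' (by simp)
    rwa [straighten_self] at this
  have hι' : HasFDerivAt ι (ContinuousLinearMap.id ℝ E4) y := by
    have := hs.to_localInverse.hasFDerivAt
    rw [straighten_self] at this
    exact this
  have hinv : ∀ᶠ w in 𝓝 y, straighten u y e (ι w) = w := by
    have := hs.eventually_right_inverse
    rwa [straighten_self] at this
  have hl : ContDiff ℝ ∞ (fun s : ℝ => y + s • v) := by fun_prop
  have hl' : HasDerivAt (fun s : ℝ => y + s • v) v 0 := by
    simpa using ((hasDerivAt_id (0 : ℝ)).smul_const v).const_add y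
  have hl0 : y + (0 : ℝ) • v = y := by simp
  refine ⟨fun s => ι (y + s • v), ?_, by simpa using hιy, ?_, ?_⟩
  · exact ContDiffAt.comp (0 : ℝ) (by rw [hl0]; exact hι) hl.contDiffAt
  · have := HasFDerivAt.comp_hasDerivAt (0 : ℝ) (by rw [hl0]; exact hι') hl'
    exact this.congr_deriv (by simp)
  · have ht : Filter.Tendsto (fun s : ℝ => y + s • v) (𝓝 0) (𝓝 y) := by
      have := hl.continuous.tendsto 0
      rwa [hl0] at this
    filter_upwards [ht.eventually hinv] with s hs
    have := fderiv_straighten he (ι (y + s • v))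
    rw [hs] at this
    simp [hv] at this
    linarith

lemma hasDerivAt_comp_curve {c : ℝ → E4} {s : ℝ} {v : E4} (hf : DifferentiableAt ℝ f (c s))
    (hc : HasDerivAt c v s) : HasDerivAt (fun s => f (c s)) (∑ a, v a * pd a f (c s)) s := by
  rw [← fderiv_eq_sum_pd]
  exact hf.hasFDerivAt.comp_hasDerivAt s hc

/-- Second derivative test: at a local maximum the second derivative is nonpositive. -/
lemma second_deriv_nonpos_of_isLocalMax {F F' : ℝ → ℝ} {F'' : ℝ}
    (hF : ∀ᶠ s in 𝓝 0, HasDerivAt F (F' s) s) (hF' : HasDerivAt F' F'' 0)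
    (hmax : IsLocalMax F 0) : F'' ≤ 0 := by
  by_contra! hpos
  have h0 : F' 0 = 0 := hmax.hasDerivAt_eq_zero hF.self_of_nhds
  have h1 : ∀ᶠ s in 𝓝[>] 0, 0 < F' s := by
    have := hF'.tendsto_slope_zero_right.eventually (eventually_gt_nhds hpos)
    filter_upwards [this, self_mem_nhdsWithin] with s hs hs0
    simp only [zero_add, h0, sub_zero, smul_eq_mul] at hs
    exact (pos_iff_pos_of_mul_pos hs).1 (inv_pos.2 hs0)
  rw [eventually_nhdsWithin_iff] at h1
  obtain ⟨ε, hε, hball⟩ := Metric.eventually_nhds_iff_ball.1 ((h1.and hF).and hmax)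
  have hmem : ∀ s ∈ Set.Icc 0 (ε / 2), s ∈ Metric.ball (0 : ℝ) ε := by
    intro s hs
    rw [Metric.mem_ball, Real.dist_eq, sub_zero, abs_of_nonneg hs.1]
    linarith [hs.2]
  have hmono : StrictMonoOn F (Set.Icc 0 (ε / 2)) := by
    refine strictMonoOn_of_deriv_pos (convex_Icc _ _)
      (fun s hs => ((hball s (hmem s hs)).1.2).continuousAt.continuousWithinAt) fun s hs => ?_
    rw [interior_Icc] at hs
    have := hball s (hmem s ⟨hs.1.le, hs.2.le⟩)
    rw [this.1.2.deriv]
    exact this.1.1 hs.1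
  have hε2 : 0 < ε / 2 := by positivity
  have h2 := hmono (Set.left_mem_Icc.2 hε2.le) (Set.right_mem_Icc.2 hε2.le) hε2
  have h3 := (hball (ε / 2) (hmem _ (Set.right_mem_Icc.2 hε2.le))).2
  exact absurd h3 (not_le.2 h2)

/-- The first and second order conditions at a constrained local maximum. -/
lemma exists_lagrange_multiplier {Ω : Set E4} (hΩ : IsOpen Ω) (hy : y ∈ Ω)
    (hf : ContDiffOn ℝ ∞ f Ω) (hu : ContDiffOn ℝ ∞ u Ω) (hdu : fderiv ℝ u y ≠ 0)
    (hmax : ∀ᶠ z in 𝓝 y, u z = u y → f z ≤ f y) :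
    ∃ l : ℝ, (∀ a, pd a f y = l * pd a u y) ∧ ∀ v : E4, ∑ a, v a * pd a u y = 0 →
      ∑ a, ∑ b, v a * v b * (pd b (pd a f) y - l * pd b (pd a u) y) ≤ 0 := by
  have huy := hu.contDiffAt (hΩ.mem_nhds hy)
  have hmax' : ∀ c : ℝ → E4, ContinuousAt c 0 → c 0 = y → (∀ᶠ s in 𝓝 0, u (c s) = u y) →
      IsLocalMax (fun s => f (c s)) 0 := by
    intro c hc h0 hlev
    have : Filter.Tendsto c (𝓝 0) (𝓝 y) := by rw [← h0]; exact hc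
    filter_upwards [this.eventually hmax, hlev] with s h1 h2
    rw [h0]; exact h1 h2
  have first : ∀ v, fderiv ℝ u y v = 0 → fderiv ℝ f y v = 0 := by
    intro v hv
    obtain ⟨c, hc, hc0, hc', hlev⟩ := exists_curve_in_level huy hdu hv
    have h1 := hmax' c hc.continuousAt hc0 hlev
    have h2 := hasDerivAt_comp_curve (f := f) (by
      rw [hc0]; exact differentiableAt_of_smooth hΩ hf hy) hc'
    rw [hc0] at h2
    rw [fderiv_eq_sum_pd]
    exact h1.hasDerivAt_eq_zero h2
  obtain ⟨w, hw⟩ : ∃ w, fderiv ℝ u y w ≠ 0 := by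
    by_contra! h
    exact hdu (ContinuousLinearMap.ext h)
  set l := fderiv ℝ f y w / fderiv ℝ u y w with hl
  have hfirst : ∀ a, pd a f y = l * pd a u y := by
    intro a
    have := first (EuclideanSpace.single a 1 - (pd a u y / fderiv ℝ u y w) • w) (by
      rw [map_sub, map_smul, smul_eq_mul, div_mul_cancel₀ _ hw, pd, sub_self])
    rw [map_sub, map_smul, smul_eq_mul] at this
    have h2 : pd a f y = pd a u y / fderiv ℝ u y w * fderiv ℝ f y w := by
      rw [← sub_eq_zero]; exact this
    rw [h2, hl]; field_simp
  refine ⟨l, hfirst, fun v hv => ?_⟩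
  rw [← fderiv_eq_sum_pd] at hv
  obtain ⟨c, hc, hc0, hc', hlev⟩ := exists_curve_in_level huy hdu hv
  -- Subtracting `l u`, a constant along the curve, makes the gradient vanish at `y`. The second
  -- derivative along the curve is then the Hessian evaluated on `v`, with no contribution from
  -- `c''`.
  have hF : IsLocalMax (fun s => f (c s) - l * u (c s)) 0 := by
    filter_upwards [hmax' c hc.continuousAt hc0 hlev, hlev] with s h1 h2
    rw [h2, hc0] at *; linarith
  have hcd : ∀ᶠ s in 𝓝 0, HasDerivAt c (deriv c s) s ∧ c s ∈ Ω := by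
    have hc1 : ContDiffAt ℝ 1 c 0 := hc.of_le (mod_cast le_top)
    have h1 := hc1.eventually (by simp)
    have h2 : ∀ᶠ s in 𝓝 0, c s ∈ Ω := hc.continuousAt.eventually_mem
      (by rw [hc0]; exact hΩ.mem_nhds hy)
    filter_upwards [h1, h2] with s hs hs2
    exact ⟨(hs.differentiableAt (by simp)).hasDerivAt, hs2⟩
  have hc2 : ∀ a, DifferentiableAt ℝ (fun s => deriv c s a) 0 := by
    intro a
    have h1 : ContDiffAt ℝ ∞ (deriv c) 0 :=
      (hc.fderiv_right (m := ∞) (by simp)).clm_apply contDiffAt_const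
    have h2 := h1.differentiableAt (by simp)
    exact ((EuclideanSpace.proj a : E4 →L[ℝ] ℝ).differentiableAt).comp 0 h2
  have hpd : ∀ (g : E4 → ℝ), ContDiffOn ℝ ∞ g Ω → HasDerivAt
      (fun s => g (c s)) (∑ b, v b * pd b g y) 0 := by
    intro g hg
    have := hasDerivAt_comp_curve (f := g) (by
      rw [hc0]; exact differentiableAt_of_smooth hΩ hg hy) hc'
    rwa [hc0] at this
  have hdc0 : ∀ a, deriv c 0 a = v a := fun a => by rw [hc'.deriv]
  have hF2 : HasDerivAt (fun s => ∑ a, deriv c s a * (pd a f (c s) - l * pd a u (c s)))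
      (∑ a, ∑ b, v a * v b * (pd b (pd a f) y - l * pd b (pd a u) y)) 0 := by
    refine (HasDerivAt.fun_sum fun a _ => (hc2 a).hasDerivAt.mul
      ((hpd _ (smooth_pd hΩ hf a)).sub ((hpd _ (smooth_pd hΩ hu a)).const_mul l))).congr_deriv ?_
    refine Finset.sum_congr rfl fun a _ => ?_
    rw [Pi.sub_apply, hc0, hdc0, hfirst a, sub_self, mul_zero, zero_add, Finset.mul_sum,
      ← Finset.sum_sub_distrib, Finset.mul_sum]
    exact Finset.sum_congr rfl fun b _ => by ring
  refine second_deriv_nonpos_of_isLocalMax ?_ hF2 hF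
  filter_upwards [hcd] with s hs
  refine ((hasDerivAt_comp_curve (f := f) (differentiableAt_of_smooth hΩ hf hs.2) hs.1).sub
    ((hasDerivAt_comp_curve (f := u) (differentiableAt_of_smooth hΩ hu hs.2) hs.1).const_mul
      l)).congr_deriv ?_
  rw [Finset.mul_sum, ← Finset.sum_sub_distrib]
  exact Finset.sum_congr rfl fun b _ => by ring

end Constrained

/-! ### Bounds for the lapse at extrema on a slice -/

section Local

variable {Ω : Set E4} {G : E4 → Matrix (Fin 4) (Fin 4) ℝ} {u : E4 → ℝ} {y : E4}

lemma IsTimeOn.smooth_logLapse (h : IsTimeOn Ω G u) : ContDiffOn ℝ ∞ (logLapse G u) Ω :=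
  h.smooth_log_lapse

lemma IsTimeOn.fderiv_time_ne_zero (h : IsTimeOn Ω G u) (hy : y ∈ Ω) : fderiv ℝ u y ≠ 0 := by
  intro h0
  have := h.normal_time hy
  simp only [pd, h0] at this
  simp at this
  exact (h.lapse_pos hy).ne this

/-- The divergence of the acceleration at a critical point of the lapse on a slice. -/
lemma IsTimeOn.div_accel_eq (h : IsTimeOn Ω G u) (hy : y ∈ Ω) {l : ℝ}
    (hl : ∀ a, pd a (logLapse G u) y = l * pd a u y) :
    ∑ b, pd b (accel G u b) y + ∑ b, ∑ d, christoffel G b b d y * accel G u d y =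
      ∑ b, ∑ a, horizInv G u b a y * (pd b (pd a (logLapse G u)) y - l * pd b (pd a u) y) := by
  have hγ : ∀ a b, DifferentiableAt ℝ (horizInv G u a b) y := fun a b =>
    differentiableAt_of_smooth h.isOpen (h.smooth_horizInv a b) hy
  have hu : ∀ a, DifferentiableAt ℝ (pd a u) y := fun a =>
    differentiableAt_of_smooth h.isOpen (smooth_pd h.isOpen h.smooth_time a) hy
  have hν : ∀ a, DifferentiableAt ℝ (pd a (logLapse G u)) y := fun a =>
    differentiableAt_of_smooth h.isOpen (smooth_pd h.isOpen h.smooth_logLapse a) hy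
  have h0 : ∀ d, accel G u d y = 0 := by
    intro d
    have : accel G u d y = l * ∑ c, horizInv G u d c y * pd c u y := by
      rw [accel, Finset.mul_sum]
      exact Finset.sum_congr rfl fun c _ => by rw [hl]; ring
    rw [this, h.horizInv_time hy, mul_zero]
  simp only [h0, mul_zero, Finset.sum_const_zero, add_zero]
  refine Finset.sum_congr rfl fun b _ => ?_
  -- The vector `γ^{ba} ∂_a u` vanishes identically, hence so do its derivatives. Subtracting `l`
  -- times this identity removes the derivatives of `γ`, because `d(log n) = l du` at `y`.
  have e1 : ∑ a, (pd b (horizInv G u b a) y * pd a u y +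
      horizInv G u b a y * pd b (pd a u) y) = 0 := by
    rw [← pd_sum_mul b (hγ b) hu, pd_congr (h := fun _ => 0) b h.isOpen
      (fun z hz => h.horizInv_time hz b) hy, pd_const]
  have e2 : pd b (accel G u b) y = ∑ a, (pd b (horizInv G u b a) y * pd a (logLapse G u) y +
      horizInv G u b a y * pd b (pd a (logLapse G u)) y) := pd_sum_mul b (hγ b) hν
  rw [e2, ← sub_zero (∑ a, _), ← mul_zero l, ← e1, Finset.mul_sum, ← Finset.sum_sub_distrib]
  refine Finset.sum_congr rfl fun a _ => ?_
  rw [hl]; ring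

/-- With `γ = Bᵀ B`, the trace is the sum of the values of `H` on the rows of `B`. These rows are
tangent to the level set because `γ(du, du) = 0` is the sum of the squares of their products with
`du`. -/
lemma IsTimeOn.horiz_trace_nonpos (h : IsTimeOn Ω G u) (hy : y ∈ Ω) {H : Fin 4 → Fin 4 → ℝ}
    (hH : ∀ v : E4, ∑ a, v a * pd a u y = 0 → ∑ a, ∑ b, v a * v b * H b a ≤ 0) :
    ∑ b, ∑ a, horizInv G u b a y * H b a ≤ 0 := by
  obtain ⟨B, hB⟩ := (h.lorentz y hy).exists_factor (h.normal_unit' hy)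
  have hB' : ∀ a b, horizInv G u a b y = ∑ i, B i a * B i b := hB
  have hker : ∀ i, ∑ a, B i a * pd a u y = 0 := by
    have h1 : ∑ i, (∑ a, B i a * pd a u y) ^ 2 = 0 := by
      have : ∑ i, (∑ a, B i a * pd a u y) ^ 2 =
          ∑ a, (∑ b, horizInv G u a b y * pd b u y) * pd a u y := by
        simp only [hB', Finset.sum_mul]
        simp only [sq, Finset.sum_mul_sum]
        refine (sum_rotate (fun i a b => B i a * pd a u y * (B i b * pd b u y))).trans ?_
        exact Finset.sum_congr rfl fun a _ => Finset.sum_congr rfl fun b _ =>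
          Finset.sum_congr rfl fun i _ => by ring
      rw [this]
      simp [h.horizInv_time hy]
    intro i
    have := (Finset.sum_eq_zero_iff_of_nonneg fun i _ => sq_nonneg _).1 h1 i (Finset.mem_univ i)
    exact pow_eq_zero_iff (two_ne_zero) |>.1 this
  have e : ∑ b, ∑ a, horizInv G u b a y * H b a = ∑ i, ∑ a, ∑ b, B i a * B i b * H b a := by
    simp only [hB', Finset.sum_mul]
    rw [sum_rotate (fun i a b => B i a * B i b * H b a), Finset.sum_comm]
    exact Finset.sum_congr rfl fun a _ => Finset.sum_congr rfl fun b _ =>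
      Finset.sum_congr rfl fun i _ => by ring
  rw [e]
  exact Finset.sum_nonpos fun i _ => hH (WithLp.toLp 2 (B i)) (hker i)

/-- The maximum principle for the lapse equation: at a maximum on the slice, the divergence of the
acceleration is the horizontal trace of a Hessian that is nonpositive on tangent vectors. -/
lemma IsTimeOn.le_inv_lapse_of_max (h : IsTimeOn Ω G u) (hcmc : ∀ z ∈ Ω, traceSff G u z = u z)
    (hy : y ∈ Ω) (hmax : ∀ᶠ z in 𝓝 y, u z = u y → lapseLoc G u z ≤ lapseLoc G u y) :
    normSff G u y ^ 2 + ricciNormal G u y ≤ (lapseLoc G u y)⁻¹ := by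
  obtain ⟨l, hl, hH⟩ := exists_lagrange_multiplier h.isOpen hy h.smooth_logLapse h.smooth_time
    (h.fderiv_time_ne_zero hy) (by
      filter_upwards [hmax, h.isOpen.mem_nhds hy] with z hz hzΩ hzu
      exact Real.log_le_log (h.lapse_pos hzΩ) (hz hzu))
  have h1 := h.horiz_trace_nonpos hy (H := fun b a =>
    pd b (pd a (logLapse G u)) y - l * pd b (pd a u) y) hH
  rw [h.lapse_equation hcmc hy, h.div_accel_eq hy hl]
  linarith

lemma IsTimeOn.inv_lapse_le_of_min (h : IsTimeOn Ω G u) (hcmc : ∀ z ∈ Ω, traceSff G u z = u z)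
    (hy : y ∈ Ω) (hmin : ∀ᶠ z in 𝓝 y, u z = u y → lapseLoc G u y ≤ lapseLoc G u z) :
    (lapseLoc G u y)⁻¹ ≤ normSff G u y ^ 2 + ricciNormal G u y := by
  obtain ⟨l, hl, hH⟩ := exists_lagrange_multiplier (f := fun z => -logLapse G u z) h.isOpen hy
    h.smooth_logLapse.neg h.smooth_time
    (h.fderiv_time_ne_zero hy) (by
      filter_upwards [hmin, h.isOpen.mem_nhds hy] with z hz hzΩ hzu
      exact neg_le_neg (Real.log_le_log (h.lapse_pos hy) (hz hzu)))
  have hneg : ∀ a, pd a (fun z => -logLapse G u z) = fun z => -pd a (logLapse G u) z := fun a => by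
    ext z; exact pd_neg a
  have hl' : ∀ a, pd a (logLapse G u) y = (-l) * pd a u y := fun a => by
    have := hl a
    rw [hneg] at this
    linarith
  have h1 := h.horiz_trace_nonpos hy (H := fun b a =>
    -(pd b (pd a (logLapse G u)) y - (-l) * pd b (pd a u) y)) (fun v hv => by
      refine (hH v hv).trans_eq' ?_
      refine Finset.sum_congr rfl fun a _ => Finset.sum_congr rfl fun b _ => ?_
      rw [hneg, pd_neg]; ring)
  rw [h.lapse_equation hcmc hy, h.div_accel_eq hy hl']
  simp only [mul_neg, Finset.sum_neg_distrib] at h1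
  linarith

lemma IsTimeOn.sq_le_normSff (h : IsTimeOn Ω G u) (hcmc : ∀ z ∈ Ω, traceSff G u z = u z)
    (hy : y ∈ Ω) : u y ^ 2 ≤ 4 * normSff G u y ^ 2 := by
  have h0 := h.horiz_norm_nonneg hy (fun a b => sff G u a b y)
  rw [normSff, Real.sq_sqrt h0, ← hcmc y hy]
  exact (h.lorentz y hy).trace_sq_le (h.normal_unit' hy) (Matrix.of fun a b => sff G u a b y)

end Local

/-! ### Differentiability of local flows with respect to the initial value -/

section Flow

variable {E : Type*} [NormedAddCommGroup E] [NormedSpace ℝ E]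

/-- A two-sided Grönwall inequality. -/
lemma norm_le_of_norm_deriv_le {w w' : ℝ → E} {K η ε : ℝ} (hK : 0 < K) (hη : 0 ≤ η)
    (h0 : w 0 = 0) (hw : ∀ s ∈ Set.Ioo (-ε) ε, HasDerivAt w (w' s) s)
    (hb : ∀ s ∈ Set.Ioo (-ε) ε, ‖w' s‖ ≤ K * ‖w s‖ + η) {s : ℝ} (hs : s ∈ Set.Ioo (-ε) ε) :
    ‖w s‖ ≤ η * (Real.exp (K * ε) / K) := by
  have hbound : ∀ t, 0 ≤ t → t ≤ ε → gronwallBound 0 K η (t - 0) ≤ η * (Real.exp (K * ε) / K) := by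
    intro t ht hte
    rw [gronwallBound_of_K_ne_0 hK.ne']
    beta_reduce
    rw [sub_zero, zero_mul, zero_add, div_mul_eq_mul_div,
      mul_div_assoc]
    have : Real.exp (K * t) ≤ Real.exp (K * ε) := Real.exp_le_exp.2 (by gcongr)
    gcongr
    linarith
  rcases le_total 0 s with h | h
  · have hsub : ∀ t ∈ Set.Icc 0 s, t ∈ Set.Ioo (-ε) ε := fun t ht =>
      ⟨by linarith [ht.1, hs.1, hs.2], by linarith [ht.2, hs.2]⟩
    have := norm_le_gronwallBound_of_norm_deriv_right_le (f := w) (f' := w') (δ := 0) (K := K)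
      (ε := η) (a := 0) (b := s) (fun t ht => (hw t (hsub t ht)).continuousAt.continuousWithinAt)
      (fun t ht => (hw t (hsub t ⟨ht.1, ht.2.le⟩)).hasDerivWithinAt) (by simp [h0])
      (fun t ht => hb t (hsub t ⟨ht.1, ht.2.le⟩)) s ⟨h, le_rfl⟩
    exact this.trans (hbound s h hs.2.le)
  · have hsub : ∀ t ∈ Set.Icc 0 (-s), -t ∈ Set.Ioo (-ε) ε := fun t ht =>
      ⟨by linarith [ht.2, hs.1], by linarith [ht.1, hs.1, hs.2]⟩
    have hd : ∀ t ∈ Set.Icc 0 (-s), HasDerivAt (fun t => w (-t)) (-w' (-t)) t := fun t ht => by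
      have := (hw (-t) (hsub t ht)).scomp t (hasDerivAt_neg t)
      exact this.congr_deriv (by simp)
    have := norm_le_gronwallBound_of_norm_deriv_right_le (f := fun t => w (-t))
      (f' := fun t => -w' (-t)) (δ := 0) (K := K)
      (ε := η) (a := 0) (b := -s) (fun t ht => (hd t ht).continuousAt.continuousWithinAt)
      (fun t ht => (hd t ⟨ht.1, ht.2.le⟩).hasDerivWithinAt) (by simp [h0])
      (fun t ht => by rw [norm_neg]; exact hb _ (hsub t ⟨ht.1, ht.2.le⟩)) (-s)
      ⟨by linarith, le_rfl⟩
    rw [neg_neg] at this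
    exact this.trans (hbound (-s) (by linarith) (by linarith [hs.1]))

/-- A local flow `φ` of the vector field `f` with derivative `A` in the initial value. -/
structure IsLocalFlow (f : E → E) (x₀ : E) (W : Set E) (r ε : ℝ) (φ : ℝ → E → E)
    (A : ℝ → E → E →L[ℝ] E) : Prop where
  init : ∀ x ∈ Metric.ball x₀ r, φ 0 x = x
  init_deriv : ∀ x ∈ Metric.ball x₀ r, A 0 x = ContinuousLinearMap.id ℝ E
  mem : ∀ x ∈ Metric.ball x₀ r, ∀ s ∈ Set.Ioo (-ε) ε, φ s x ∈ W
  hasDerivAt : ∀ x ∈ Metric.ball x₀ r, ∀ s ∈ Set.Ioo (-ε) ε,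
    HasDerivAt (fun s => φ s x) (f (φ s x)) s
  hasFDerivAt : ∀ x ∈ Metric.ball x₀ r, ∀ s ∈ Set.Ioo (-ε) ε, HasFDerivAt (φ s) (A s x) x
  hasDerivAt_deriv : ∀ x ∈ Metric.ball x₀ r, ∀ s ∈ Set.Ioo (-ε) ε,
    HasDerivAt (fun s => A s x) ((fderiv ℝ f (φ s x)).comp (A s x)) s
  continuousOn : ∀ s ∈ Set.Ioo (-ε) ε, ContinuousOn (A s) (Metric.ball x₀ r)

/-- The second order remainder of a function with Lipschitz derivative. -/
lemma norm_taylor_le {f : E → E} {s : Set E} {K : ℝ} (hs : Convex ℝ s)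
    (hf : ∀ x ∈ s, DifferentiableAt ℝ f x)
    (hK : ∀ x ∈ s, ∀ y ∈ s, ‖fderiv ℝ f x - fderiv ℝ f y‖ ≤ K * ‖x - y‖) (hK0 : 0 ≤ K)
    {x y : E} (hx : x ∈ s) (hy : y ∈ s) :
    ‖f y - f x - fderiv ℝ f x (y - x)‖ ≤ K * ‖y - x‖ ^ 2 := by
  have hseg : segment ℝ x y ⊆ s := hs.segment_subset hx hy
  have := Convex.norm_image_sub_le_of_norm_hasFDerivWithin_le' (f := f) (f' := fderiv ℝ f)
    (φ := fderiv ℝ f x) (C := K * ‖y - x‖) (s := segment ℝ x y)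
    (fun z hz => (hf z (hseg hz)).hasFDerivAt.hasFDerivWithinAt)
    (fun z hz => (hK z (hseg hz) x hx).trans (by
      gcongr
      exact norm_sub_le_of_mem_segment hz)) (convex_segment x y)
    (left_mem_segment ℝ x y) (right_mem_segment ℝ x y)
  rwa [mul_assoc, ← sq] at this

/-- The equation is solved together with its linearization `A' = Df(φ) A`, `A(0) = id`. The
Picard-Lindelöf theorem for the augmented system gives solutions that are Lipschitz in the initial
value. A Grönwall estimate then identifies `A` as the derivative of `φ` in the initial value, and
the Lipschitz bound makes `A` continuous. -/
theorem exists_isLocalFlow [CompleteSpace E] {f : E → E} {x₀ : E} (hf : ContDiffAt ℝ ∞ f x₀)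
    {W : Set E} (hW : W ∈ 𝓝 x₀) :
    ∃ r > 0, ∃ ε > 0, ∃ φ : ℝ → E → E, ∃ A : ℝ → E → E →L[ℝ] E, IsLocalFlow f x₀ W r ε φ A := by
  -- the augmented vector field
  set F : E × (E →L[ℝ] E) → E × (E →L[ℝ] E) := fun p => (f p.1, (fderiv ℝ f p.1).comp p.2) with hF
  have hDf : ContDiffAt ℝ ∞ (fderiv ℝ f) x₀ := hf.fderiv_right (m := ∞) (by simp)
  have hF1 : ContDiffAt ℝ 1 F (x₀, ContinuousLinearMap.id ℝ E) := by
    have h1 : ContDiffAt ℝ ∞ (fun p : E × (E →L[ℝ] E) => f p.1) (x₀, ContinuousLinearMap.id ℝ E) :=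
      ContDiffAt.comp (x₀, ContinuousLinearMap.id ℝ E) hf contDiffAt_fst
    have h2 : ContDiffAt ℝ ∞ (fun p : E × (E →L[ℝ] E) => fderiv ℝ f p.1)
        (x₀, ContinuousLinearMap.id ℝ E) :=
      ContDiffAt.comp (x₀, ContinuousLinearMap.id ℝ E) hDf contDiffAt_fst
    exact (h1.prodMk (h2.clm_comp contDiffAt_snd)).of_le (mod_cast le_top)
  obtain ⟨ε, hε, a, r, L, K, hr, hpl⟩ := IsPicardLindelof.of_contDiffAt_one hF1
  obtain ⟨α, hα, L', hL'⟩ :=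
    (hpl 0).exists_forall_mem_closedBall_eq_hasDerivWithinAt_lipschitzOnWith
  simp only [zero_sub, zero_add] at hα hL'
  -- a convex neighbourhood on which `f` is well behaved
  have hDf1 : ContDiffAt ℝ 1 (fderiv ℝ f) x₀ := hDf.of_le (mod_cast le_top)
  obtain ⟨K₂, t, ht, hlip⟩ := hDf1.exists_lipschitzOnWith
  have hf1 : ContDiffAt ℝ 1 f x₀ := hf.of_le (mod_cast le_top)
  have hdiff : ∀ᶠ x in 𝓝 x₀, DifferentiableAt ℝ f x :=
    (hf1.eventually (by simp)).mono fun x hx => hx.differentiableAt (by simp)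
  have hbd : ∀ᶠ x in 𝓝 x₀, ‖fderiv ℝ f x‖ < ‖fderiv ℝ f x₀‖ + 1 :=
    hDf.continuousAt.norm.eventually_lt continuousAt_const (by linarith [norm_nonneg (fderiv ℝ f x₀)])
  have htW : ∀ᶠ x in 𝓝 x₀, x ∈ t ∩ W := Filter.inter_mem ht hW
  obtain ⟨δ, hδ, hball⟩ := Metric.eventually_nhds_iff_ball.1 (htW.and (hdiff.and hbd))
  set K₁ := ‖fderiv ℝ f x₀‖ + 1 with hK₁
  have hK₁0 : 0 < K₁ := by positivity
  -- shrink the time interval and the set of initial values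
  set id' := ContinuousLinearMap.id ℝ E with hid'
  have hmemc : ∀ x ∈ Metric.closedBall x₀ r, (x, id') ∈ Metric.closedBall (x₀, id') (r : ℝ) := by
    intro x hx
    rw [Metric.mem_closedBall, Prod.dist_eq, dist_self, max_le_iff]
    exact ⟨hx, r.2⟩
  have hx₀c : (x₀, id') ∈ Metric.closedBall (x₀, id') (r : ℝ) := Metric.mem_closedBall_self r.2
  have h0mem : (0 : ℝ) ∈ Set.Icc (-ε) ε := ⟨by linarith, hε.le⟩
  have hcont : ContinuousAt (α (x₀, id')) 0 :=
    ((hα _ hx₀c).2 0 h0mem).continuousWithinAt.continuousAt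
      (Icc_mem_nhds (by linarith) hε)
  obtain ⟨ε₁, hε₁, hcb⟩ := Metric.continuousAt_iff.1 hcont (δ / 2) (by positivity)
  rw [(hα _ hx₀c).1] at hcb
  set ε' := min ε ε₁ with hε'
  have hε'0 : 0 < ε' := lt_min hε hε₁
  -- Half of `δ` is reserved for the motion of the base point in time and half for the Lipschitz
  -- dependence on the initial value; `L' + 1` avoids a division by zero.
  set r' := min (r : ℝ) (δ / (2 * (L' + 1))) with hr'
  have hr'0 : 0 < r' := lt_min hr (by positivity)
  have hsIcc : ∀ s ∈ Set.Ioo (-ε') ε', s ∈ Set.Icc (-ε) ε := fun s hs =>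
    ⟨by linarith [hs.1, min_le_left ε ε₁], by linarith [hs.2, min_le_left ε ε₁]⟩
  have hxc : ∀ x ∈ Metric.ball x₀ r', (x, id') ∈ Metric.closedBall (x₀, id') (r : ℝ) := fun x hx =>
    hmemc x (Metric.ball_subset_closedBall.trans
      (Metric.closedBall_subset_closedBall (min_le_left _ _)) hx)
  have hdist : ∀ x ∈ Metric.ball x₀ r', ∀ y ∈ Metric.ball x₀ r', ∀ s ∈ Set.Ioo (-ε') ε',
      dist (α (x, id') s) (α (y, id') s) ≤ L' * dist x y := by
    intro x hx y hy s hs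
    refine ((hL' s (hsIcc s hs)).dist_le_mul _ (hxc x hx) _ (hxc y hy)).trans ?_
    rw [Prod.dist_eq, dist_self, max_eq_left dist_nonneg]
  have hδmem : ∀ x ∈ Metric.ball x₀ r', ∀ s ∈ Set.Ioo (-ε') ε',
      (α (x, id') s).1 ∈ Metric.ball x₀ δ := by
    intro x hx s hs
    have h1 : dist (α (x, id') s) (α (x₀, id') s) ≤ L' * dist x x₀ :=
      hdist x hx x₀ (Metric.mem_ball_self hr'0) s hs
    have h2 : dist (α (x₀, id') s) (x₀, id') < δ / 2 := by
      apply hcb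
      rw [Real.dist_eq, sub_zero, abs_lt]
      exact ⟨by linarith [hs.1, min_le_right ε ε₁], by linarith [hs.2, min_le_right ε ε₁]⟩
    have h3 : L' * dist x x₀ ≤ δ / 2 := by
      have : dist x x₀ ≤ δ / (2 * (L' + 1)) := (Metric.mem_ball.1 hx).le.trans (min_le_right _ _)
      calc L' * dist x x₀ ≤ L' * (δ / (2 * (L' + 1))) := by gcongr
        _ ≤ (L' + 1) * (δ / (2 * (L' + 1))) := by gcongr; linarith
        _ = δ / 2 := by
          have : (L' : ℝ) + 1 ≠ 0 := by positivity
          field_simp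
    rw [Metric.mem_ball]
    calc dist (α (x, id') s).1 x₀ ≤ dist (α (x, id') s) (x₀, id') := by
          rw [Prod.dist_eq]; exact le_max_left _ _
      _ ≤ _ := dist_triangle _ (α (x₀, id') s) _
      _ < δ := by linarith
  have hderiv : ∀ x ∈ Metric.ball x₀ r', ∀ s ∈ Set.Ioo (-ε') ε',
      HasDerivAt (α (x, id')) (F (α (x, id') s)) s := fun x hx s hs =>
    ((hα _ (hxc x hx)).2 s (hsIcc s hs)).hasDerivAt (Icc_mem_nhds
      (by linarith [hs.1, min_le_left ε ε₁]) (by linarith [hs.2, min_le_left ε ε₁]))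
  have hd1 : ∀ x ∈ Metric.ball x₀ r', ∀ s ∈ Set.Ioo (-ε') ε',
      HasDerivAt (fun s => (α (x, id') s).1) (f (α (x, id') s).1) s := fun x hx s hs =>
    (hderiv x hx s hs).fst
  have hd2 : ∀ x ∈ Metric.ball x₀ r', ∀ s ∈ Set.Ioo (-ε') ε',
      HasDerivAt (fun s => (α (x, id') s).2)
        ((fderiv ℝ f (α (x, id') s).1).comp (α (x, id') s).2) s := fun x hx s hs =>
    (hderiv x hx s hs).snd
  have hlip2 : ∀ x ∈ Metric.ball x₀ δ, ∀ y ∈ Metric.ball x₀ δ,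
      ‖fderiv ℝ f x - fderiv ℝ f y‖ ≤ K₂ * ‖x - y‖ := by
    intro x hx y hy
    rw [← dist_eq_norm, ← dist_eq_norm]
    exact hlip.dist_le_mul x (hball x hx).1.1 y (hball y hy).1.1
  refine ⟨r', hr'0, ε', hε'0, fun s x => (α (x, id') s).1, fun s x => (α (x, id') s).2, ?_⟩
  refine ⟨fun x hx => by rw [(hα _ (hxc x hx)).1], fun x hx => by rw [(hα _ (hxc x hx)).1],
    fun x hx s hs => (hball _ (hδmem x hx s hs)).1.2, hd1, fun x hx s hs => ?_, hd2,
    fun s hs => ?_⟩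
  · set C := K₂ * (L' : ℝ) ^ 2 * (Real.exp (K₁ * ε') / K₁) with hC
    have hC0 : 0 ≤ C := by positivity
    -- The error `w` of the linear approximation vanishes at time `0` and satisfies `‖w'‖ ≤ K₁ ‖w‖ +
    -- K₂ (L' ‖y - x‖)²`: a linear term, plus the Taylor remainder of `f`. Grönwall makes `w`
    -- quadratic in `y - x`.
    have key : ∀ y ∈ Metric.ball x₀ r', ‖(α (y, id') s).1 - (α (x, id') s).1 -
        (α (x, id') s).2 (y - x)‖ ≤ C * ‖y - x‖ ^ 2 := by
      intro y hy
      have := norm_le_of_norm_deriv_le (K := K₁) (η := K₂ * (L' * ‖y - x‖) ^ 2) (ε := ε')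
        (w := fun s => (α (y, id') s).1 - (α (x, id') s).1 - (α (x, id') s).2 (y - x))
        (w' := fun s => f (α (y, id') s).1 - f (α (x, id') s).1 -
          fderiv ℝ f (α (x, id') s).1 ((α (x, id') s).2 (y - x))) hK₁0 (by positivity)
        (by simp only [(hα _ (hxc x hx)).1, (hα _ (hxc y hy)).1]; simp [hid'])
        (fun s hs => ((hd1 y hy s hs).sub (hd1 x hx s hs)).sub (by
          have := (hd2 x hx s hs).clm_apply (hasDerivAt_const s (y - x))
          simpa using this))
        (fun s hs => by
          have h1 := norm_taylor_le (f := f) (s := Metric.ball x₀ δ) (convex_ball _ _)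
            (fun z hz => (hball z hz).2.1) hlip2 K₂.2 (hδmem x hx s hs) (hδmem y hy s hs)
          have h2 : ‖(α (y, id') s).1 - (α (x, id') s).1‖ ≤ L' * ‖y - x‖ := by
            rw [← dist_eq_norm, ← dist_eq_norm]
            refine le_trans ?_ (hdist y hy x hx s hs)
            rw [Prod.dist_eq]; exact le_max_left _ _
          set P := (α (y, id') s).1
          set Q := (α (x, id') s).1
          set B := (α (x, id') s).2
          have e : f P - f Q - fderiv ℝ f Q (B (y - x)) =
              (f P - f Q - fderiv ℝ f Q (P - Q)) + fderiv ℝ f Q (P - Q - B (y - x)) := by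
            rw [map_sub (fderiv ℝ f Q) (P - Q)]; abel
          change ‖f P - f Q - fderiv ℝ f Q (B (y - x))‖ ≤ K₁ * ‖P - Q - B (y - x)‖ + _
          rw [e]
          refine (norm_add_le _ _).trans ?_
          rw [add_comm]
          gcongr
          · exact (ContinuousLinearMap.le_opNorm _ _).trans
              (by gcongr; exact (hball _ (hδmem x hx s hs)).2.2.le)
          · exact h1.trans (by gcongr)) hs
      refine this.trans_eq ?_
      rw [hC]; ring
    refine HasFDerivAt.of_isLittleO ?_
    rw [Asymptotics.isLittleO_iff]
    intro c hc
    have h1 : ∀ᶠ y in 𝓝 x, y ∈ Metric.ball x₀ r' := Metric.isOpen_ball.mem_nhds hx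
    have h2 : ∀ᶠ y in 𝓝 x, ‖y - x‖ < c / (C + 1) := by
      have : ContinuousAt (fun y => ‖y - x‖) x := by fun_prop
      refine this.eventually_lt continuousAt_const ?_
      simp only [sub_self, norm_zero]
      positivity
    filter_upwards [h1, h2] with y hy hyc
    refine (key y hy).trans ?_
    rw [sq, ← mul_assoc]
    gcongr
    calc C * ‖y - x‖ ≤ (C + 1) * (c / (C + 1)) := by gcongr; linarith
      _ = c := by field_simp
  · have : LipschitzOnWith L' (fun x => (α (x, id') s).2) (Metric.ball x₀ r') := by
      refine LipschitzOnWith.of_dist_le_mul fun x hx y hy => ?_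
      refine le_trans ?_ (hdist x hx y hy s hs)
      rw [Prod.dist_eq]; exact le_max_right _ _
    exact this.continuousOn

end Flow

/-! ### Charts of the spacetime -/

section Charts

set_option linter.unusedSectionVars false

variable {M : Type*} [TopologicalSpace M] [ChartedSpace E4 M] [IsManifold (𝓡 4) ∞ M]
  {g : LorentzMetric M} {t : M → ℝ} {e : OpenPartialHomeomorph M E4} {y : E4} {p : M}

lemma sum_smul_single {n : ℕ} (v : EuclideanSpace ℝ (Fin n)) :
    ∑ i, v i • EuclideanSpace.single i (1 : ℝ) = v := by
  ext j
  simp [Finset.sum_apply, Pi.single_apply]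

lemma mdifferentiable_of_mem_maximalAtlas (he : e ∈ IsManifold.maximalAtlas (𝓡 4) ∞ M) :
    e.MDifferentiable (𝓡 4) (𝓡 4) :=
  ⟨(contMDiffOn_of_mem_maximalAtlas he).mdifferentiableOn (by simp),
    (contMDiffOn_symm_of_mem_maximalAtlas he).mdifferentiableOn (by simp)⟩

/-- The derivative of the inverse of a chart. -/
def dsymm (e : OpenPartialHomeomorph M E4) (y : E4) : E4 →L[ℝ] E4 :=
  mfderiv (𝓡 4) (𝓡 4) e.symm y

/-- The derivative of a function on the spacetime. -/
def dfun (f : M → ℝ) (p : M) : E4 →L[ℝ] ℝ := mfderiv (𝓡 4) 𝓘(ℝ, ℝ) f p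

/-- The metric, with the tangent spaces identified with the model space. -/
def LorentzMetric.bil (g : LorentzMetric M) (p : M) : E4 →L[ℝ] E4 →L[ℝ] ℝ := g.form p

/-- The derivative of the inverse of a chart, as an equivalence. -/
def dsymmEquiv (he : e ∈ IsManifold.maximalAtlas (𝓡 4) ∞ M) (hy : y ∈ e.target) : E4 ≃L[ℝ] E4 :=
  (mdifferentiable_of_mem_maximalAtlas he).symm.mfderiv (x := y) hy

lemma dsymmEquiv_apply (he : e ∈ IsManifold.maximalAtlas (𝓡 4) ∞ M) (hy : y ∈ e.target) (v : E4) :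
    dsymmEquiv he hy v = dsymm e y v := rfl

lemma dsymm_injective (he : e ∈ IsManifold.maximalAtlas (𝓡 4) ∞ M) (hy : y ∈ e.target) :
    Function.Injective (dsymm e y) := (dsymmEquiv he hy).injective

lemma dsymm_surjective (he : e ∈ IsManifold.maximalAtlas (𝓡 4) ∞ M) (hy : y ∈ e.target) :
    Function.Surjective (dsymm e y) := (dsymmEquiv he hy).surjective

lemma LorentzMetric.bil_dsymm (g : LorentzMetric M) (e : OpenPartialHomeomorph M E4)
    (y v w : E4) : g.bil (e.symm y) (dsymm e y v) (dsymm e y w) =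
      ∑ i, ∑ j, v i * w j * g.comp e y i j := by
  change _ = ∑ i, ∑ j, v i * w j * g.bil (e.symm y) (dsymm e y (EuclideanSpace.single i 1))
    (dsymm e y (EuclideanSpace.single j 1))
  conv_lhs => rw [← sum_smul_single v, ← sum_smul_single w]
  simp only [map_sum, map_smul, _root_.sum_apply, _root_.smul_apply, smul_eq_mul,
    Finset.mul_sum, mul_assoc]
  rw [Finset.sum_comm]
  refine Finset.sum_congr rfl fun a _ => Finset.sum_congr rfl fun c _ => by ring

lemma LorentzMetric.isLorentz (g : LorentzMetric M)
    (he : e ∈ IsManifold.maximalAtlas (𝓡 4) ∞ M) (hy : y ∈ e.target) :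
    IsLorentz (g.comp e y) := by
  refine ⟨Matrix.IsSymm.ext fun i j => g.symm _ _ _, ?_⟩
  obtain ⟨b, hb⟩ : ∃ b : Fin 4 → E4, ∀ i j, g.bil (e.symm y) (b i) (b j) =
      if i = j then (if i = 0 then -1 else 1) else 0 :=
    let ⟨b, hb⟩ := g.signature (e.symm y); ⟨b, hb⟩
  refine ⟨Matrix.of fun i j => (dsymmEquiv he hy).symm (b j) i, ?_⟩
  ext i j
  have h := g.bil_dsymm e y ((dsymmEquiv he hy).symm (b i)) ((dsymmEquiv he hy).symm (b j))
  rw [← dsymmEquiv_apply he hy, ← dsymmEquiv_apply he hy, ContinuousLinearEquiv.apply_symm_apply,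
    ContinuousLinearEquiv.apply_symm_apply, hb] at h
  rw [Matrix.diagonal_apply, h, Matrix.mul_apply]
  simp only [Matrix.mul_apply, Matrix.transpose_apply, Matrix.of_apply, Finset.sum_mul]
  rw [Finset.sum_comm]
  refine Finset.sum_congr rfl fun a _ => Finset.sum_congr rfl fun c _ => by ring

lemma contDiffOn_inChart {f : M → ℝ} (hf : ContMDiff (𝓡 4) 𝓘(ℝ, ℝ) ∞ f)
    (he : e ∈ IsManifold.maximalAtlas (𝓡 4) ∞ M) : ContDiffOn ℝ ∞ (inChart f e) e.target :=
  contMDiffOn_iff_contDiffOn.1 (hf.comp_contMDiffOn (contMDiffOn_symm_of_mem_maximalAtlas he))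

lemma IsTimeFunction.isTimeOn (ht : IsTimeFunction g t)
    (he : e ∈ IsManifold.maximalAtlas (𝓡 4) ∞ M) :
    IsTimeOn e.target (g.comp e) (inChart t e) where
  isOpen := e.open_target
  smooth := g.smooth e he
  lorentz := fun _ hy => g.isLorentz he hy
  smooth_time := contDiffOn_inChart ht.smooth he
  timelike := ht.grad_timelike e he

lemma fderiv_inChart {f : M → ℝ} (hf : ContMDiff (𝓡 4) 𝓘(ℝ, ℝ) ∞ f)
    (he : e ∈ IsManifold.maximalAtlas (𝓡 4) ∞ M) (hy : y ∈ e.target) (v : E4) :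
    fderiv ℝ (inChart f e) y v = dfun f (e.symm y) (dsymm e y v) := by
  have := mfderiv_comp y (hf.mdifferentiableAt (x := e.symm y) (by simp))
    ((mdifferentiable_of_mem_maximalAtlas he).mdifferentiableAt_symm hy)
  rw [← mfderiv_eq_fderiv]
  exact congrArg (fun L : E4 →L[ℝ] ℝ => L v) this

lemma LorentzMetric.eq_zero (g : LorentzMetric M) {v : E4} (h : ∀ w, g.bil p v w = 0) :
    v = 0 := by
  obtain ⟨b, hb⟩ : ∃ b : Module.Basis (Fin 4) ℝ E4, ∀ i j, g.bil p (b i) (b j) =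
      if i = j then (if i = 0 then -1 else 1) else 0 := g.signature p
  rw [← b.sum_repr v]
  refine Finset.sum_eq_zero fun i _ => ?_
  have := h (b i)
  rw [← b.sum_repr v] at this
  simp only [map_sum, map_smul, _root_.sum_apply, _root_.smul_apply, hb] at this
  simp only [smul_eq_mul, mul_ite, mul_zero, Finset.sum_ite_eq', Finset.mem_univ, if_true] at this
  split_ifs at this with h0
  · rw [show b.repr v i = 0 by linarith, zero_smul]
  · rw [show b.repr v i = 0 by linarith, zero_smul]

/-- The coordinate expression of the multiple of the gradient of `u` along which `u` grows at unit
speed. -/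
def timeVec (G : E4 → Matrix (Fin 4) (Fin 4) ℝ) (u : E4 → ℝ) (y : E4) : E4 :=
  WithLp.toLp 2 fun a => (gradSq G u y)⁻¹ * grad G u a y

lemma timeVec_apply (G : E4 → Matrix (Fin 4) (Fin 4) ℝ) (u : E4 → ℝ) (y : E4) (a : Fin 4) :
    timeVec G u y a = (gradSq G u y)⁻¹ * grad G u a y := rfl

lemma IsTimeOn.fderiv_timeVec {Ω : Set E4} {G : E4 → Matrix (Fin 4) (Fin 4) ℝ} {u : E4 → ℝ}
    (h : IsTimeOn Ω G u) (hy : y ∈ Ω) : fderiv ℝ u y (timeVec G u y) = 1 := by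
  rw [fderiv_eq_sum_pd]
  simp only [timeVec_apply, mul_assoc]
  rw [← Finset.mul_sum, ← h.gradSq_eq hy]
  exact inv_mul_cancel₀ (h.timelike y hy).ne

lemma IsTimeOn.lower_timeVec {Ω : Set E4} {G : E4 → Matrix (Fin 4) (Fin 4) ℝ} {u : E4 → ℝ}
    (h : IsTimeOn Ω G u) (hy : y ∈ Ω) (w : E4) :
    ∑ i, ∑ j, timeVec G u y i * w j * G y i j = (gradSq G u y)⁻¹ * fderiv ℝ u y w := by
  rw [fderiv_eq_sum_pd, Finset.mul_sum, Finset.sum_comm]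
  refine Finset.sum_congr rfl fun j _ => ?_
  rw [← h.lower_grad hy j, Finset.mul_sum, Finset.mul_sum]
  refine Finset.sum_congr rfl fun i _ => ?_
  rw [timeVec_apply, h.symm hy i j]
  ring

lemma IsTimeOn.smooth_timeVec {Ω : Set E4} {G : E4 → Matrix (Fin 4) (Fin 4) ℝ} {u : E4 → ℝ}
    (h : IsTimeOn Ω G u) : ContDiffOn ℝ ∞ (timeVec G u) Ω := by
  rw [contDiffOn_euclidean]
  exact fun a => (h.smooth_gradSq.inv fun y hy => (h.timelike y hy).ne).mul (h.smooth_grad a)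

/-- The multiple of the gradient of `t` along which `t` grows at unit speed. -/
def timeField (g : LorentzMetric M) (t : M → ℝ) (p : M) : TangentSpace (𝓡 4) p :=
  dsymm (chartAt E4 p) (chartAt E4 p p)
    (timeVec (g.comp (chartAt E4 p)) (inChart t (chartAt E4 p)) (chartAt E4 p p))

lemma IsTimeFunction.dfun_timeVec (ht : IsTimeFunction g t)
    (he : e ∈ IsManifold.maximalAtlas (𝓡 4) ∞ M) (hp : p ∈ e.source) :
    dfun t p (dsymm e (e p) (timeVec (g.comp e) (inChart t e) (e p))) = 1 := by
  have h := (ht.isTimeOn he).fderiv_timeVec (e.map_source hp)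
  rw [fderiv_inChart ht.smooth he (e.map_source hp)] at h
  rwa [e.left_inv hp] at h

lemma IsTimeFunction.bil_timeVec (ht : IsTimeFunction g t)
    (he : e ∈ IsManifold.maximalAtlas (𝓡 4) ∞ M) (hp : p ∈ e.source) (w : E4) :
    g.bil p (dsymm e (e p) (timeVec (g.comp e) (inChart t e) (e p))) w =
      (gradSq (g.comp e) (inChart t e) (e p))⁻¹ * dfun t p w := by
  obtain ⟨y, hy, rfl⟩ : ∃ y ∈ e.target, e.symm y = p := ⟨e p, e.map_source hp, e.left_inv hp⟩
  rw [e.right_inv hy]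
  obtain ⟨v, rfl⟩ := dsymm_surjective he hy w
  rw [← fderiv_inChart ht.smooth he hy, g.bil_dsymm e y]
  exact (ht.isTimeOn he).lower_timeVec hy v

/-- In every chart the vector `X` satisfies `g(X, ·) = c dt` and `dt(X) = 1`, with `c` the inverse
of `g(grad t, grad t)`. Since `g` is nondegenerate, these two relations determine both `X` and `c`,
so neither depends on the chart. -/
lemma IsTimeFunction.timeVec_unique (ht : IsTimeFunction g t) {e e' : OpenPartialHomeomorph M E4}
    (he : e ∈ IsManifold.maximalAtlas (𝓡 4) ∞ M) (he' : e' ∈ IsManifold.maximalAtlas (𝓡 4) ∞ M)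
    (hp : p ∈ e.source) (hp' : p ∈ e'.source) :
    gradSq (g.comp e) (inChart t e) (e p) = gradSq (g.comp e') (inChart t e') (e' p) ∧
    dsymm e (e p) (timeVec (g.comp e) (inChart t e) (e p)) =
      dsymm e' (e' p) (timeVec (g.comp e') (inChart t e') (e' p)) := by
  have h1 := ht.dfun_timeVec he hp
  have h1' := ht.dfun_timeVec he' hp'
  have h2 := ht.bil_timeVec he hp
  have h2' := ht.bil_timeVec he' hp'
  have hc := inv_ne_zero (ht.grad_timelike e he (e p) (e.map_source hp)).ne
  rw [← inv_inj]
  generalize dsymm e (e p) (timeVec (g.comp e) (inChart t e) (e p)) = X at *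
  generalize dsymm e' (e' p) (timeVec (g.comp e') (inChart t e') (e' p)) = X' at *
  generalize (gradSq (g.comp e) (inChart t e) (e p))⁻¹ = c at *
  generalize (gradSq (g.comp e') (inChart t e') (e' p))⁻¹ = c' at *
  have h0 : c' • X - c • X' = 0 := by
    refine g.eq_zero (p := p) fun w => ?_
    rw [map_sub, map_smul, map_smul, _root_.sub_apply, _root_.smul_apply, _root_.smul_apply,
      h2, h2', smul_eq_mul, smul_eq_mul]
    ring
  have h3 := congrArg (dfun t p) h0
  rw [map_sub, map_smul, map_smul, map_zero, h1, h1'] at h3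
  have h5 : c = c' := by
    simp only [smul_eq_mul, mul_one] at h3
    linarith
  refine ⟨h5, ?_⟩
  rw [← h5, ← smul_sub, smul_eq_zero, or_iff_right hc] at h0
  exact sub_eq_zero.1 h0

lemma IsTimeFunction.timeField_eq (ht : IsTimeFunction g t)
    (he : e ∈ IsManifold.maximalAtlas (𝓡 4) ∞ M) (hp : p ∈ e.source) :
    timeField g t p = dsymm e (e p) (timeVec (g.comp e) (inChart t e) (e p)) :=
  (ht.timeVec_unique (IsManifold.chart_mem_maximalAtlas p) he (mem_chart_source E4 p) hp).2

lemma IsTimeFunction.dfun_timeField (ht : IsTimeFunction g t) (p : M) :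
    dfun t p (timeField g t p) = 1 :=
  ht.dfun_timeVec (IsManifold.chart_mem_maximalAtlas p) (mem_chart_source E4 p)

lemma IsTimeFunction.bil_timeField_neg (ht : IsTimeFunction g t) (p : M) :
    g.bil p (timeField g t p) (timeField g t p) < 0 := by
  have he := IsManifold.chart_mem_maximalAtlas (I := 𝓡 4) (n := ∞) p
  have hp := mem_chart_source E4 p
  have := ht.bil_timeVec he hp (timeField g t p)
  rw [ht.dfun_timeField p, mul_one] at this
  refine lt_of_eq_of_lt this (inv_lt_zero.2 ?_)
  exact ht.grad_timelike _ he _ ((chartAt E4 p).map_source hp)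

lemma IsTimeFunction.lapse_eq (ht : IsTimeFunction g t)
    (he : e ∈ IsManifold.maximalAtlas (𝓡 4) ∞ M) (hp : p ∈ e.source) :
    lapse g t p = lapseLoc (g.comp e) (inChart t e) (e p) := by
  rw [lapse, lapseLoc, lapseLoc, (ht.timeVec_unique (IsManifold.chart_mem_maximalAtlas p) he
    (mem_chart_source E4 p) hp).1]

lemma IsTimeFunction.continuous_lapse (ht : IsTimeFunction g t) : Continuous (lapse g t) := by
  rw [continuous_iff_continuousAt]
  intro p
  have he := IsManifold.chart_mem_maximalAtlas (I := 𝓡 4) (n := ∞) p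
  have hp := mem_chart_source E4 p
  have h1 : ContinuousAt (fun q => lapseLoc (g.comp (chartAt E4 p)) (inChart t (chartAt E4 p))
      (chartAt E4 p q)) p :=
    ContinuousAt.comp (f := chartAt E4 p) (((ht.isTimeOn he).smooth_lapse.continuousOn).continuousAt
      ((chartAt E4 p).open_target.mem_nhds ((chartAt E4 p).map_source hp)))
      ((chartAt E4 p).continuousAt hp)
  refine h1.congr ?_
  filter_upwards [(chartAt E4 p).open_source.mem_nhds hp] with q hq
  exact (ht.lapse_eq he hq).symm

/-- Near `p` the field is the image of a smooth coordinate field under one fixed chart, although its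
definition changes chart from point to point. This regularity is what the uniqueness of integral
curves requires. -/
lemma IsTimeFunction.contMDiff_timeField (ht : IsTimeFunction g t) :
    ContMDiff (𝓡 4) (𝓡 4).tangent 1 (fun p => (⟨p, timeField g t p⟩ : TangentBundle (𝓡 4) M)) := by
  intro p
  set e := chartAt E4 p with hedef
  have he : e ∈ IsManifold.maximalAtlas (𝓡 4) ∞ M := IsManifold.chart_mem_maximalAtlas p
  have hp : p ∈ e.source := mem_chart_source E4 p
  have h1 : ContMDiffOn (𝓡 4) (𝓡 4).tangent 1
      (fun y => (⟨y, timeVec (g.comp e) (inChart t e) y⟩ : TangentBundle (𝓡 4) E4)) e.target :=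
    contMDiffOn_vectorSpace_iff_contDiffOn.2
      ((ht.isTimeOn he).smooth_timeVec.of_le (mod_cast le_top))
  have h2 : ContMDiffOn (𝓡 4).tangent (𝓡 4).tangent 1
      (tangentMapWithin (𝓡 4) (𝓡 4) e.symm e.target)
      (Bundle.TotalSpace.proj ⁻¹' e.target) :=
    (contMDiffOn_symm_of_mem_maximalAtlas he).contMDiffOn_tangentMapWithin
      (le_of_eq_of_le one_add_one_eq_two (WithTop.coe_le_coe.2 (le_top : (2 : ℕ∞) ≤ ⊤)))
      e.open_target.uniqueMDiffOn
  have h3 : ContMDiffOn (𝓡 4) (𝓡 4) 1 e e.source :=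
    (contMDiffOn_of_mem_maximalAtlas he).of_le (mod_cast le_top)
  have h4 := (h2.comp h1 fun y hy => hy).comp h3 e.mapsTo
  refine (h4.contMDiffAt (e.open_source.mem_nhds hp)).congr_of_eventuallyEq ?_
  filter_upwards [e.open_source.mem_nhds hp] with q hq
  simp only [Function.comp_apply, tangentMapWithin]
  rw [ht.timeField_eq he hq, mfderivWithin_of_isOpen e.open_target (e.map_source hq)]
  ext
  · exact (e.left_inv hq).symm
  · exact HEq.rfl

end Charts

/-! ### The flow of the time function -/

section TimeFlow

set_option linter.unusedSectionVars false

variable {M : Type*} [TopologicalSpace M] [ChartedSpace E4 M] [IsManifold (𝓡 4) ∞ M]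
  {g : LorentzMetric M} {t : M → ℝ} {e : OpenPartialHomeomorph M E4} {y : E4} {p : M}
  {γ : ℝ → M} {a b t₀ t₁ : ℝ}

lemma IsTimeFunction.isMIntegralCurveOn_of_chart (ht : IsTimeFunction g t)
    (he : e ∈ IsManifold.maximalAtlas (𝓡 4) ∞ M) {c : ℝ → E4} {J : Set ℝ}
    (hc : ∀ s ∈ J, HasDerivAt c (timeVec (g.comp e) (inChart t e) (c s)) s)
    (hct : ∀ s ∈ J, c s ∈ e.target) :
    IsMIntegralCurveOn (fun s => e.symm (c s)) (timeField g t) J := by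
  intro s hs
  refine HasMFDerivAt.hasMFDerivWithinAt ?_
  have h1 : HasMFDerivAt (𝓡 4) (𝓡 4) e.symm (c s) (dsymm e (c s)) :=
    ((mdifferentiable_of_mem_maximalAtlas he).mdifferentiableAt_symm (hct s hs)).hasMFDerivAt
  have h2 := (hc s hs).hasFDerivAt.hasMFDerivAt
  have h3 := h1.comp s h2
  refine h3.congr_mfderiv ?_
  have h4 := ht.timeField_eq he (e.map_target (hct s hs))
  rw [e.right_inv (hct s hs)] at h4
  refine DFunLike.ext _ _ fun (r : ℝ) => ?_
  change dsymm e (c s) (r • timeVec (g.comp e) (inChart t e) (c s)) = _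
  rw [map_smul, ← h4]
  rfl

lemma IsTimeFunction.hasDerivAt_time (ht : IsTimeFunction g t) {s : ℝ}
    (hγ : HasMFDerivAt 𝓘(ℝ, ℝ) (𝓡 4) γ s ((1 : ℝ →L[ℝ] ℝ).smulRight (timeField g t (γ s)))) :
    HasDerivAt (fun s => t (γ s)) 1 s := by
  have h1 : HasMFDerivAt (𝓡 4) 𝓘(ℝ, ℝ) t (γ s) (dfun t (γ s)) :=
    (ht.smooth.mdifferentiableAt (by simp)).hasMFDerivAt
  have h2 : HasFDerivAt (fun s => t (γ s)) ((dfun t (γ s)).comp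
      (ContinuousLinearMap.smulRight (M₂ := E4) (1 : ℝ →L[ℝ] ℝ) (timeField g t (γ s)))) s :=
    (h1.comp s hγ).hasFDerivAt
  have key : ∀ v : E4, (dfun t (γ s)).comp ((1 : ℝ →L[ℝ] ℝ).smulRight v) 1 = dfun t (γ s) v :=
    fun v => by simp
  exact h2.hasDerivAt.congr_deriv ((key _).trans (ht.dfun_timeField (γ s)))

lemma IsTimeFunction.time_eq (ht : IsTimeFunction g t)
    (hγ : IsMIntegralCurveOn γ (timeField g t) (Set.Ioo a b)) {s s' : ℝ}
    (hs : s ∈ Set.Ioo a b) (hs' : s' ∈ Set.Ioo a b) : t (γ s') = t (γ s) + (s' - s) := by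
  have hd : ∀ x ∈ Set.Ioo a b, HasDerivAt (fun s => t (γ s) - s) 0 x := fun x hx => by
    have := (ht.hasDerivAt_time ((hγ x hx).hasMFDerivAt (Ioo_mem_nhds hx.1 hx.2))).sub
      (hasDerivAt_id x)
    exact this.congr_deriv (sub_self 1)
  have := (convex_Ioo a b).is_const_of_fderivWithin_eq_zero (𝕜 := ℝ)
    (f := fun s => t (γ s) - s)
    (fun x hx => (hd x hx).differentiableAt.differentiableWithinAt) (fun x hx => by
      rw [fderivWithin_of_isOpen isOpen_Ioo hx, (hd x hx).hasFDerivAt.fderiv]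
      ext; simp) hs hs'
  linarith

/-- Near every point there is a local flow in a chart. -/
lemma IsTimeFunction.exists_isLocalFlow (ht : IsTimeFunction g t) (p : M) :
    ∃ r > 0, ∃ ε > 0, ∃ φ : ℝ → E4 → E4, ∃ A : ℝ → E4 → E4 →L[ℝ] E4,
      IsLocalFlow (timeVec (g.comp (chartAt E4 p)) (inChart t (chartAt E4 p))) (chartAt E4 p p)
        (chartAt E4 p).target r ε φ A := by
  have he := IsManifold.chart_mem_maximalAtlas (I := 𝓡 4) (n := ∞) p
  have hp := (chartAt E4 p).open_target.mem_nhds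
    ((chartAt E4 p).map_source (mem_chart_source E4 p))
  exact CMCFoliation.exists_isLocalFlow ((ht.isTimeOn he).smooth_timeVec.contDiffAt hp) hp

lemma IsTimeFunction.localFlow_curve (ht : IsTimeFunction g t)
    (he : e ∈ IsManifold.maximalAtlas (𝓡 4) ∞ M) {x₀ : E4} {r ε : ℝ}
    {φ : ℝ → E4 → E4} {A : ℝ → E4 → E4 →L[ℝ] E4}
    (h : IsLocalFlow (timeVec (g.comp e) (inChart t e)) x₀ e.target r ε φ A)
    {x : E4} (hx : x ∈ Metric.ball x₀ r) :
    IsMIntegralCurveOn (fun s => e.symm (φ s x)) (timeField g t) (Set.Ioo (-ε) ε) :=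
  ht.isMIntegralCurveOn_of_chart he (h.hasDerivAt x hx) (h.mem x hx)

/-- Integral curves exist for a uniform time near every point. -/
lemma IsTimeFunction.exists_uniform_time (ht : IsTimeFunction g t) (q : M) :
    ∃ ε > 0, ∃ U ∈ 𝓝 q, ∀ p ∈ U, ∃ γ : ℝ → M, γ 0 = p ∧
      IsMIntegralCurveOn γ (timeField g t) (Set.Ioo (-ε) ε) := by
  obtain ⟨r, hr, ε, hε, φ, A, h⟩ := ht.exists_isLocalFlow q
  have he := IsManifold.chart_mem_maximalAtlas (I := 𝓡 4) (n := ∞) q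
  have hq := mem_chart_source E4 q
  refine ⟨ε, hε, (chartAt E4 q).source ∩ (chartAt E4 q) ⁻¹' Metric.ball (chartAt E4 q q) r,
    Filter.inter_mem ((chartAt E4 q).open_source.mem_nhds hq)
      (((chartAt E4 q).continuousAt hq).preimage_mem_nhds (Metric.ball_mem_nhds _ hr)), ?_⟩
  rintro p ⟨hp, hpr⟩
  refine ⟨fun s => (chartAt E4 q).symm (φ s (chartAt E4 q p)), ?_, ht.localFlow_curve he h hpr⟩
  beta_reduce
  rw [h.init _ hpr, (chartAt E4 q).left_inv hp]

variable [T2Space M]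

lemma IsTimeFunction.curve_unique (ht : IsTimeFunction g t) {γ' : ℝ → M} {a' b' s₀ s : ℝ}
    (hγ : IsMIntegralCurveOn γ (timeField g t) (Set.Ioo a b))
    (hγ' : IsMIntegralCurveOn γ' (timeField g t) (Set.Ioo a' b'))
    (h₀ : s₀ ∈ Set.Ioo a b) (h₀' : s₀ ∈ Set.Ioo a' b') (h : γ s₀ = γ' s₀)
    (hs : s ∈ Set.Ioo a b) (hs' : s ∈ Set.Ioo a' b') : γ s = γ' s := by
  refine isMIntegralCurveOn_Ioo_eqOn_of_contMDiff_boundaryless (a := max a a') (b := min b b')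
    ⟨max_lt h₀.1 h₀'.1, lt_min h₀.2 h₀'.2⟩ ht.contMDiff_timeField
    (hγ.mono (Set.Ioo_subset_Ioo (le_max_left _ _) (min_le_left _ _)))
    (hγ'.mono (Set.Ioo_subset_Ioo (le_max_right _ _) (min_le_right _ _))) h
    ⟨max_lt hs.1 hs'.1, lt_min hs.2 hs'.2⟩

/-- By uniqueness an integral curve agrees near `s` with the local flow in a chart, whose velocity
is continuous. This is the `C¹` condition in the definition of a causal curve. -/
lemma IsTimeFunction.contMDiffAt_curve (ht : IsTimeFunction g t)
    (hγ : IsMIntegralCurveOn γ (timeField g t) (Set.Ioo a b)) {s : ℝ} (hs : s ∈ Set.Ioo a b) :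
    ContMDiffAt 𝓘(ℝ, ℝ) (𝓡 4) 1 γ s := by
  obtain ⟨r, hr, ε, hε, φ, A, h⟩ := ht.exists_isLocalFlow (γ s)
  set e := chartAt E4 (γ s) with hedef
  have he : e ∈ IsManifold.maximalAtlas (𝓡 4) ∞ M := IsManifold.chart_mem_maximalAtlas (γ s)
  have hp : γ s ∈ e.source := mem_chart_source E4 (γ s)
  set x := e (γ s) with hx
  have hxr : x ∈ Metric.ball x r := Metric.mem_ball_self hr
  have hloc := (ht.localFlow_curve he h hxr).comp_add (-s)
  have hset : {s' | s' + -s ∈ Set.Ioo (-ε) ε} = Set.Ioo (s - ε) (s + ε) := by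
    ext s'
    simp only [Set.mem_ofPred_eq, Set.mem_Ioo]
    constructor <;> rintro ⟨h1, h2⟩ <;> constructor <;> linarith
  rw [hset] at hloc
  have hs2 : s ∈ Set.Ioo (s - ε) (s + ε) := ⟨by linarith, by linarith⟩
  have heq : γ =ᶠ[𝓝 s] fun s' => e.symm (φ (s' - s) x) := by
    filter_upwards [Ioo_mem_nhds hs.1 hs.2, Ioo_mem_nhds hs2.1 hs2.2] with s' h1 h2
    refine ht.curve_unique hγ hloc hs hs2 ?_ h1 h2
    simp only [Function.comp_apply, add_neg_cancel]
    rw [h.init x hxr, e.left_inv hp]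
  refine ContMDiffAt.congr_of_eventuallyEq ?_ heq
  have h0 : (0 : ℝ) ∈ Set.Ioo (-ε) ε := ⟨by linarith, hε⟩
  have hmem := h.mem x hxr
  have hd := h.hasDerivAt x hxr
  have hc : ContDiffOn ℝ 1 (fun s => φ s x) (Set.Ioo (-ε) ε) := by
    rw [show (1 : WithTop ℕ∞) = 0 + 1 from rfl, contDiffOn_succ_iff_deriv_of_isOpen isOpen_Ioo]
    refine ⟨fun s' hs' => (hd s' hs').differentiableAt.differentiableWithinAt, by simp,
      contDiffOn_zero.2 ?_⟩
    have : ContinuousOn (fun s => timeVec (g.comp e) (inChart t e) (φ s x)) (Set.Ioo (-ε) ε) :=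
      (ht.isTimeOn he).smooth_timeVec.continuousOn.comp
        (fun s' hs' => (hd s' hs').continuousAt.continuousWithinAt) hmem
    exact this.congr fun s' hs' => (hd s' hs').deriv
  have hc1 : ContDiffAt ℝ 1 (fun s' => φ (s' - s) x) s := by
    refine ContDiffAt.comp (g := fun s => φ s x) s ?_ (by fun_prop)
    rw [sub_self]
    exact hc.contDiffAt (Ioo_mem_nhds h0.1 h0.2)
  refine ContMDiffAt.comp (I' := 𝓡 4) (g := e.symm) s ?_ hc1.contMDiffAt
  refine (contMDiffAt_symm_of_mem_maximalAtlas he ?_).of_le (mod_cast le_top)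
  rw [sub_self]
  exact hmem 0 h0

/-- The integral curves of the time field are defined as long as `t` permits. -/
theorem IsTimeFunction.exists_curve (ht : IsTimeFunction g t) (hrange : Set.range t = Set.Ioo t₀ t₁)
    (p : M) : ∃ γ : ℝ → M, γ 0 = p ∧
      IsMIntegralCurveOn γ (timeField g t) (Set.Ioo (t₀ - t p) (t₁ - t p)) := by
  -- the maximal interval of existence
  set P : ℝ → ℝ → ℝ → (ℝ → M) → Prop := fun s a b γ => (0 : ℝ) ∈ Set.Ioo a b ∧ s ∈ Set.Ioo a b ∧
    γ 0 = p ∧ IsMIntegralCurveOn γ (timeField g t) (Set.Ioo a b) with hP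
  set J : Set ℝ := {s | ∃ a b γ, P s a b γ} with hJ
  have hsub : ∀ {s a b γ}, P s a b γ → Set.Ioo a b ⊆ J := fun h x hx =>
    ⟨_, _, _, h.1, hx, h.2.2⟩
  have hJopen : IsOpen J := isOpen_iff_mem_nhds.2 fun s ⟨a, b, γ, h⟩ =>
    Filter.mem_of_superset (Ioo_mem_nhds h.2.1.1 h.2.1.2) (hsub h)
  have h0J : (0 : ℝ) ∈ J := by
    obtain ⟨ε, hε, U, hU, h⟩ := ht.exists_uniform_time p
    obtain ⟨γ, hγ0, hγ⟩ := h p (mem_of_mem_nhds hU)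
    have h0 : (0 : ℝ) ∈ Set.Ioo (-ε) ε := ⟨by linarith, hε⟩
    exact ⟨-ε, ε, γ, h0, h0, hγ0, hγ⟩
  have hJconn : J.OrdConnected := by
    have : J = ⋃ i : {i : ℝ × ℝ × (ℝ → M) // P 0 i.1 i.2.1 i.2.2},
        Set.Ioo i.1.1 i.1.2.1 := by
      ext s
      rw [Set.mem_iUnion]
      exact ⟨fun ⟨a, b, γ, h⟩ => ⟨⟨(a, b, γ), h.1, h.1, h.2.2⟩, h.2.1⟩,
        fun ⟨⟨⟨a, b, γ⟩, h⟩, hs⟩ => ⟨a, b, γ, h.1, hs, h.2.2⟩⟩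
    rw [← isPreconnected_iff_ordConnected, this]
    exact isPreconnected_iUnion ⟨0, Set.mem_iInter.2 fun i => i.2.1⟩ fun i => isPreconnected_Ioo
  have : Nonempty (ℝ → M) := ⟨fun _ => p⟩
  -- For each time a solution reaching it is chosen; its value there defines `c`. By uniqueness `c`
  -- agrees with every such solution, so it is an integral curve on all of `J`.
  choose! A B Γ hΓ using fun s (hs : s ∈ J) => hs
  set c : ℝ → M := fun s => Γ s s with hc
  have hceq : ∀ {s a b γ}, P s a b γ → Set.EqOn c γ (Set.Ioo a b) := by
    intro s a b γ h x hx
    have hx' := hΓ x (hsub h hx)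
    exact ht.curve_unique (γ := Γ x) hx'.2.2.2 h.2.2.2 hx'.1 h.1 (hx'.2.2.1.trans h.2.2.1.symm) hx'.2.1 hx
  have hccurve : ∀ {s a b γ}, P s a b γ → IsMIntegralCurveOn c (timeField g t) (Set.Ioo a b) := by
    intro s a b γ h x hx
    have h1 := h.2.2.2 x hx
    rw [hceq h hx]
    exact h1.congr_of_eventuallyEq (Filter.eventually_of_mem self_mem_nhdsWithin (hceq h))
      (hceq h hx)
  have hc0 : c 0 = p := (hΓ 0 h0J).2.2.1
  have htime : ∀ s ∈ J, t (c s) = t p + s := by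
    intro s hs
    have h := hΓ s hs
    rw [ht.time_eq (hccurve h) h.1 h.2.1, hc0, sub_zero]
  have hJI : J ⊆ Set.Ioo (t₀ - t p) (t₁ - t p) := by
    intro s hs
    have : t (c s) ∈ Set.Ioo t₀ t₁ := hrange ▸ Set.mem_range_self (c s)
    rw [htime s hs] at this
    exact ⟨by linarith [this.1], by linarith [this.2]⟩
  -- extension by a local integral curve
  have hext : ∀ s ∈ J, ∀ ε > 0, (∃ γ : ℝ → M, γ 0 = c s ∧
      IsMIntegralCurveOn γ (timeField g t) (Set.Ioo (-ε) ε)) → Set.Ioo (s - ε) (s + ε) ⊆ J := by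
    rintro s hs ε hε ⟨γ, hγ0, hγ⟩
    have h := hΓ s hs
    have hloc := hγ.comp_add (-s)
    have hset : {s' | s' + -s ∈ Set.Ioo (-ε) ε} = Set.Ioo (s - ε) (s + ε) := by
      ext s'
      simp only [Set.mem_ofPred_eq, Set.mem_Ioo]
      constructor <;> rintro ⟨h1, h2⟩ <;> constructor <;> linarith
    rw [hset] at hloc
    have hs2 : s ∈ Set.Ioo (s - ε) (s + ε) := ⟨by linarith, by linarith⟩
    have hglue := isMIntegralCurveOn_piecewise ht.contMDiff_timeField (hccurve h) hloc
      ⟨h.2.1, hs2⟩ (by simp [hγ0])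
    have h1 := h.2.1
    rw [Set.Ioo_union_Ioo' (by linarith [h1.2]) (by linarith [h1.1])] at hglue
    intro x hx
    refine ⟨min (A s) (s - ε), max (B s) (s + ε), _, ?_, ?_, ?_, hglue⟩
    · exact ⟨(min_le_left _ _).trans_lt h.1.1, h.1.2.trans_le (le_max_left _ _)⟩
    · exact ⟨(min_le_right _ _).trans_lt hx.1, hx.2.trans_le (le_max_right _ _)⟩
    · rw [Set.piecewise_eq_of_mem _ _ _ h.1, hc0]
  have hcJ : ∀ s ∈ J, HasMFDerivAt 𝓘(ℝ, ℝ) (𝓡 4) c s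
      ((1 : ℝ →L[ℝ] ℝ).smulRight (timeField g t (c s))) := fun s hs =>
    (hccurve (hΓ s hs) s (hΓ s hs).2.1).hasMFDerivAt
      (Ioo_mem_nhds (hΓ s hs).2.1.1 (hΓ s hs).2.1.2)
  have hvel : ∀ s ∈ J, mfderiv 𝓘(ℝ, ℝ) (𝓡 4) c s (1 : ℝ) = timeField g t (c s) := by
    intro s hs
    rw [(hcJ s hs).mfderiv]
    exact one_smul ℝ (timeField g t (c s))
  have hcausal : IsInextendibleCausalCurve g J c := by
    refine ⟨hJopen, ⟨0, h0J⟩, hJconn, fun s hs => (ht.contMDiffAt_curve (hccurve (hΓ s hs))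
      (hΓ s hs).2.1).contMDiffWithinAt, fun s hs h => ?_, fun s hs => ?_, ?_, ?_⟩
    · rw [hvel s hs] at h
      have := ht.dfun_timeField (c s)
      have h' : dfun t (c s) (timeField g t (c s)) = dfun t (c s) 0 := congrArg (dfun t (c s)) h
      rw [map_zero] at h'
      exact zero_ne_one (h'.symm.trans this)
    · rw [hvel s hs]
      exact (ht.bil_timeField_neg (c s)).le
    -- Near an endpoint `q` integral curves exist for a uniform time `ε`. Restarting the curve less
    -- than `ε` before the supremum of `J` extends it beyond `J`.
    · rintro ⟨q, hq⟩
      obtain ⟨ε, hε, U, hU, h⟩ := ht.exists_uniform_time q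
      obtain ⟨s₀, hs₀, hs₀U⟩ := hq U hU
      have hbdd : BddAbove J := ⟨t₁ - t p, fun s hs => (hJI hs).2.le⟩
      obtain ⟨s, hs, hlt⟩ := exists_lt_of_lt_csSup ⟨0, h0J⟩ (show sSup J - ε < sSup J by linarith)
      have hm : max s s₀ ∈ J := by
        rcases max_choice s s₀ with h | h <;> rw [h] <;> assumption
      have := hext _ hm ε hε (h _ (hs₀U _ hm (le_max_right _ _)))
      have hmax : sSup J < max s s₀ + ε := by linarith [le_max_left s s₀]
      have hle : max s s₀ ≤ sSup J := le_csSup hbdd hm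
      have hmem := this (show (sSup J + (max s s₀ + ε)) / 2 ∈ _ from ⟨by linarith, by linarith⟩)
      linarith [le_csSup hbdd hmem]
    · rintro ⟨q, hq⟩
      obtain ⟨ε, hε, U, hU, h⟩ := ht.exists_uniform_time q
      obtain ⟨s₀, hs₀, hs₀U⟩ := hq U hU
      have hbdd : BddBelow J := ⟨t₀ - t p, fun s hs => (hJI hs).1.le⟩
      obtain ⟨s, hs, hlt⟩ := exists_lt_of_csInf_lt ⟨0, h0J⟩ (show sInf J < sInf J + ε by linarith)
      have hm : min s s₀ ∈ J := by
        rcases min_choice s s₀ with h | h <;> rw [h] <;> assumption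
      have := hext _ hm ε hε (h _ (hs₀U _ hm (min_le_right _ _)))
      have hmin : min s s₀ - ε < sInf J := by linarith [min_le_left s s₀]
      have hle : sInf J ≤ min s s₀ := csInf_le hbdd hm
      have hmem := this (show (sInf J + (min s s₀ - ε)) / 2 ∈ _ from ⟨by linarith, by linarith⟩)
      linarith [csInf_le hbdd hmem]
  -- The slice `t = t p + s` is a nonempty Cauchy hypersurface, so it meets `c`. As `t` grows at
  -- unit speed along `c`, this can happen only at the parameter `s`, which therefore belongs to
  -- `J`.
  have hIJ : Set.Ioo (t₀ - t p) (t₁ - t p) ⊆ J := by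
    intro s hs
    have hmem : t p + s ∈ Set.range t := by
      rw [hrange]; exact ⟨by linarith [hs.1], by linarith [hs.2]⟩
    obtain ⟨q, hq⟩ := hmem
    obtain ⟨s', ⟨hs'J, hs'⟩, -⟩ := ht.cauchy (t p + s) ⟨q, hq⟩ J c hcausal
    have h1 : t (c s') = t p + s := hs'
    rw [htime s' hs'J] at h1
    rwa [show s = s' by linarith]
  exact ⟨c, hc0, fun s hs => (hcJ s (hIJ hs)).hasMFDerivWithinAt⟩

end TimeFlow

/-! ### The global flow of the time field, its group law and its regularity. -/

section FlowMap

set_option linter.unusedSectionVars false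

variable {M : Type*} [TopologicalSpace M] [ChartedSpace E4 M] [IsManifold (𝓡 4) ∞ M] [T2Space M]
  {g : LorentzMetric M} {t : M → ℝ} {e : OpenPartialHomeomorph M E4} {p : M}
  {t₀ t₁ : ℝ} {Φ : ℝ → M → M}

/-- `Φ` is the flow of the time field. -/
structure IsTimeFlow (g : LorentzMetric M) (t : M → ℝ) (t₀ t₁ : ℝ) (Φ : ℝ → M → M) : Prop where
  timeFunction : IsTimeFunction g t
  range_eq : Set.range t = Set.Ioo t₀ t₁
  zero : ∀ p, Φ 0 p = p
  curve : ∀ p, IsMIntegralCurveOn (fun s => Φ s p) (timeField g t)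
    (Set.Ioo (t₀ - t p) (t₁ - t p))

lemma IsTimeFunction.exists_isTimeFlow (ht : IsTimeFunction g t)
    (hrange : Set.range t = Set.Ioo t₀ t₁) : ∃ Φ, IsTimeFlow g t t₀ t₁ Φ := by
  choose γ h0 hγ using ht.exists_curve hrange
  exact ⟨fun s p => γ p s, ht, hrange, h0, hγ⟩

namespace IsTimeFlow

variable (h : IsTimeFlow g t t₀ t₁ Φ) {s s' : ℝ}
include h

lemma mem_Ioo (p : M) : t p ∈ Set.Ioo t₀ t₁ := h.range_eq ▸ Set.mem_range_self p

lemma zero_mem (p : M) : (0 : ℝ) ∈ Set.Ioo (t₀ - t p) (t₁ - t p) :=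
  ⟨by linarith [(h.mem_Ioo p).1], by linarith [(h.mem_Ioo p).2]⟩

lemma time (hs : s ∈ Set.Ioo (t₀ - t p) (t₁ - t p)) : t (Φ s p) = t p + s := by
  rw [h.timeFunction.time_eq (h.curve p) (h.zero_mem p) hs, h.zero, sub_zero]

lemma mem_shift (hs : s ∈ Set.Ioo (t₀ - t p) (t₁ - t p)) :
    s' ∈ Set.Ioo (t₀ - t (Φ s p)) (t₁ - t (Φ s p)) ↔ s + s' ∈ Set.Ioo (t₀ - t p) (t₁ - t p) := by
  rw [h.time hs]
  constructor <;> rintro ⟨h1, h2⟩ <;> constructor <;> linarith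

lemma add (hs : s ∈ Set.Ioo (t₀ - t p) (t₁ - t p)) (hs' : s + s' ∈ Set.Ioo (t₀ - t p) (t₁ - t p)) :
    Φ (s + s') p = Φ s' (Φ s p) := by
  have h1 := (h.curve p).comp_add s
  have hset : {x | x + s ∈ Set.Ioo (t₀ - t p) (t₁ - t p)} =
      Set.Ioo (t₀ - t p - s) (t₁ - t p - s) := by
    ext x
    simp only [Set.mem_ofPred_eq, Set.mem_Ioo]
    constructor <;> rintro ⟨h1, h2⟩ <;> constructor <;> linarith
  rw [hset] at h1
  have := h.timeFunction.curve_unique (s₀ := 0) (s := s') h1 (h.curve (Φ s p))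
    ⟨by linarith [hs.1], by linarith [hs.2]⟩ (h.zero_mem _)
    (by simp [h.zero]) ⟨by linarith [hs'.1], by linarith [hs'.2]⟩ ((h.mem_shift hs).2 hs')
  rw [← this, Function.comp_apply, add_comm]

lemma neg_add (hs : s ∈ Set.Ioo (t₀ - t p) (t₁ - t p)) : Φ (-s) (Φ s p) = p := by
  rw [← h.add hs (by rw [add_neg_cancel]; exact h.zero_mem p), add_neg_cancel, h.zero]

lemma eventually_mem (hs : s ∈ Set.Ioo (t₀ - t p) (t₁ - t p)) :
    ∀ᶠ q in 𝓝 p, s ∈ Set.Ioo (t₀ - t q) (t₁ - t q) := by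
  have hc : ContinuousAt t p := h.timeFunction.smooth.continuous.continuousAt
  have h1 : ∀ᶠ q in 𝓝 p, t₀ - s < t q := hc.eventually (lt_mem_nhds (by linarith [hs.1]))
  have h2 : ∀ᶠ q in 𝓝 p, t q < t₁ - s := hc.eventually (gt_mem_nhds (by linarith [hs.2]))
  filter_upwards [h1, h2] with q h1 h2
  exact ⟨by linarith, by linarith⟩

/-- The chart curve stays in the manifold, where `t` has values in `(t₀, t₁)`. Hence its parameter
automatically lies in the interval on which the global flow is controlled, and uniqueness applies.
-/
lemma eq_localFlow (he : e ∈ IsManifold.maximalAtlas (𝓡 4) ∞ M) {x₀ : E4} {r ε : ℝ}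
    {φ : ℝ → E4 → E4} {A : ℝ → E4 → E4 →L[ℝ] E4}
    (hφ : IsLocalFlow (timeVec (g.comp e) (inChart t e)) x₀ e.target r ε φ A)
    (hp : p ∈ e.source) (hpr : e p ∈ Metric.ball x₀ r) (hs : s ∈ Set.Ioo (-ε) ε) :
    s ∈ Set.Ioo (t₀ - t p) (t₁ - t p) ∧ Φ s p = e.symm (φ s (e p)) := by
  have hc := h.timeFunction.localFlow_curve he hφ hpr
  have h0 : (0 : ℝ) ∈ Set.Ioo (-ε) ε := ⟨by linarith [hs.1, hs.2], by linarith [hs.1, hs.2]⟩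
  have hz : e.symm (φ 0 (e p)) = p := by rw [hφ.init _ hpr, e.left_inv hp]
  have htime := h.timeFunction.time_eq hc h0 hs
  have hmem := h.mem_Ioo (e.symm (φ s (e p)))
  beta_reduce at htime
  rw [htime, hz] at hmem
  have hsI : s ∈ Set.Ioo (t₀ - t p) (t₁ - t p) := ⟨by linarith [hmem.1], by linarith [hmem.2]⟩
  exact ⟨hsI, h.timeFunction.curve_unique (h.curve p) hc (h.zero_mem p) h0
    (by rw [h.zero, hz]) hsI hs⟩

/-- The flow in a chart around a point of an orbit. -/
lemma eventually_eq_localFlow (he : e ∈ IsManifold.maximalAtlas (𝓡 4) ∞ M) {x₀ : E4} {r ε : ℝ}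
    {φ : ℝ → E4 → E4} {A : ℝ → E4 → E4 →L[ℝ] E4}
    (hφ : IsLocalFlow (timeVec (g.comp e) (inChart t e)) x₀ e.target r ε φ A)
    (hs : s ∈ Set.Ioo (t₀ - t p) (t₁ - t p))
    (hcont : ContinuousAt (Φ s) p) (hp : Φ s p ∈ e.source)
    (hpr : e (Φ s p) ∈ Metric.ball x₀ r) (hs' : s' - s ∈ Set.Ioo (-ε) ε) :
    ∀ᶠ q in 𝓝 p, Φ s' q = e.symm (φ (s' - s) (e (Φ s q))) := by
  have h1 : ∀ᶠ q in 𝓝 p, Φ s q ∈ e.source ∩ e ⁻¹' Metric.ball x₀ r :=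
    hcont.preimage_mem_nhds (Filter.inter_mem (e.open_source.mem_nhds hp)
      ((e.continuousAt hp).preimage_mem_nhds (Metric.isOpen_ball.mem_nhds hpr)))
  filter_upwards [h1, h.eventually_mem hs] with q hq hqs
  obtain ⟨h2, h3⟩ := h.eq_localFlow he hφ hq.1 hq.2 hs'
  rw [← h3, ← h.add hqs ((h.mem_shift hqs).1 h2), add_sub_cancel]

omit h in
lemma _root_.CMCFoliation.IsLocalFlow.contDiffOn {f : E4 → E4} {x₀ : E4} {W : Set E4} {r ε : ℝ}
    {φ : ℝ → E4 → E4} {A : ℝ → E4 → E4 →L[ℝ] E4} (hφ : IsLocalFlow f x₀ W r ε φ A)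
    (hs : s ∈ Set.Ioo (-ε) ε) : ContDiffOn ℝ 1 (φ s) (Metric.ball x₀ r) := by
  rw [show (1 : WithTop ℕ∞) = 0 + 1 from rfl,
    contDiffOn_succ_iff_fderiv_of_isOpen Metric.isOpen_ball]
  refine ⟨fun x hx => (hφ.hasFDerivAt x hx s hs).differentiableAt.differentiableWithinAt, by simp,
    contDiffOn_zero.2 ((hφ.continuousOn s hs).congr fun x hx => (hφ.hasFDerivAt x hx s hs).fderiv)⟩

lemma contMDiffAt_step (he : e ∈ IsManifold.maximalAtlas (𝓡 4) ∞ M) {x₀ : E4} {r ε : ℝ}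
    {φ : ℝ → E4 → E4} {A : ℝ → E4 → E4 →L[ℝ] E4}
    (hφ : IsLocalFlow (timeVec (g.comp e) (inChart t e)) x₀ e.target r ε φ A)
    (hs : s ∈ Set.Ioo (t₀ - t p) (t₁ - t p)) (hp : Φ s p ∈ e.source)
    (hpr : e (Φ s p) ∈ Metric.ball x₀ r) (hs' : s' - s ∈ Set.Ioo (-ε) ε)
    (hC : ContMDiffAt (𝓡 4) (𝓡 4) 1 (Φ s) p) : ContMDiffAt (𝓡 4) (𝓡 4) 1 (Φ s') p := by
  refine ContMDiffAt.congr_of_eventuallyEq ?_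
    (h.eventually_eq_localFlow he hφ hs hC.continuousAt hp hpr hs')
  have h1 : ContMDiffAt (𝓡 4) (𝓡 4) 1 (fun q => e (Φ s q)) p :=
    ContMDiffAt.comp p ((contMDiffAt_of_mem_maximalAtlas he hp).of_le (mod_cast le_top)) hC
  have h2 : ContMDiffAt (𝓡 4) (𝓡 4) 1 (φ (s' - s)) (e (Φ s p)) :=
    ((hφ.contDiffOn hs').contDiffAt (Metric.isOpen_ball.mem_nhds hpr)).contMDiffAt
  have h3 : ContMDiffAt (𝓡 4) (𝓡 4) 1 e.symm (φ (s' - s) (e (Φ s p))) :=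
    (contMDiffAt_symm_of_mem_maximalAtlas he (hφ.mem _ hpr _ hs')).of_le (mod_cast le_top)
  exact ContMDiffAt.comp p h3 (ContMDiffAt.comp p h2 h1)

/-- Being `C¹` at `p` is a property of `Φ s` that is unchanged under small changes of `s`, since
nearby times differ by a local flow in one chart, run forward or backward. It holds at `s = 0`, and
the interval of times is connected. -/
lemma contMDiffAt (hs : s ∈ Set.Ioo (t₀ - t p) (t₁ - t p)) :
    ContMDiffAt (𝓡 4) (𝓡 4) 1 (Φ s) p := by
  have key : (ContMDiffAt (𝓡 4) (𝓡 4) 1 (Φ 0) p ↔ ContMDiffAt (𝓡 4) (𝓡 4) 1 (Φ s) p) := by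
    refine isPreconnected_Ioo.induction₂ (s := Set.Ioo (t₀ - t p) (t₁ - t p))
      (fun a b => ContMDiffAt (𝓡 4) (𝓡 4) 1 (Φ a) p ↔ ContMDiffAt (𝓡 4) (𝓡 4) 1 (Φ b) p)
      (fun a ha => ?_) (fun a b c _ _ _ h1 h2 => h1.trans h2) (fun a b _ _ h1 => h1.symm)
      (h.zero_mem p) hs
    obtain ⟨r, hr, ε, hε, φ, A, hφ⟩ := h.timeFunction.exists_isLocalFlow (Φ a p)
    have he := IsManifold.chart_mem_maximalAtlas (I := 𝓡 4) (n := ∞) (Φ a p)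
    set e := chartAt E4 (Φ a p)
    have hq : Φ a p ∈ e.source := mem_chart_source E4 (Φ a p)
    have hcont : ContinuousWithinAt (fun s => Φ s p) (Set.Ioo (t₀ - t p) (t₁ - t p)) a :=
      (h.curve p).continuousWithinAt ha
    have h1 : ∀ᶠ b in 𝓝[Set.Ioo (t₀ - t p) (t₁ - t p)] a,
        Φ b p ∈ e.source ∩ e ⁻¹' Metric.ball (e (Φ a p)) r :=
      hcont (Filter.inter_mem (e.open_source.mem_nhds hq)
        ((e.continuousAt hq).preimage_mem_nhds (Metric.ball_mem_nhds _ hr)))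
    have h2 : ∀ᶠ b in 𝓝[Set.Ioo (t₀ - t p) (t₁ - t p)] a, b ∈ Set.Ioo (a - ε) (a + ε) :=
      nhdsWithin_le_nhds (Ioo_mem_nhds (by linarith) (by linarith))
    filter_upwards [h1, h2, self_mem_nhdsWithin] with b hb1 hb2 hb
    exact ⟨h.contMDiffAt_step he hφ ha hq (Metric.mem_ball_self hr)
      ⟨by linarith [hb2.1], by linarith [hb2.2]⟩,
      h.contMDiffAt_step he hφ hb hb1.1 hb1.2 ⟨by linarith [hb2.2], by linarith [hb2.1]⟩⟩
  refine key.1 (contMDiffAt_id.congr_of_eventuallyEq ?_)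
  exact Filter.Eventually.of_forall fun q => h.zero q

/-- `Φ (-s)` inverts `Φ s` in a whole neighbourhood of `p`, so the chain rule provides a left
inverse of the differential. -/
lemma mfderiv_injective (hs : s ∈ Set.Ioo (t₀ - t p) (t₁ - t p)) :
    Function.Injective (mfderiv (𝓡 4) (𝓡 4) (Φ s) p) := by
  have hs' : -s ∈ Set.Ioo (t₀ - t (Φ s p)) (t₁ - t (Φ s p)) :=
    (h.mem_shift hs).2 (by rw [add_neg_cancel]; exact h.zero_mem p)
  have h1 := ((h.contMDiffAt hs).mdifferentiableAt (by simp)).hasMFDerivAt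
  have h2 := ((h.contMDiffAt hs').mdifferentiableAt (by simp)).hasMFDerivAt
  have h3 := h2.comp p h1
  have h4 : HasMFDerivAt (𝓡 4) (𝓡 4) (Φ (-s) ∘ Φ s) p
      (ContinuousLinearMap.id ℝ (TangentSpace (𝓡 4) p)) := by
    refine (hasMFDerivAt_id p).congr_of_eventuallyEq ?_
    filter_upwards [h.eventually_mem hs] with q hq
    exact h.neg_add hq
  have h5 := hasMFDerivAt_unique h3 h4
  exact Function.LeftInverse.injective
    (g := fun v => mfderiv (𝓡 4) (𝓡 4) (Φ (-s)) (Φ s p) v) fun v => congrArg (fun L => L v) h5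

end IsTimeFlow

end FlowMap

/-! ### The evolution of the induced metric in coordinates -/

section GramEvolution

open Matrix

/-- Jacobi's formula in size three, by differentiating the six products in the expansion of the
determinant. -/
lemma hasDerivAt_det_three {B : ℝ → Matrix (Fin 3) (Fin 3) ℝ} {B' : Matrix (Fin 3) (Fin 3) ℝ}
    {s : ℝ} (hB : ∀ i j, HasDerivAt (fun s => B s i j) (B' i j) s) :
    HasDerivAt (fun s => (B s).det) (((B s).adjugate * B').trace) s := by
  have h := fun i j k => (hB 0 i).mul ((hB 1 j).mul (hB 2 k))
  have h1 := (((((h 0 1 2).sub (h 0 2 1)).sub (h 1 0 2)).add (h 1 2 0)).add (h 2 0 1)).sub (h 2 1 0)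
  refine (h1.congr_of_eventuallyEq (Filter.Eventually.of_forall fun s => ?_)).congr_deriv ?_
  · simp only [det_fin_three, Pi.add_apply, Pi.sub_apply, Pi.mul_apply]
    ring
  · simp only [trace_fin_three, adjugate_fin_three, mul_apply, Fin.sum_univ_three, of_apply,
      cons_val', cons_val_zero, cons_val_one, cons_val_two, Pi.mul_apply,
      cons_val_fin_one, head_cons, tail_cons, head_fin_const]
    ring

variable {Ω : Set E4} {G : E4 → Matrix (Fin 4) (Fin 4) ℝ} {u : E4 → ℝ} {y : E4}

lemma IsTimeOn.timeVec_eq (h : IsTimeOn Ω G u) (hy : y ∈ Ω) (a : Fin 4) :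
    timeVec G u y a = lapseLoc G u y * normal G u a y := by
  have h1 := h.lapse_sq_mul hy
  have h2 := (h.timelike y hy).ne
  rw [timeVec_apply, normal]
  have : (gradSq G u y)⁻¹ = -(lapseLoc G u y * lapseLoc G u y) := by
    field_simp
    linarith
  rw [this]
  ring

/-- The components of the Lie derivative of the metric along `timeVec G u`. -/
def lieMetric (G : E4 → Matrix (Fin 4) (Fin 4) ℝ) (u : E4 → ℝ) (a b : Fin 4) (y : E4) : ℝ :=
  (∑ c, timeVec G u y c * pd c (fun z => G z a b) y) +
    (∑ c, G y c b * pd a (fun z => timeVec G u z c) y) +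
    ∑ c, G y a c * pd b (fun z => timeVec G u z c) y

/-- The Lie derivative along `T` is the symmetrization of `D_a T_b`, that is of `-k`. The factor `n`
in `timeVec = n T` adds products of `dn` with the covector `T_b = -n ∂_b u`. -/
lemma IsTimeOn.lieMetric_eq (h : IsTimeOn Ω G u) (hy : y ∈ Ω) (a b : Fin 4) :
    lieMetric G u a b y = -(lapseLoc G u y * (sff G u a b y + sff G u b a y)) -
      lapseLoc G u y * (pd a (lapseLoc G u) y * pd b u y + pd b (lapseLoc G u) y * pd a u y) := by
  have hX : ∀ a c, pd a (fun z => timeVec G u z c) y =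
      pd a (lapseLoc G u) y * normal G u c y + lapseLoc G u y * pd a (normal G u c) y := by
    intro a c
    rw [pd_congr a h.isOpen (fun z hz => h.timeVec_eq hz c) hy,
      pd_mul a (differentiableAt_of_smooth h.isOpen h.smooth_lapse hy)
        (differentiableAt_of_smooth h.isOpen (h.smooth_normal c) hy)]
  have e1 : ∑ c, timeVec G u y c * pd c (fun z => G z a b) y =
      lapseLoc G u y * ∑ c, (G y c b * ∑ d, christoffel G c a d y * normal G u d y +
        G y c a * ∑ d, christoffel G c b d y * normal G u d y) := by
    rw [Finset.mul_sum]
    simp only [h.timeVec_eq hy, h.metric_compat hy a b, Finset.mul_sum, mul_add,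
      Finset.sum_add_distrib]
    rw [Finset.sum_comm, add_comm]
    congr 1
    · rw [Finset.sum_comm]
      refine Finset.sum_congr rfl fun c _ => Finset.sum_congr rfl fun d _ => ?_
      rw [h.christoffel_symm hy c a d, h.symm hy b c]; ring
    · refine Finset.sum_congr rfl fun c _ => Finset.sum_congr rfl fun d _ => ?_
      rw [h.christoffel_symm hy c b d, h.symm hy a c]; ring
  have e2 : ∀ a b, ∑ c, G y c b * pd a (fun z => timeVec G u z c) y =
      -(lapseLoc G u y * (pd a (lapseLoc G u) y * pd b u y)) +
        lapseLoc G u y * ∑ c, G y c b * pd a (normal G u c) y := by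
    intro a b
    have e3 : ∑ c, G y c b * normal G u c y = -(lapseLoc G u y * pd b u y) := by
      rw [← h.lower_normal hy b]
      exact Finset.sum_congr rfl fun c _ => by rw [h.symm hy b c]
    calc _ = pd a (lapseLoc G u) y * (∑ c, G y c b * normal G u c y) +
          lapseLoc G u y * ∑ c, G y c b * pd a (normal G u c) y := by
          rw [Finset.mul_sum, Finset.mul_sum, ← Finset.sum_add_distrib]
          exact Finset.sum_congr rfl fun c _ => by rw [hX]; ring
      _ = _ := by rw [e3]; ring
  have e4 : ∑ c, G y a c * pd b (fun z => timeVec G u z c) y =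
      ∑ c, G y c a * pd b (fun z => timeVec G u z c) y :=
    Finset.sum_congr rfl fun c _ => by rw [h.symm hy a c]
  have e5 : ∀ a b, sff G u a b y = -((∑ c, G y c b * pd a (normal G u c) y) +
      ∑ c, G y c b * ∑ d, christoffel G c a d y * normal G u d y) := by
    intro a b
    rw [sff, ← Finset.sum_add_distrib]
    exact congrArg Neg.neg (Finset.sum_congr rfl fun c _ => by ring)
  rw [lieMetric, e1, e4, e2 a b, e2 b a, e5 a b, e5 b a, Finset.sum_add_distrib]
  ring

lemma IsTimeOn.lieMetric_symm (h : IsTimeOn Ω G u) (hy : y ∈ Ω) (a b : Fin 4) :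
    lieMetric G u a b y = lieMetric G u b a y := by
  rw [h.lieMetric_eq hy, h.lieMetric_eq hy]
  ring

lemma IsTimeOn.horizInv_symm (h : IsTimeOn Ω G u) (hy : y ∈ Ω) (a b : Fin 4) :
    horizInv G u a b y = horizInv G u b a y := by
  rw [horizInv, horizInv, h.inv_symm hy a b, mul_comm (normal G u a y)]

/-- The terms with `du` vanish in the horizontal trace, and each of the two orderings of `k`
contributes the mean curvature. -/
lemma IsTimeOn.trace_lieMetric (h : IsTimeOn Ω G u) (hy : y ∈ Ω) :
    ∑ a, ∑ b, horizInv G u a b y * lieMetric G u a b y =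
      -2 * lapseLoc G u y * traceSff G u y := by
  have e0 := h.horizInv_time hy
  have e1 : ∑ a, ∑ b, horizInv G u a b y * (pd a (lapseLoc G u) y * pd b u y) = 0 := by
    refine Finset.sum_eq_zero fun a _ => ?_
    have := congrArg (fun x => pd a (lapseLoc G u) y * x) (e0 a)
    rw [mul_zero, Finset.mul_sum] at this
    rw [← this]
    exact Finset.sum_congr rfl fun b _ => by ring
  have e2 : ∑ a, ∑ b, horizInv G u a b y * (pd b (lapseLoc G u) y * pd a u y) = 0 := by
    rw [Finset.sum_comm, ← e1]
    refine Finset.sum_congr rfl fun a _ => Finset.sum_congr rfl fun b _ => ?_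
    rw [h.horizInv_symm hy b a]
  have e3 : ∑ a, ∑ b, horizInv G u a b y * sff G u b a y = traceSff G u y := by
    rw [Finset.sum_comm, traceSff]
    refine Finset.sum_congr rfl fun a _ => Finset.sum_congr rfl fun b _ => ?_
    rw [h.horizInv_symm hy b a]
  have e4 : ∑ a, ∑ b, horizInv G u a b y * lieMetric G u a b y =
      -lapseLoc G u y * ((∑ a, ∑ b, horizInv G u a b y * sff G u a b y) +
        (∑ a, ∑ b, horizInv G u a b y * sff G u b a y) +
        (∑ a, ∑ b, horizInv G u a b y * (pd a (lapseLoc G u) y * pd b u y)) +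
        ∑ a, ∑ b, horizInv G u a b y * (pd b (lapseLoc G u) y * pd a u y)) := by
    simp only [← Finset.sum_add_distrib, Finset.mul_sum]
    refine Finset.sum_congr rfl fun a _ => Finset.sum_congr rfl fun b _ => ?_
    rw [h.lieMetric_eq hy]
    ring
  rw [e4, e1, e2, e3, traceSff]
  ring

/-- The Gram matrix of the rows of `V`. -/
def gramMatrix (A : Matrix (Fin 4) (Fin 4) ℝ) (V : Matrix (Fin 3) (Fin 4) ℝ) :
    Matrix (Fin 3) (Fin 3) ℝ := V * A * Vᵀ

lemma gramMatrix_apply (A : Matrix (Fin 4) (Fin 4) ℝ) (V : Matrix (Fin 3) (Fin 4) ℝ)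
    (i j : Fin 3) : gramMatrix A V i j = ∑ a, ∑ b, V i a * V j b * A a b := by
  simp only [gramMatrix, mul_apply, transpose_apply, Finset.sum_mul]
  rw [Finset.sum_comm]
  exact Finset.sum_congr rfl fun a _ => Finset.sum_congr rfl fun b _ => by ring

lemma IsTimeOn.normal_orthogonal (h : IsTimeOn Ω G u) (hy : y ∈ Ω) {v : Fin 4 → ℝ}
    (hv : ∑ a, v a * pd a u y = 0) :
    (fun a => normal G u a y) ⬝ᵥ (G y) *ᵥ v = 0 := by
  rw [(h.lorentz y hy).dotProduct_comm]
  calc v ⬝ᵥ (G y) *ᵥ (fun a => normal G u a y) =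
        ∑ a, v a * ∑ b, G y a b * normal G u b y := rfl
    _ = -lapseLoc G u y * ∑ a, v a * pd a u y := by
        rw [Finset.mul_sum]
        exact Finset.sum_congr rfl fun a _ => by rw [h.lower_normal hy]; ring
    _ = 0 := by rw [hv, mul_zero]

/-- Combinations of the rows are tangent to the level set, hence orthogonal to the timelike vector
`T`, hence spacelike. The Gram matrix of independent rows is therefore positive definite. -/
lemma IsTimeOn.gramMatrix_det_pos (h : IsTimeOn Ω G u) (hy : y ∈ Ω)
    {V : Matrix (Fin 3) (Fin 4) ℝ} (hV : ∀ i, ∑ a, V i a * pd a u y = 0)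
    (hinj : ∀ x : Fin 3 → ℝ, x ᵥ* V = 0 → x = 0) : 0 < (gramMatrix (G y) V).det := by
  refine PosDef.det_pos (PosDef.of_dotProduct_mulVec_pos ?_ fun x hx => ?_)
  · rw [gramMatrix, IsHermitian, conjTranspose_eq_transpose_of_trivial, transpose_mul,
      transpose_mul, transpose_transpose, (h.lorentz y hy).1, Matrix.mul_assoc]
  · have h1 : star x ⬝ᵥ gramMatrix (G y) V *ᵥ x = (x ᵥ* V) ⬝ᵥ (G y) *ᵥ (x ᵥ* V) := by
      rw [star_trivial, gramMatrix, ← mulVec_mulVec, ← mulVec_mulVec, mulVec_transpose,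
        dotProduct_mulVec]
    rw [h1]
    refine (h.lorentz y hy).pos_of_orthogonal (T := fun a => normal G u a y) ?_
      (h.normal_orthogonal hy ?_) fun h0 => hx (hinj x h0)
    · rw [h.normal_unit' hy]; norm_num
    · simp only [vecMul, dotProduct, Finset.sum_mul]
      rw [Finset.sum_comm]
      refine Finset.sum_eq_zero fun i _ => ?_
      have := congrArg (fun r => x i * r) (hV i)
      rw [mul_zero, Finset.mul_sum] at this
      rw [← this]
      exact Finset.sum_congr rfl fun a _ => by ring

/-- The derivative of the volume density along the flow. -/
theorem IsTimeOn.hasDerivAt_det_gramMatrix (h : IsTimeOn Ω G u) {z : ℝ → E4} {s : ℝ}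
    {V : ℝ → Matrix (Fin 3) (Fin 4) ℝ} (hy : z s ∈ Ω)
    (hz : HasDerivAt z (timeVec G u (z s)) s)
    (hV : ∀ i a, HasDerivAt (fun s => V s i a)
      (∑ b, V s i b * pd b (fun z => timeVec G u z a) (z s)) s)
    (htan : ∀ i, ∑ a, V s i a * pd a u (z s) = 0)
    (hdet : (gramMatrix (G (z s)) (V s)).det ≠ 0) :
    HasDerivAt (fun s => (gramMatrix (G (z s)) (V s)).det)
      (-2 * lapseLoc G u (z s) * traceSff G u (z s) * (gramMatrix (G (z s)) (V s)).det) s := by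
  set L : Matrix (Fin 4) (Fin 4) ℝ := Matrix.of fun a b => lieMetric G u a b (z s) with hL
  have hG : ∀ a b, HasDerivAt (fun s => G (z s) a b)
      (∑ c, timeVec G u (z s) c * pd c (fun z => G z a b) (z s)) s := by
    intro a b
    have h1 := (differentiableAt_of_smooth h.isOpen (h.smooth a b) hy).hasFDerivAt.comp_hasDerivAt s
      hz
    rw [fderiv_eq_sum_pd] at h1
    exact h1
  have hB : ∀ i j, HasDerivAt (fun s => gramMatrix (G (z s)) (V s) i j)
      ((V s * L * (V s)ᵀ) i j) s := by
    intro i j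
    simp only [gramMatrix_apply]
    have h1 := HasDerivAt.fun_sum (u := Finset.univ) fun a _ =>
      HasDerivAt.fun_sum (u := Finset.univ) fun b _ => ((hV i a).mul (hV j b)).mul (hG a b)
    refine h1.congr_deriv ?_
    have h2 := gramMatrix_apply L (V s) i j
    rw [gramMatrix] at h2
    rw [h2]
    simp only [hL, of_apply, lieMetric, mul_add, add_mul, Finset.sum_add_distrib]
    rw [add_comm, ← add_assoc]
    congr 1
    · congr 1
      · simp only [Finset.sum_mul, Finset.mul_sum]
        rw [Finset.sum_comm]
        conv_rhs => rw [Finset.sum_comm]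
        refine Finset.sum_congr rfl fun b _ => ?_
        rw [Finset.sum_comm]
        refine Finset.sum_congr rfl fun c _ => Finset.sum_congr rfl fun d _ => ?_
        ring
    · simp only [Finset.sum_mul, Finset.mul_sum]
      refine Finset.sum_congr rfl fun a _ => ?_
      rw [Finset.sum_comm]
      refine Finset.sum_congr rfl fun c _ => Finset.sum_congr rfl fun d _ => ?_
      ring
  refine (hasDerivAt_det_three hB).congr_deriv ?_
  set g := gramMatrix (G (z s)) (V s) with hg
  -- Jacobi's formula becomes `det` times the trace of `g⁻¹ g'`. The adapted frame identity `hframe`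
  -- then rewrites this trace over slice indices as the spacetime contraction of `lieMetric` with
  -- `γ^{ab}`.
  have hadj : g.adjugate = g.det • g⁻¹ := by
    rw [inv_def, smul_smul, Ring.inverse_eq_inv', mul_inv_cancel₀ hdet, one_smul]
  have hframe := inv_eq_of_adapted_frame (h.lorentz _ hy) (h.normal_unit' hy)
    (fun i => h.normal_orthogonal hy (htan i)) hdet
  have htr : (g⁻¹ * (V s * L * (V s)ᵀ)).trace = -2 * lapseLoc G u (z s) * traceSff G u (z s) := by
    rw [← h.trace_lieMetric hy]
    calc (g⁻¹ * (V s * L * (V s)ᵀ)).trace = (((V s)ᵀ * g⁻¹ * V s) * L).trace := by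
          rw [← Matrix.mul_assoc, trace_mul_comm]
          simp only [Matrix.mul_assoc]
      _ = _ := by
          rw [hg, gramMatrix, hframe, trace]
          refine Finset.sum_congr rfl fun a _ => ?_
          rw [diag_apply, mul_apply]
          refine Finset.sum_congr rfl fun b _ => ?_
          rw [hL, of_apply, horizInv, Matrix.add_apply, vecMulVec_apply]
          rw [h.lieMetric_symm hy b a]
  rw [hadj, Matrix.smul_mul, trace_smul, htr, smul_eq_mul]
  ring

end GramEvolution

/-! ### The evolution of the induced metric on the slices -/

section Pullback

open Matrix

set_option linter.unusedSectionVars false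

variable {M : Type*} [TopologicalSpace M] [ChartedSpace E4 M] [IsManifold (𝓡 4) ∞ M]
  {g : LorentzMetric M} {t : M → ℝ} {e : OpenPartialHomeomorph M E4} {p : M} {x : E3}
  {ψ ψ' : E3 → M} {τ : ℝ}

/-- The derivative of a parametrization. -/
def dparam (ψ : E3 → M) (x : E3) : E3 →L[ℝ] E4 := mfderiv (𝓡 3) (𝓡 4) ψ x

lemma pullbackGram_apply (g : LorentzMetric M) (ψ : E3 → M) (x : E3) (i j : Fin 3) :
    pullbackGram g ψ x i j = g.bil (ψ x) (dparam ψ x (EuclideanSpace.single i 1))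
      (dparam ψ x (EuclideanSpace.single j 1)) := rfl

lemma dparam_congr (h : ψ =ᶠ[𝓝 x] ψ') : dparam ψ x = dparam ψ' x := h.mfderiv_eq

lemma pullbackGram_congr (h : ψ =ᶠ[𝓝 x] ψ') : pullbackGram g ψ x = pullbackGram g ψ' x := by
  ext i j
  rw [pullbackGram_apply, pullbackGram_apply, dparam_congr h, h.eq_of_nhds]

lemma dparam_symm_comp (he : e ∈ IsManifold.maximalAtlas (𝓡 4) ∞ M) {c : E3 → E4}
    {c' : E3 →L[ℝ] E4} (hc : HasFDerivAt c c' x) (hx : c x ∈ e.target) :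
    dparam (e.symm ∘ c) x = (dsymm e (c x)).comp c' := by
  have h1 : HasMFDerivAt (𝓡 4) (𝓡 4) e.symm (c x) (dsymm e (c x)) :=
    ((mdifferentiable_of_mem_maximalAtlas he).mdifferentiableAt_symm hx).hasMFDerivAt
  exact (h1.comp x hc.hasMFDerivAt).mfderiv

/-- The matrix whose rows are the images of the coordinate vectors. -/
def rowMatrix (L : E3 →L[ℝ] E4) : Matrix (Fin 3) (Fin 4) ℝ :=
  Matrix.of fun i a => L (EuclideanSpace.single i 1) a

lemma vecMul_rowMatrix (L : E3 →L[ℝ] E4) (v : Fin 3 → ℝ) :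
    v ᵥ* rowMatrix L = fun a => L (WithLp.toLp 2 v) a := by
  ext a
  conv_rhs => rw [← sum_smul_single (WithLp.toLp 2 v)]
  simp [vecMul, dotProduct, rowMatrix]

lemma eq_zero_of_vecMul_rowMatrix {L : E3 →L[ℝ] E4} (hL : Function.Injective L) {v : Fin 3 → ℝ}
    (h : v ᵥ* rowMatrix L = 0) : v = 0 := by
  rw [vecMul_rowMatrix] at h
  have h1 : L (WithLp.toLp 2 v) = 0 := by
    ext a
    exact congrFun h a
  have h2 : WithLp.toLp 2 v = (0 : E3) := hL (by rw [h1, map_zero])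
  exact (WithLp.toLp_eq_zero 2).1 h2

lemma pullbackGram_eq (he : e ∈ IsManifold.maximalAtlas (𝓡 4) ∞ M) {c : E3 → E4}
    {c' : E3 →L[ℝ] E4} (h : ψ =ᶠ[𝓝 x] e.symm ∘ c) (hc : HasFDerivAt c c' x)
    (hx : c x ∈ e.target) :
    pullbackGram g ψ x = gramMatrix (g.comp e (c x)) (rowMatrix c') := by
  ext i j
  rw [pullbackGram_congr h, pullbackGram_apply, dparam_symm_comp he hc hx, gramMatrix_apply,
    Function.comp_apply, ContinuousLinearMap.comp_apply, ContinuousLinearMap.comp_apply,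
    g.bil_dsymm]
  rfl

lemma exists_chart_param (he : e ∈ IsManifold.maximalAtlas (𝓡 4) ∞ M)
    (hψ : MDifferentiableAt (𝓡 3) (𝓡 4) ψ x) (hx : ψ x ∈ e.source) :
    ψ =ᶠ[𝓝 x] e.symm ∘ (e ∘ ψ) ∧ DifferentiableAt ℝ (e ∘ ψ) x := by
  refine ⟨?_, ?_⟩
  · filter_upwards [hψ.continuousAt.preimage_mem_nhds (e.open_source.mem_nhds hx)] with z hz
    exact (e.left_inv hz).symm
  · exact (((mdifferentiable_of_mem_maximalAtlas he).mdifferentiableAt hx).comp x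
      hψ).differentiableAt

lemma IsTimeFunction.tangent_param (ht : IsTimeFunction g t)
    (he : e ∈ IsManifold.maximalAtlas (𝓡 4) ∞ M)
    (hψ : MDifferentiableAt (𝓡 3) (𝓡 4) ψ x) (hx : ψ x ∈ e.source)
    (hslice : ∀ᶠ z in 𝓝 x, t (ψ z) = τ) (i : Fin 3) :
    ∑ a, rowMatrix (fderiv ℝ (e ∘ ψ) x) i a * pd a (inChart t e) (e (ψ x)) = 0 := by
  obtain ⟨h1, h2⟩ := exists_chart_param he hψ hx
  have h3 : (fun z => inChart t e ((e ∘ ψ) z)) =ᶠ[𝓝 x] fun _ => τ := by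
    filter_upwards [h1, hslice] with z hz hz'
    rw [← hz', inChart]
    exact congrArg t hz.symm
  have hu : DifferentiableAt ℝ (inChart t e) ((e ∘ ψ) x) :=
    differentiableAt_of_smooth e.open_target (contDiffOn_inChart ht.smooth he) (e.map_source hx)
  have h4 := hu.hasFDerivAt.comp x h2.hasFDerivAt
  have h5 := h4.congr_of_eventuallyEq h3.symm
  have h6 := h5.unique (hasFDerivAt_const τ x)
  have h7 := congrArg (fun L => L (EuclideanSpace.single i 1)) h6
  simp only [ContinuousLinearMap.comp_apply, fderiv_eq_sum_pd] at h7
  exact h7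

lemma injective_chart_param (he : e ∈ IsManifold.maximalAtlas (𝓡 4) ∞ M)
    (hψ : MDifferentiableAt (𝓡 3) (𝓡 4) ψ x) (hx : ψ x ∈ e.source)
    (hinj : Function.Injective (dparam ψ x)) : Function.Injective (fderiv ℝ (e ∘ ψ) x) := by
  obtain ⟨h1, h2⟩ := exists_chart_param he hψ hx
  rw [dparam_congr h1, dparam_symm_comp he h2.hasFDerivAt (e.map_source hx)] at hinj
  exact Function.Injective.of_comp hinj

lemma IsTimeFunction.pullbackGram_det_pos (ht : IsTimeFunction g t)
    (hψ : MDifferentiableAt (𝓡 3) (𝓡 4) ψ x) (hinj : Function.Injective (dparam ψ x))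
    (hslice : ∀ᶠ z in 𝓝 x, t (ψ z) = τ) : 0 < (pullbackGram g ψ x).det := by
  have he := IsManifold.chart_mem_maximalAtlas (I := 𝓡 4) (n := ∞) (ψ x)
  have hx := mem_chart_source E4 (ψ x)
  obtain ⟨h1, h2⟩ := exists_chart_param he hψ hx
  rw [pullbackGram_eq he h1 h2.hasFDerivAt ((chartAt E4 (ψ x)).map_source hx)]
  exact (ht.isTimeOn he).gramMatrix_det_pos ((chartAt E4 (ψ x)).map_source hx)
    (ht.tangent_param he hψ hx hslice)
    fun v hv => eq_zero_of_vecMul_rowMatrix (injective_chart_param he hψ hx hinj) hv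

variable [T2Space M] {t₀ t₁ s : ℝ} {Φ : ℝ → M → M}

lemma IsTimeFlow.mdifferentiableAt_comp (h : IsTimeFlow g t t₀ t₁ Φ)
    (hψ : MDifferentiableAt (𝓡 3) (𝓡 4) ψ x)
    (hs : s ∈ Set.Ioo (t₀ - t (ψ x)) (t₁ - t (ψ x))) :
    MDifferentiableAt (𝓡 3) (𝓡 4) (Φ s ∘ ψ) x :=
  ((h.contMDiffAt hs).mdifferentiableAt (by simp)).comp x hψ

lemma IsTimeFlow.injective_comp (h : IsTimeFlow g t t₀ t₁ Φ)
    (hψ : MDifferentiableAt (𝓡 3) (𝓡 4) ψ x) (hinj : Function.Injective (dparam ψ x))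
    (hs : s ∈ Set.Ioo (t₀ - t (ψ x)) (t₁ - t (ψ x))) :
    Function.Injective (dparam (Φ s ∘ ψ) x) := by
  have h1 := mfderiv_comp x ((h.contMDiffAt hs).mdifferentiableAt (by simp)) hψ
  change Function.Injective (mfderiv (𝓡 3) (𝓡 4) (Φ s ∘ ψ) x)
  rw [h1]
  exact (h.mfderiv_injective hs).comp hinj

lemma IsTimeFlow.eventually_slice (h : IsTimeFlow g t t₀ t₁ Φ)
    (hψ : ContinuousAt ψ x) (hslice : ∀ᶠ z in 𝓝 x, t (ψ z) = τ)
    (hs : s ∈ Set.Ioo (t₀ - t (ψ x)) (t₁ - t (ψ x))) :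
    ∀ᶠ z in 𝓝 x, t ((Φ s ∘ ψ) z) = τ + s := by
  filter_upwards [hslice, hψ.eventually (h.eventually_mem hs)] with z hz hz'
  rw [Function.comp_apply, h.time hz', hz]

set_option maxHeartbeats 1000000 in
/-- Along the flow of the time field, the volume density evolves by the mean curvature. -/
theorem IsTimeFlow.hasDerivAt_det_pullbackGram (h : IsTimeFlow g t t₀ t₁ Φ)
    (hcmc : ∀ e ∈ IsManifold.maximalAtlas (𝓡 4) ∞ M, ∀ y ∈ e.target,
      traceSff (g.comp e) (inChart t e) y = inChart t e y)
    (hψ : MDifferentiableAt (𝓡 3) (𝓡 4) ψ x) (hinj : Function.Injective (dparam ψ x))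
    (hslice : ∀ᶠ z in 𝓝 x, t (ψ z) = τ)
    (hs : s ∈ Set.Ioo (t₀ - t (ψ x)) (t₁ - t (ψ x))) :
    HasDerivAt (fun s => (pullbackGram g (Φ s ∘ ψ) x).det)
      (-2 * lapse g t (Φ s (ψ x)) * (τ + s) * (pullbackGram g (Φ s ∘ ψ) x).det) s := by
  obtain ⟨r, hr, ε, hε, φ, A, hφ⟩ := h.timeFunction.exists_isLocalFlow (Φ s (ψ x))
  have he := IsManifold.chart_mem_maximalAtlas (I := 𝓡 4) (n := ∞) (Φ s (ψ x))
  have hq := mem_chart_source E4 (Φ s (ψ x))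
  set e := chartAt E4 (Φ s (ψ x)) with hedef
  have ht := h.timeFunction
  have hT := ht.isTimeOn he
  have hΨ := h.mdifferentiableAt_comp hψ hs
  have hΨinj := h.injective_comp hψ hinj hs
  have hΨslice := h.eventually_slice hψ.continuousAt hslice hs
  obtain ⟨h1, h2⟩ := exists_chart_param he hΨ hq
  set y := e (Φ s (ψ x)) with hy
  have hyt : y ∈ e.target := e.map_source hq
  have hyr : y ∈ Metric.ball y r := Metric.mem_ball_self hr
  have h0 : (0 : ℝ) ∈ Set.Ioo (-ε) ε := ⟨by linarith, hε⟩
  set c' := fderiv ℝ (e ∘ Φ s ∘ ψ) x with hc'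
  set z : ℝ → E4 := fun s' => φ (s' - s) y with hz
  set V : ℝ → Matrix (Fin 3) (Fin 4) ℝ := fun s' => rowMatrix ((A (s' - s) y).comp c') with hV
  have hzs : z s = y := by simp only [hz, sub_self, hφ.init y hyr]
  have hVs : V s = rowMatrix c' := by
    simp only [hV, sub_self, hφ.init_deriv y hyr, ContinuousLinearMap.id_comp]
  -- For `s'` near `s`, `Φ s'` is `Φ s` followed by the local flow for time `s' - s` in one chart.
  -- The base point moves along an integral curve and the tangent frame by the linearized flow `A`,
  -- so the coordinate computation applies.
  have hgram : ∀ s', s' - s ∈ Set.Ioo (-ε) ε →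
      pullbackGram g (Φ s' ∘ ψ) x = gramMatrix (g.comp e (z s')) (V s') := by
    intro s' hs'
    have e1 := h.eventually_eq_localFlow he hφ hs (h.contMDiffAt hs).continuousAt hq hyr hs'
    have e2 : Φ s' ∘ ψ =ᶠ[𝓝 x] e.symm ∘ (φ (s' - s) ∘ (e ∘ Φ s ∘ ψ)) :=
      hψ.continuousAt.eventually e1
    have e3 : HasFDerivAt (φ (s' - s) ∘ (e ∘ Φ s ∘ ψ)) ((A (s' - s) y).comp c') x :=
      HasFDerivAt.comp x (hφ.hasFDerivAt y hyr _ hs') h2.hasFDerivAt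
    have e4 : (φ (s' - s) ∘ (e ∘ Φ s ∘ ψ)) x ∈ e.target := hφ.mem y hyr _ hs'
    have e5 := pullbackGram_eq (g := g) he e2 e3 e4
    have e6 : (φ (s' - s) ∘ (e ∘ Φ s ∘ ψ)) x = z s' := rfl
    rw [e5, e6]
  have hev : (fun s' => (pullbackGram g (Φ s' ∘ ψ) x).det) =ᶠ[𝓝 s]
      fun s' => (gramMatrix (g.comp e (z s')) (V s')).det := by
    filter_upwards [Ioo_mem_nhds (show s - ε < s by linarith) (show s < s + ε by linarith)]
      with s' hs'
    rw [hgram s' ⟨by linarith [hs'.1], by linarith [hs'.2]⟩]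
  have hsub : HasDerivAt (fun s' => s' - s) 1 s := (hasDerivAt_id s).sub_const s
  have hzd : HasDerivAt z (timeVec (g.comp e) (inChart t e) (z s)) s := by
    have e1 := hφ.hasDerivAt y hyr (s - s) (by rwa [sub_self])
    have e2 := HasDerivAt.scomp (h := fun s' => s' - s) s e1 hsub
    rw [one_smul] at e2
    exact e2
  have hX : DifferentiableAt ℝ (timeVec (g.comp e) (inChart t e)) y :=
    (hT.smooth_timeVec.contDiffAt (e.open_target.mem_nhds hyt)).differentiableAt (by simp)
  have hVd : ∀ i a, HasDerivAt (fun s' => V s' i a)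
      (∑ b, V s i b * pd b (fun z => timeVec (g.comp e) (inChart t e) z a) (z s)) s := by
    intro i a
    have e1 := hφ.hasDerivAt_deriv y hyr (s - s) (by rwa [sub_self])
    have e2 := HasDerivAt.scomp (h := fun s' => s' - s) s e1 hsub
    rw [one_smul, sub_self, hφ.init y hyr, hφ.init_deriv y hyr, ContinuousLinearMap.comp_id] at e2
    have e3 := e2.clm_apply (hasDerivAt_const s (c' (EuclideanSpace.single i 1)))
    rw [map_zero, add_zero] at e3
    have e4 := ((EuclideanSpace.proj (𝕜 := ℝ) a).hasFDerivAt).comp_hasDerivAt s e3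
    refine e4.congr_deriv ?_
    have e5 : fderiv ℝ (fun z => timeVec (g.comp e) (inChart t e) z a) y =
        (EuclideanSpace.proj (𝕜 := ℝ) a).comp (fderiv ℝ (timeVec (g.comp e) (inChart t e)) y) :=
      ((EuclideanSpace.proj (𝕜 := ℝ) a).hasFDerivAt.comp y hX.hasFDerivAt).fderiv
    have e6 := fderiv_eq_sum_pd (fun z => timeVec (g.comp e) (inChart t e) z a) y
      (c' (EuclideanSpace.single i 1))
    rw [e5] at e6
    rw [hVs, hzs]
    exact e6
  have htan : ∀ i, ∑ a, V s i a * pd a (inChart t e) (z s) = 0 := by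
    rw [hVs, hzs]
    exact ht.tangent_param he hΨ hq hΨslice
  have hdet : (gramMatrix (g.comp e (z s)) (V s)).det ≠ 0 := by
    rw [← hgram s (by rwa [sub_self])]
    exact (ht.pullbackGram_det_pos hΨ hΨinj hΨslice).ne'
  have hmain := hT.hasDerivAt_det_gramMatrix (z := z) (V := V) (by rwa [hzs]) hzd hVd htan hdet
  refine (hmain.congr_of_eventuallyEq hev).congr_deriv ?_
  rw [hgram s (by rwa [sub_self]), hcmc e he _ (by rwa [hzs]), ht.lapse_eq he hq, hzs, inChart, hy,
    e.left_inv hq]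
  rw [show t (Φ s (ψ x)) = τ + s from hΨslice.self_of_nhds]

end Pullback

/-! ### Comparison of the volumes of the slices -/

section VolumeComparison

set_option linter.unusedSectionVars false

/-- For `f' = a f` with `0 ≤ a ≤ K` and `f ≥ 0`, the function `f` is nondecreasing and `f(s)
e^{-Ks}` is nonincreasing. -/
lemma growth_bounds {f a : ℝ → ℝ} {α β K : ℝ}
    (hf : ∀ s ∈ Set.Ioo α β, HasDerivAt f (a s * f s) s)
    (ha : ∀ s ∈ Set.Ioo α β, 0 ≤ a s ∧ a s ≤ K) (h0 : ∀ s ∈ Set.Ioo α β, 0 ≤ f s) {s s' : ℝ}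
    (hs : s ∈ Set.Ioo α β) (hs' : s' ∈ Set.Ioo α β) (hle : s ≤ s') :
    f s ≤ f s' ∧ f s' ≤ Real.exp (K * (s' - s)) * f s := by
  constructor
  · refine monotoneOn_of_deriv_nonneg (convex_Ioo α β)
      (fun x hx => (hf x hx).continuousAt.continuousWithinAt) (fun x hx => ?_) (fun x hx => ?_)
      hs hs' hle
    · rw [interior_Ioo] at hx
      exact (hf x hx).differentiableAt.differentiableWithinAt
    · rw [interior_Ioo] at hx
      rw [(hf x hx).deriv]
      exact mul_nonneg (ha x hx).1 (h0 x hx)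
  · have hd : ∀ x ∈ Set.Ioo α β, HasDerivAt (fun s => f s * Real.exp (-K * s))
        ((a x - K) * f x * Real.exp (-K * x)) x := fun x hx => by
      have h1 : HasDerivAt (fun s => Real.exp (-K * s)) (Real.exp (-K * x) * -K) x := by
        simpa using ((hasDerivAt_id x).const_mul (-K)).exp
      exact ((hf x hx).mul h1).congr_deriv (by ring)
    have := antitoneOn_of_deriv_nonpos (convex_Ioo α β)
      (fun x hx => (hd x hx).continuousAt.continuousWithinAt) (fun x hx => by
        rw [interior_Ioo] at hx
        exact (hd x hx).differentiableAt.differentiableWithinAt) (fun x hx => by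
        rw [interior_Ioo] at hx
        rw [(hd x hx).deriv]
        exact mul_nonpos_of_nonpos_of_nonneg (mul_nonpos_of_nonpos_of_nonneg
          (by linarith [(ha x hx).2]) (h0 x hx)) (Real.exp_pos _).le) hs hs' hle
    beta_reduce at this
    calc f s' = f s' * Real.exp (-K * s') * Real.exp (K * s') := by
          rw [mul_assoc, ← Real.exp_add]; simp
      _ ≤ f s * Real.exp (-K * s) * Real.exp (K * s') := by gcongr
      _ = Real.exp (K * (s' - s)) * f s := by
          rw [mul_assoc, ← Real.exp_add, mul_comm]
          congr 2
          ring

variable {M : Type*} [TopologicalSpace M] [ChartedSpace E4 M] [IsManifold (𝓡 4) ∞ M] [T2Space M]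
  {g : LorentzMetric M} {t : M → ℝ} {t₀ t₁ s s' τ τ' : ℝ} {Φ : ℝ → M → M}

namespace IsTimeFlow

variable (h : IsTimeFlow g t t₀ t₁ Φ)

lemma mem_of_slice {p : M} (hs : s ∈ Set.Ioo (t₀ - τ) (t₁ - τ)) (hp : p ∈ slice t τ) :
    s ∈ Set.Ioo (t₀ - t p) (t₁ - t p) := by
  have : t p = τ := hp
  rwa [this]

lemma _root_.CMCFoliation.Piece.mdifferentiableAt {S : Set M} (P : Piece S) {x : E3}
    (hx : x ∈ P.U) : MDifferentiableAt (𝓡 3) (𝓡 4) P.ψ x :=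
  (P.contMDiffOn.contMDiffAt (P.isOpen.mem_nhds hx)).mdifferentiableAt (by simp)

lemma _root_.CMCFoliation.Piece.eventually_slice (P : Piece (slice t τ)) {x : E3}
    (hx : x ∈ P.U) : ∀ᶠ z in 𝓝 x, t (P.ψ z) = τ := by
  filter_upwards [P.isOpen.mem_nhds hx] with z hz using P.mapsTo hz

include h in
lemma injOn (hs : s ∈ Set.Ioo (t₀ - τ) (t₁ - τ)) : Set.InjOn (Φ s) (slice t τ) :=
  fun p hp q hq hpq => by
    rw [← h.neg_add (mem_of_slice hs hp), hpq, h.neg_add (mem_of_slice hs hq)]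

/-- The image under the flow of a piece of a slice. -/
def push (hs : s ∈ Set.Ioo (t₀ - τ) (t₁ - τ)) (hτ : τ' = τ + s) (P : Piece (slice t τ)) :
    Piece (slice t τ') where
  U := P.U
  ψ := Φ s ∘ P.ψ
  K := P.K
  isOpen := P.isOpen
  contMDiffOn := fun x hx =>
    ((h.contMDiffAt (mem_of_slice hs (P.mapsTo hx))).comp x
      (P.contMDiffOn.contMDiffAt (P.isOpen.mem_nhds hx))).contMDiffWithinAt
  injOn := (h.injOn hs).comp P.injOn P.mapsTo
  immersion := fun x hx => h.injective_comp (P.mdifferentiableAt hx) (P.immersion x hx)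
    (mem_of_slice hs (P.mapsTo hx))
  mapsTo := fun x hx => by
    have h1 : t (P.ψ x) = τ := P.mapsTo hx
    have h2 := h.time (mem_of_slice hs (P.mapsTo hx))
    rw [h1] at h2
    rw [hτ]
    exact h2
  measurable := P.measurable
  subset := P.subset

/-- `Φ s` is injective on the slice, so it carries disjoint families of pieces to disjoint families.
A comparison of single pieces therefore passes to the supremum. -/
lemma hypersurfaceVolume_le (hs : s ∈ Set.Ioo (t₀ - τ) (t₁ - τ)) (hτ : τ' = τ + s) {c : ℝ≥0∞}
    (hP : ∀ P : Piece (slice t τ), P.volume g ≤ c * (h.push hs hτ P).volume g) :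
    hypersurfaceVolume g (slice t τ) ≤ c * hypersurfaceVolume g (slice t τ') := by
  refine iSup_le fun m => iSup_le fun P => iSup_le fun hdisj => ?_
  calc ∑ i, (P i).volume g ≤ ∑ i, c * (h.push hs hτ (P i)).volume g :=
        Finset.sum_le_sum fun i _ => hP (P i)
    _ = c * ∑ i, (h.push hs hτ (P i)).volume g := by rw [Finset.mul_sum]
    _ ≤ _ := by
        gcongr
        refine le_trans ?_ (le_iSup _ m)
        refine le_trans ?_ (le_iSup _ fun i => h.push hs hτ (P i))
        refine le_trans ?_ (le_iSup _ ?_)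
        · exact le_rfl
        · intro i j hij
          have hsub : ∀ i, (P i).ψ '' (P i).K ⊆ slice t τ := fun i =>
            Set.image_subset_iff.2 fun x hx => (P i).mapsTo ((P i).subset hx)
          change Disjoint ((Φ s ∘ (P i).ψ) '' (P i).K) ((Φ s ∘ (P j).ψ) '' (P j).K)
          rw [Set.image_comp, Set.image_comp]
          exact Disjoint.image (hdisj hij) (h.injOn hs) (hsub i) (hsub j)

include h in
/-- The volume density is increasing along the flow, at a bounded rate. -/
lemma density_bounds (ht₁ : t₁ < 0)
    (hcmc : ∀ e ∈ IsManifold.maximalAtlas (𝓡 4) ∞ M, ∀ y ∈ e.target,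
      traceSff (g.comp e) (inChart t e) y = inChart t e y)
    (hlapse : ∀ p, 0 ≤ lapse g t p ∧ lapse g t p ≤ 4 / t p ^ 2)
    (P : Piece (slice t τ)) {x : E3} (hx : x ∈ P.U)
    (hs : s ∈ Set.Ioo (t₀ - τ) (t₁ - τ)) (hs' : s' ∈ Set.Ioo (t₀ - τ) (t₁ - τ)) (hle : s ≤ s') :
    (pullbackGram g (Φ s ∘ P.ψ) x).det ≤ (pullbackGram g (Φ s' ∘ P.ψ) x).det ∧
    (pullbackGram g (Φ s' ∘ P.ψ) x).det ≤
      Real.exp (8 / -t₁ * (s' - s)) * (pullbackGram g (Φ s ∘ P.ψ) x).det := by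
  have hmem : ∀ σ ∈ Set.Ioo (t₀ - τ) (t₁ - τ),
      σ ∈ Set.Ioo (t₀ - t (P.ψ x)) (t₁ - t (P.ψ x)) := fun σ hσ =>
    mem_of_slice hσ (P.mapsTo hx)
  have hψ := P.mdifferentiableAt hx
  have hinj : Function.Injective (dparam P.ψ x) := P.immersion x hx
  have hslice := P.eventually_slice hx
  refine growth_bounds (f := fun s => (pullbackGram g (Φ s ∘ P.ψ) x).det)
    (a := fun s => -2 * lapse g t (Φ s (P.ψ x)) * (τ + s)) (K := 8 / -t₁)
    (fun σ hσ => h.hasDerivAt_det_pullbackGram hcmc hψ hinj hslice (hmem σ hσ))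
    (fun σ hσ => ?_) (fun σ hσ => (h.timeFunction.pullbackGram_det_pos
      (h.mdifferentiableAt_comp hψ (hmem σ hσ)) (h.injective_comp hψ hinj (hmem σ hσ))
      (h.eventually_slice hψ.continuousAt hslice (hmem σ hσ))).le) hs hs' hle
  have htime : t (Φ σ (P.ψ x)) = τ + σ :=
    (h.eventually_slice hψ.continuousAt hslice (hmem σ hσ)).self_of_nhds
  obtain ⟨h1, h2⟩ := hlapse (Φ σ (P.ψ x))
  rw [htime] at h2
  have h3 : τ + σ < t₁ := by linarith [hσ.2]
  set n := lapse g t (Φ σ (P.ψ x))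
  set w := -(τ + σ) with hw
  have hw1 : -t₁ < w := by linarith
  have hw0 : 0 < w := by linarith
  -- With `w = -t > |t₁|` on the slice reached, the rate is `2nw ≤ 8/w ≤ 8/|t₁|`.
  have e1 : -2 * n * (τ + σ) = 2 * n * w := by rw [hw]; ring
  rw [e1]
  refine ⟨by positivity, ?_⟩
  have e2 : (τ + σ) ^ 2 = w ^ 2 := by rw [hw]; ring
  rw [e2] at h2
  calc 2 * n * w ≤ 2 * (4 / w ^ 2) * w := by gcongr
    _ = 8 / w := by field_simp; norm_num
    _ ≤ 8 / -t₁ := by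
      apply div_le_div_of_nonneg_left (by norm_num) (by linarith) hw1.le

lemma push_volume_le (ht₁ : t₁ < 0)
    (hcmc : ∀ e ∈ IsManifold.maximalAtlas (𝓡 4) ∞ M, ∀ y ∈ e.target,
      traceSff (g.comp e) (inChart t e) y = inChart t e y)
    (hlapse : ∀ p, 0 ≤ lapse g t p ∧ lapse g t p ≤ 4 / t p ^ 2)
    (P : Piece (slice t τ))
    (hs : s ∈ Set.Ioo (t₀ - τ) (t₁ - τ)) (hs' : s' ∈ Set.Ioo (t₀ - τ) (t₁ - τ)) (hle : s ≤ s') :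
    (h.push hs rfl P).volume g ≤ (h.push hs' rfl P).volume g ∧
    (h.push hs' rfl P).volume g ≤
      ENNReal.ofReal (Real.exp (8 / -t₁ * (s' - s))) * (h.push hs rfl P).volume g := by
  have key := fun x (hx : x ∈ P.K) =>
    h.density_bounds ht₁ hcmc hlapse P (P.subset hx) hs hs' hle
  constructor
  · refine MeasureTheory.setLIntegral_mono' P.measurable fun x hx => ?_
    exact ENNReal.ofReal_le_ofReal (Real.sqrt_le_sqrt (key x hx).1)
  · rw [Piece.volume, Piece.volume, ← MeasureTheory.lintegral_const_mul' _ _ ENNReal.ofReal_ne_top]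
    refine MeasureTheory.setLIntegral_mono' P.measurable fun x hx => ?_
    rw [← ENNReal.ofReal_mul (Real.exp_pos _).le]
    refine ENNReal.ofReal_le_ofReal ?_
    set E := Real.exp (8 / -t₁ * (s' - s)) with hE
    -- The volume density is the square root of the determinant and grows only by `√E`; since `E ≥
    -- 1`, the coarser factor `E` may be used instead.
    have hE1 : 1 ≤ E := Real.one_le_exp (mul_nonneg (div_nonneg (by norm_num) (by linarith))
      (by linarith))
    calc √(pullbackGram g (Φ s' ∘ P.ψ) x).det
        ≤ √(E * (pullbackGram g (Φ s ∘ P.ψ) x).det) := Real.sqrt_le_sqrt (key x hx).2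
      _ = √E * √(pullbackGram g (Φ s ∘ P.ψ) x).det := Real.sqrt_mul (by linarith) _
      _ ≤ E * √(pullbackGram g (Φ s ∘ P.ψ) x).det := by
        gcongr
        exact Real.sqrt_le_iff.2 ⟨by linarith, by nlinarith⟩

lemma push_zero_volume (h0 : (0 : ℝ) ∈ Set.Ioo (t₀ - τ) (t₁ - τ)) (P : Piece (slice t τ)) :
    (h.push h0 rfl P).volume g = P.volume g := by
  have : Φ 0 ∘ P.ψ = P.ψ := funext fun x => h.zero _
  change ∫⁻ x in P.K, ENNReal.ofReal (Real.sqrt (pullbackGram g (Φ 0 ∘ P.ψ) x).det) = _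
  rw [this]
  rfl

include h in
/-- The volume of the slices is increasing, at a bounded rate. -/
theorem volume_bounds (ht₁ : t₁ < 0)
    (hcmc : ∀ e ∈ IsManifold.maximalAtlas (𝓡 4) ∞ M, ∀ y ∈ e.target,
      traceSff (g.comp e) (inChart t e) y = inChart t e y)
    (hlapse : ∀ p, 0 ≤ lapse g t p ∧ lapse g t p ≤ 4 / t p ^ 2)
    (hτ : t₀ < τ) (hle : τ ≤ τ') (hτ' : τ' < t₁) :
    hypersurfaceVolume g (slice t τ) ≤ hypersurfaceVolume g (slice t τ') ∧
    hypersurfaceVolume g (slice t τ') ≤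
      ENNReal.ofReal (Real.exp (8 / -t₁ * (τ' - τ))) * hypersurfaceVolume g (slice t τ) := by
  constructor
  · have hs : τ' - τ ∈ Set.Ioo (t₀ - τ) (t₁ - τ) := ⟨by linarith, by linarith⟩
    have h0 : (0 : ℝ) ∈ Set.Ioo (t₀ - τ) (t₁ - τ) := ⟨by linarith, by linarith⟩
    have := h.hypersurfaceVolume_le hs (τ' := τ') (by ring) (c := 1) fun P => by
      rw [one_mul, ← h.push_zero_volume h0]
      exact (h.push_volume_le ht₁ hcmc hlapse P h0 hs (by linarith)).1
    rwa [one_mul] at this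
  -- For the upper bound the pieces of the later slice are pushed backward in time, which again
  -- reduces the claim to the comparison along single orbits.
  · have hs : τ - τ' ∈ Set.Ioo (t₀ - τ') (t₁ - τ') := ⟨by linarith, by linarith⟩
    have h0 : (0 : ℝ) ∈ Set.Ioo (t₀ - τ') (t₁ - τ') := ⟨by linarith, by linarith⟩
    refine h.hypersurfaceVolume_le hs (τ' := τ) (by ring) fun P => ?_
    rw [← h.push_zero_volume h0]
    have := (h.push_volume_le ht₁ hcmc hlapse P hs h0 (by linarith)).2
    rwa [show 0 - (τ - τ') = τ' - τ by ring] at this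

end IsTimeFlow

end VolumeComparison

/-! ### Bounds for the lapse -/

section LapseBounds

variable {M : Type*} [TopologicalSpace M] [ChartedSpace E4 M] [IsManifold (𝓡 4) ∞ M]
  {g : LorentzMetric M} {t : M → ℝ} {Φ : MatterField M} {C₀ t₀ t₁ : ℝ} {p : M}

omit [IsManifold (𝓡 4) ∞ M] in
lemma BreakdownCriterion.bounds (h : BreakdownCriterion g t Φ C₀) (hC₀ : 0 < C₀) (p : M) :
    pointNormSff g t p ≤ C₀ ∧ pointNormMatter g t p Φ ≤ C₀ := by
  rw [BreakdownCriterion] at h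
  constructor
  · have h1 : ENNReal.ofReal (pointNormSff g t p) ≤ ENNReal.ofReal C₀ :=
      (le_iSup (fun p : M => ENNReal.ofReal (pointNormSff g t p)) p).trans
        ((le_self_add.trans le_self_add).trans h)
    exact (ENNReal.ofReal_le_ofReal_iff hC₀.le).1 h1
  · have h1 : ENNReal.ofReal (pointNormMatter g t p Φ) ≤ ENNReal.ofReal C₀ :=
      (le_iSup (fun p : M => ENNReal.ofReal (pointNormMatter g t p Φ)) p).trans
        (le_add_self.trans h)
    exact (ENNReal.ofReal_le_ofReal_iff hC₀.le).1 h1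

lemma IsEinsteinSpacetime.ricciNormal_bounds (h : IsEinsteinSpacetime g Φ)
    (ht : IsTimeFunction g t) (p : M) :
    0 ≤ ricciNormal (g.comp (chartAt E4 p)) (inChart t (chartAt E4 p)) (chartAt E4 p p) ∧
    ricciNormal (g.comp (chartAt E4 p)) (inChart t (chartAt E4 p)) (chartAt E4 p p) ≤
      pointNormMatter g t p Φ ^ 2 := by
  have he := IsManifold.chart_mem_maximalAtlas (I := 𝓡 4) (n := ∞) p
  have hy := (chartAt E4 p).map_source (mem_chart_source E4 p)
  have hT := ht.isTimeOn he
  cases Φ with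
  | scalar φ =>
    have hQ := (h.2 _ he _ hy).1
    have h1 := hT.ricciNormal_scalar hy hQ
    exact ⟨h1 ▸ sq_nonneg _, h1.trans_le (hT.scalar_le_norm hy _)⟩
  | maxwell F =>
    have hQ := (h _ he _ hy).1
    exact hT.ricciNormal_maxwell hy (fun a b => F.antisymm _ _ _) hQ

lemma IsTimeFunction.lapse_pos (ht : IsTimeFunction g t) (p : M) : 0 < lapse g t p :=
  (ht.isTimeOn (IsManifold.chart_mem_maximalAtlas p)).lapse_pos
    ((chartAt E4 p).map_source (mem_chart_source E4 p))

/-- Turns a property of the lapse on a whole slice, such as an extremal bound, into the local form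
in a chart that the maximum principle uses. -/
lemma IsTimeFunction.eventually_slice_lapse (ht : IsTimeFunction g t) (q : M) {R : ℝ → Prop}
    (hR : ∀ p ∈ slice t (t q), R (lapse g t p)) :
    ∀ᶠ z in 𝓝 (chartAt E4 q q), inChart t (chartAt E4 q) z = inChart t (chartAt E4 q)
      (chartAt E4 q q) → R (lapseLoc (g.comp (chartAt E4 q)) (inChart t (chartAt E4 q)) z) := by
  have he := IsManifold.chart_mem_maximalAtlas (I := 𝓡 4) (n := ∞) q
  set e := chartAt E4 q
  have hq : q ∈ e.source := mem_chart_source E4 q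
  filter_upwards [e.open_target.mem_nhds (e.map_source hq)] with z hz hzu
  simp only [inChart, e.left_inv hq] at hzu
  have h1 := hR (e.symm z) hzu
  rwa [ht.lapse_eq he (e.map_target hz), e.right_inv hz] at h1

/-- The lapse is continuous, so it attains its maximum on the compact slice. There `1/n ≥ |k|² +
Ric(T,T) ≥ t²/4`, by the trace inequality and the nonnegativity of `Ric(T,T)`. -/
lemma IsCMC.lapse_le (h : IsCMC g t t₀ t₁) (hE : IsEinsteinSpacetime g Φ) (p : M) :
    lapse g t p ≤ 4 / t p ^ 2 := by
  have ht := h.timeFunction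
  obtain ⟨q, hq, hmax⟩ := (h.compact_slice (t p)).exists_isMaxOn ⟨p, rfl⟩
    ht.continuous_lapse.continuousOn
  have hq' : t q = t p := hq
  have he := IsManifold.chart_mem_maximalAtlas (I := 𝓡 4) (n := ∞) q
  have hy := (chartAt E4 q).map_source (mem_chart_source E4 q)
  have hT := ht.isTimeOn he
  have h1 := hT.le_inv_lapse_of_max (h.cmc _ he) hy (ht.eventually_slice_lapse q
    (R := fun x => x ≤ lapse g t q) fun p' hp' => hmax (hp'.trans hq'))
  have h2 := hT.sq_le_normSff (h.cmc _ he) hy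
  have h3 := (hE.ricciNormal_bounds ht q).1
  rw [inChart, (chartAt E4 q).left_inv (mem_chart_source E4 q), hq'] at h2
  change _ ≤ (lapse g t q)⁻¹ at h1
  have h4 : t p ^ 2 / 4 ≤ (lapse g t q)⁻¹ := by linarith
  have htp : t p < 0 := by
    have : t p ∈ Set.Ioo t₀ t₁ := h.range_eq ▸ Set.mem_range_self p
    linarith [this.2, h.neg]
  have h5 : 0 < t p ^ 2 := sq_pos_of_neg htp
  calc lapse g t p ≤ lapse g t q := hmax rfl
    _ ≤ (t p ^ 2 / 4)⁻¹ := by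
      rw [le_inv_comm₀ (ht.lapse_pos q) (by positivity)]
      exact h4
    _ = 4 / t p ^ 2 := by rw [inv_div]

/-- At a minimum of the lapse on the slice `1/n ≤ |k|² + Ric(T,T)`, and the breakdown criterion
bounds each of the two terms by `C₀²`. -/
lemma IsCMC.inv_lapse_le (h : IsCMC g t t₀ t₁) (hE : IsEinsteinSpacetime g Φ)
    (hB : BreakdownCriterion g t Φ C₀) (hC₀ : 0 < C₀) (p : M) :
    (lapse g t p)⁻¹ ≤ 2 * C₀ ^ 2 := by
  have ht := h.timeFunction
  obtain ⟨q, hq, hmin⟩ := (h.compact_slice (t p)).exists_isMinOn ⟨p, rfl⟩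
    ht.continuous_lapse.continuousOn
  have hq' : t q = t p := hq
  have he := IsManifold.chart_mem_maximalAtlas (I := 𝓡 4) (n := ∞) q
  have hy := (chartAt E4 q).map_source (mem_chart_source E4 q)
  have hT := ht.isTimeOn he
  have h1 := hT.inv_lapse_le_of_min (h.cmc _ he) hy (ht.eventually_slice_lapse q
    (R := fun x => lapse g t q ≤ x) fun p' hp' => hmin (hp'.trans hq'))
  have h2 := (hE.ricciNormal_bounds ht q).2
  obtain ⟨h3, h4⟩ := hB.bounds hC₀ q
  have h5 : pointNormSff g t q ^ 2 ≤ C₀ ^ 2 := pow_le_pow_left₀ (Real.sqrt_nonneg _) h3 2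
  have h6 : 0 ≤ pointNormMatter g t q Φ := by cases Φ <;> exact Real.sqrt_nonneg _
  have h7 : pointNormMatter g t q Φ ^ 2 ≤ C₀ ^ 2 := pow_le_pow_left₀ h6 h4 2
  change (lapse g t q)⁻¹ ≤ pointNormSff g t q ^ 2 + _ at h1
  calc (lapse g t p)⁻¹ ≤ (lapse g t q)⁻¹ := inv_anti₀ (ht.lapse_pos q) (hmin rfl)
    _ ≤ 2 * C₀ ^ 2 := by linarith

end LapseBounds

/-! ### The volume of a compact slice -/

section SliceVolume

open Matrix

set_option linter.unusedSectionVars false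

/-- A parametrization `c` of a piece of a level set of `u`, with inverse `π`. -/
structure IsSliceParam (Ω : Set E4) (G : E4 → Matrix (Fin 4) (Fin 4) ℝ) (u : E4 → ℝ) (y : E4)
    (δ : ℝ) (c : E3 → E4) (π : E4 → E3) (N : Set E4) (m C : ℝ) : Prop where
  pos : 0 < δ
  isOpen : IsOpen N
  mem : y ∈ N
  subset : N ⊆ Ω
  differentiable : Differentiable ℝ π
  contDiffOn : ContDiffOn ℝ 1 c (Metric.ball 0 δ)
  mapsTo : ∀ x ∈ Metric.ball 0 δ, c x ∈ Ω
  level : ∀ x ∈ Metric.ball 0 δ, u (c x) = u y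
  left_inv : ∀ x ∈ Metric.ball 0 δ, π (c x) = x
  right_inv : ∀ z ∈ N, u z = u y → π z ∈ Metric.ball 0 δ ∧ c (π z) = z
  gram_pos : 0 < m
  gram_bounds : ∀ x ∈ Metric.ball 0 δ,
    m ≤ (gramMatrix (G (c x)) (rowMatrix (fderiv ℝ c x))).det ∧
    (gramMatrix (G (c x)) (rowMatrix (fderiv ℝ c x))).det ≤ C

variable {Ω : Set E4} {G : E4 → Matrix (Fin 4) (Fin 4) ℝ} {u : E4 → ℝ} {y : E4}

/-- The projection along a coordinate axis. -/
def dropCoord (a : Fin 4) : E4 →L[ℝ] E3 :=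
  LinearMap.toContinuousLinearMap
    { toFun := fun v => WithLp.toLp 2 fun i => v (a.succAbove i)
      map_add' := fun v w => by ext i; simp
      map_smul' := fun r v => by ext i; simp }

lemma dropCoord_apply (a : Fin 4) (v : E4) (i : Fin 3) : dropCoord a v i = v (a.succAbove i) := rfl

/-- If `L` does not vanish on the `a`-th coordinate vector, the other three coordinates together
with `L` form a linear coordinate system. -/
lemma exists_equiv_dropCoord {L : E4 →L[ℝ] ℝ} (hL : L ≠ 0) :
    ∃ a, ∃ f : E4 ≃L[ℝ] E3 × ℝ, (f : E4 →L[ℝ] E3 × ℝ) = (dropCoord a).prod L := by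
  obtain ⟨a, ha⟩ : ∃ a, L (EuclideanSpace.single a 1) ≠ 0 := by
    by_contra! h
    refine hL (ContinuousLinearMap.ext fun v => ?_)
    rw [← sum_smul_single v]
    simp [h]
  have hinj : Function.Injective ((dropCoord a).prod L).toLinearMap := by
    rw [← LinearMap.ker_eq_bot, LinearMap.ker_eq_bot']
    intro v hv
    have h1 : dropCoord a v = 0 := congrArg Prod.fst hv
    have h2 : L v = 0 := congrArg Prod.snd hv
    have h3 : v = v a • EuclideanSpace.single a 1 := by
      ext j
      rcases Fin.eq_self_or_eq_succAbove a j with rfl | ⟨i, rfl⟩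
      · simp
      · have := congrArg (fun w : E3 => w i) h1
        simp only [dropCoord_apply] at this
        simp [this]
    rw [h3, map_smul, smul_eq_mul] at h2
    rw [h3, (mul_eq_zero.1 h2).resolve_right ha, zero_smul]
  refine ⟨a, (LinearEquiv.ofInjectiveOfFinrankEq _ hinj (by simp)).toContinuousLinearEquiv, ?_⟩
  ext v <;> rfl

lemma rowMatrix_continuous : Continuous (rowMatrix : (E3 →L[ℝ] E4) → _) := by
  refine continuous_pi fun i => continuous_pi fun a => ?_
  have : Continuous fun L : E3 →L[ℝ] E4 => L (EuclideanSpace.single i 1) := by fun_prop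
  exact (EuclideanSpace.proj (𝕜 := ℝ) a).continuous.comp this

lemma continuousAt_det_gramMatrix {A : E3 → Matrix (Fin 4) (Fin 4) ℝ}
    {V : E3 → Matrix (Fin 3) (Fin 4) ℝ} {x : E3} (hA : ContinuousAt A x) (hV : ContinuousAt V x) :
    ContinuousAt (fun x => (gramMatrix (A x) (V x)).det) x := by
  have h2 : Continuous fun q : Matrix (Fin 4) (Fin 4) ℝ × Matrix (Fin 3) (Fin 4) ℝ =>
      (q.2 * q.1 * q.2ᵀ).det := by fun_prop
  exact ContinuousAt.comp (f := fun x => (A x, V x)) h2.continuousAt (hA.prodMk hV)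

lemma injective_fderiv_of_leftInverse {c : E3 → E4} {π : E4 → E3} {x : E3}
    (hπ : DifferentiableAt ℝ π (c x)) (hc : DifferentiableAt ℝ c x)
    (h : ∀ᶠ z in 𝓝 x, π (c z) = z) : Function.Injective (fderiv ℝ c x) := by
  have h1 := hπ.hasFDerivAt.comp x hc.hasFDerivAt
  have h2 : HasFDerivAt (π ∘ c) (ContinuousLinearMap.id ℝ E3) x :=
    (hasFDerivAt_id x).congr_of_eventuallyEq h
  have h3 := h1.unique h2
  exact Function.LeftInverse.injective (g := fderiv ℝ π (c x))
    fun v => congrArg (fun L => L v) h3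

lemma tangent_of_level {c : E3 → E4} {x : E3} {τ : ℝ} (hu : DifferentiableAt ℝ u (c x))
    (hc : DifferentiableAt ℝ c x) (h : ∀ᶠ z in 𝓝 x, u (c z) = τ) (i : Fin 3) :
    ∑ a, rowMatrix (fderiv ℝ c x) i a * pd a u (c x) = 0 := by
  have h1 := hu.hasFDerivAt.comp x hc.hasFDerivAt
  have h2 : HasFDerivAt (u ∘ c) (0 : E3 →L[ℝ] ℝ) x :=
    (hasFDerivAt_const τ x).congr_of_eventuallyEq h
  have h3 := congrArg (fun L => L (EuclideanSpace.single i 1)) (h1.unique h2)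
  simp only [ContinuousLinearMap.comp_apply, fderiv_eq_sum_pd] at h3
  exact h3

/-- The inverse function theorem is applied to the map formed by three coordinates and `u - u(y)`.
Its inverse, restricted to the hyperplane where the last component is zero, parametrizes the level
set; the inverse parametrization `π` is simply the affine projection to the three coordinates. -/
theorem IsTimeOn.exists_isSliceParam (h : IsTimeOn Ω G u) (hy : y ∈ Ω) :
    ∃ δ c π N m C, IsSliceParam Ω G u y δ c π N m C := by
  have hu : ContDiffAt ℝ ∞ u y := h.smooth_time.contDiffAt (h.isOpen.mem_nhds hy)
  obtain ⟨a, f, hf⟩ := exists_equiv_dropCoord (h.fderiv_time_ne_zero hy)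
  set π : E4 → E3 := fun z => dropCoord a (z - y) with hπ
  set H : E4 → E3 × ℝ := fun z => (π z, u z - u y) with hH
  have hπd : Differentiable ℝ π := by fun_prop
  have hH1 : ContDiffAt ℝ 1 H y := by
    refine ContDiffAt.prodMk (by fun_prop) ?_
    exact (hu.of_le (mod_cast le_top)).sub contDiffAt_const
  have hHd : HasFDerivAt H (f : E4 →L[ℝ] E3 × ℝ) y := by
    rw [hf]
    refine HasFDerivAt.prodMk ?_ ((hu.differentiableAt (by simp)).hasFDerivAt.sub_const _)
    exact (dropCoord a).hasFDerivAt.comp y ((hasFDerivAt_id y).sub_const y)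
  set Q := hH1.toOpenPartialHomeomorph H hHd one_ne_zero with hQ
  have hQcoe : ∀ z, Q z = H z := fun z => rfl
  have hyQ : y ∈ Q.source := hH1.mem_toOpenPartialHomeomorph_source hHd one_ne_zero
  have hHy : H y = (0, 0) := by simp [hH, hπ]
  have hsymm : ContDiffAt ℝ 1 Q.symm (0, 0) := by
    have := hH1.to_localInverse hHd one_ne_zero
    rw [hHy] at this
    exact this
  have hQ0 : Q.symm (0, 0) = y := by rw [← hHy, ← hQcoe, Q.left_inv hyQ]
  have h0t : ((0 : E3), (0 : ℝ)) ∈ Q.target := by rw [← hHy, ← hQcoe]; exact Q.map_source hyQ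
  set c : E3 → E4 := fun x => Q.symm (x, 0) with hc
  have hc0 : c 0 = y := hQ0
  have hι : Continuous fun x : E3 => (x, (0 : ℝ)) := by fun_prop
  have ev1 : ∀ᶠ x in 𝓝 (0 : E3), (x, (0 : ℝ)) ∈ Q.target :=
    hι.continuousAt.preimage_mem_nhds (Q.open_target.mem_nhds h0t)
  have hcC : ∀ x, ContDiffAt ℝ 1 Q.symm (x, (0 : ℝ)) → ContDiffAt ℝ 1 c x := fun x hx =>
    ContDiffAt.comp x hx (by fun_prop)
  have ev2 : ∀ᶠ x in 𝓝 (0 : E3), ContDiffAt ℝ 1 c x := by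
    have := hι.continuousAt.eventually (hsymm.eventually (by simp))
    exact this.mono hcC
  have hc1 : ContDiffAt ℝ 1 c 0 := ev2.self_of_nhds
  have ev3 : ∀ᶠ x in 𝓝 (0 : E3), c x ∈ Ω :=
    hc1.continuousAt.preimage_mem_nhds (h.isOpen.mem_nhds (by rwa [hc0]))
  have hinv : ∀ x, (x, (0 : ℝ)) ∈ Q.target → π (c x) = x ∧ u (c x) = u y := by
    intro x hx
    have h1 : H (c x) = (x, 0) := Q.right_inv hx
    exact ⟨congrArg Prod.fst h1, sub_eq_zero.1 (congrArg Prod.snd h1)⟩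
  set D : E3 → ℝ := fun x => (gramMatrix (G (c x)) (rowMatrix (fderiv ℝ c x))).det with hD
  have hDcont : ContinuousAt D 0 := by
    have hG : ContinuousAt (fun x => G (c x)) 0 := by
      refine continuousAt_pi.2 fun i => continuousAt_pi.2 fun j => ?_
      have h1 : ContinuousAt (fun z => G z i j) (c 0) :=
        (h.smooth i j).continuousOn.continuousAt (h.isOpen.mem_nhds (by rwa [hc0]))
      exact ContinuousAt.comp (f := c) h1 hc1.continuousAt
    have hV : ContinuousAt (fun x => rowMatrix (fderiv ℝ c x)) 0 := by
      have h1 : ContinuousAt (fderiv ℝ c) 0 := hc1.continuousAt_fderiv (by simp)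
      exact rowMatrix_continuous.continuousAt.comp h1
    exact continuousAt_det_gramMatrix hG hV
  have hD0 : 0 < D 0 := by
    refine h.gramMatrix_det_pos (by rwa [hc0]) (fun i => ?_) fun v hv =>
      eq_zero_of_vecMul_rowMatrix (injective_fderiv_of_leftInverse (π := π) hπd.differentiableAt
        (hc1.differentiableAt (by simp)) (ev1.mono fun x hx => (hinv x hx).1)) hv
    exact tangent_of_level (by rw [hc0]; exact hu.differentiableAt (by simp))
      (hc1.differentiableAt (by simp)) (ev1.mono fun x hx => (hinv x hx).2) i
  have ev4 : ∀ᶠ x in 𝓝 (0 : E3), D 0 / 2 < D x ∧ D x < D 0 + 1 :=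
    (hDcont.eventually (lt_mem_nhds (by linarith))).and
      (hDcont.eventually (gt_mem_nhds (by linarith)))
  obtain ⟨δ, hδ, hball⟩ := Metric.eventually_nhds_iff_ball.1 (ev1.and (ev2.and (ev3.and ev4)))
  have hπy : π y = 0 := by simp [hπ]
  -- The Gram determinant is continuous and positive at the centre, so on a small ball it stays
  -- between half its central value and one more than it.
  refine ⟨δ, c, π, (Q.source ∩ Ω) ∩ π ⁻¹' Metric.ball 0 δ, D 0 / 2, D 0 + 1, ?_⟩
  exact
    { pos := hδ
      isOpen := (Q.open_source.inter h.isOpen).inter (Metric.isOpen_ball.preimage hπd.continuous)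
      mem := ⟨⟨hyQ, hy⟩, by rw [Set.mem_preimage, hπy]; exact Metric.mem_ball_self hδ⟩
      subset := fun z hz => hz.1.2
      differentiable := hπd
      contDiffOn := fun x hx => (hball x hx).2.1.contDiffWithinAt
      mapsTo := fun x hx => (hball x hx).2.2.1
      level := fun x hx => (hinv x (hball x hx).1).2
      left_inv := fun x hx => (hinv x (hball x hx).1).1
      right_inv := fun z hz hzu => ⟨hz.2, by
        have : H z = (π z, 0) := by simp [hH, hzu]
        change Q.symm (π z, 0) = z
        rw [← this, ← hQcoe, Q.left_inv hz.1.1]⟩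
      gram_pos := by linarith
      gram_bounds := fun x hx => ⟨(hball x hx).2.2.2.1.le, (hball x hx).2.2.2.2.le⟩ }

end SliceVolume

/-! ### Positivity and finiteness of the volume of a compact slice. -/

section

section CompactSlice

open Matrix

set_option linter.unusedSectionVars false

/-- The transformation rule of the squared volume density under a change of parameters. -/
lemma det_gramMatrix_comp (A : Matrix (Fin 4) (Fin 4) ℝ) (L : E3 →L[ℝ] E4) (θ : E3 →L[ℝ] E3) :
    (gramMatrix A (rowMatrix (L.comp θ))).det = θ.det ^ 2 * (gramMatrix A (rowMatrix L)).det := by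
  set B : Matrix (Fin 3) (Fin 3) ℝ := Matrix.of fun i j => θ (EuclideanSpace.single i 1) j with hB
  have h1 : rowMatrix (L.comp θ) = B * rowMatrix L := by
    ext i a
    rw [mul_apply]
    change L (θ (EuclideanSpace.single i 1)) a = _
    conv_lhs => rw [← sum_smul_single (θ (EuclideanSpace.single i 1))]
    simp [hB, rowMatrix]
  have h2 : B.det = θ.det := by
    rw [ContinuousLinearMap.det, ← LinearMap.det_toMatrix
      (EuclideanSpace.basisFun (Fin 3) ℝ).toBasis, ← det_transpose]
    congr 1
  have h3 : gramMatrix A (B * rowMatrix L) = B * gramMatrix A (rowMatrix L) * Bᵀ := by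
    simp only [gramMatrix, transpose_mul, Matrix.mul_assoc]
  rw [h1, h3, det_mul, det_mul, det_transpose, h2]
  ring

variable {M : Type*} [TopologicalSpace M] [ChartedSpace E4 M] [IsManifold (𝓡 4) ∞ M] [T2Space M]
  {g : LorentzMetric M} {t : M → ℝ} {e : OpenPartialHomeomorph M E4} {p : M} {τ δ m C : ℝ}
  {c : E3 → E4} {π : E4 → E3} {N : Set E4} {y : E4}

lemma Piece.volume_le {S : Set M} (P : Piece S) : P.volume g ≤ hypersurfaceVolume g S := by
  refine le_trans ?_ (le_iSup _ 1)
  refine le_trans ?_ (le_iSup _ fun _ => P)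
  refine le_trans ?_ (le_iSup _ fun i j hij => (hij (Subsingleton.elim i j)).elim)
  simp

/-- The piece of a slice which belongs to a parametrization in a chart. -/
def IsSliceParam.piece (he : e ∈ IsManifold.maximalAtlas (𝓡 4) ∞ M)
    (h : IsSliceParam e.target (g.comp e) (inChart t e) y δ c π N m C) (hy : inChart t e y = τ) :
    Piece (slice t τ) where
  U := Metric.ball 0 δ
  ψ := e.symm ∘ c
  K := Metric.ball 0 δ
  isOpen := Metric.isOpen_ball
  contMDiffOn := ((contMDiffOn_symm_of_mem_maximalAtlas he).of_le (mod_cast le_top)).comp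
    h.contDiffOn.contMDiffOn h.mapsTo
  injOn := fun x hx x' hx' hxx' => by
    have h1 := e.symm.injOn (h.mapsTo x hx) (h.mapsTo x' hx') hxx'
    rw [← h.left_inv x hx, h1, h.left_inv x' hx']
  immersion := fun x hx => by
    have h1 : DifferentiableAt ℝ c x :=
      (h.contDiffOn.contDiffAt (Metric.isOpen_ball.mem_nhds hx)).differentiableAt (by simp)
    have h2 := dparam_symm_comp he h1.hasFDerivAt (h.mapsTo x hx)
    have h3 := injective_fderiv_of_leftInverse h.differentiable.differentiableAt h1
      (Filter.eventually_of_mem (Metric.isOpen_ball.mem_nhds hx) h.left_inv)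
    change Function.Injective (dparam (e.symm ∘ c) x)
    rw [h2]
    exact (dsymm_injective he (h.mapsTo x hx)).comp h3
  mapsTo := fun x hx => (h.level x hx).trans hy
  measurable := measurableSet_ball
  subset := subset_rfl

/-- A single parametrized piece around `p` suffices: its density is at least `√m > 0` on a ball of
positive measure. -/
lemma IsTimeFunction.hypersurfaceVolume_pos (ht : IsTimeFunction g t) (hp : t p = τ) :
    0 < hypersurfaceVolume g (slice t τ) := by
  have he := IsManifold.chart_mem_maximalAtlas (I := 𝓡 4) (n := ∞) p
  set e := chartAt E4 p
  have hps : p ∈ e.source := mem_chart_source E4 p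
  obtain ⟨δ, c, π, N, m, C, h⟩ := (ht.isTimeOn he).exists_isSliceParam (e.map_source hps)
  have hy : inChart t e (e p) = τ := by rw [inChart, e.left_inv hps, hp]
  refine lt_of_lt_of_le ?_ (h.piece he hy).volume_le
  have h1 : ∫⁻ x in Metric.ball (0 : E3) δ, ENNReal.ofReal (√m) ≤ (h.piece he hy).volume g := by
    refine MeasureTheory.setLIntegral_mono' measurableSet_ball fun x hx => ?_
    refine ENNReal.ofReal_le_ofReal (Real.sqrt_le_sqrt ?_)
    have h2 : DifferentiableAt ℝ c x :=
      (h.contDiffOn.contDiffAt (Metric.isOpen_ball.mem_nhds hx)).differentiableAt (by simp)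
    have h3 := pullbackGram_eq (g := g) he (ψ := e.symm ∘ c) (Filter.EventuallyEq.refl _ _)
      h2.hasFDerivAt (h.mapsTo x hx)
    change m ≤ (pullbackGram g (e.symm ∘ c) x).det
    rw [h3]
    exact (h.gram_bounds x hx).1
  refine lt_of_lt_of_le ?_ h1
  rw [MeasureTheory.setLIntegral_const]
  exact ENNReal.mul_pos (ENNReal.ofReal_pos.2 (Real.sqrt_pos.2 h.gram_pos)).ne'
    (Metric.measure_ball_pos _ _ h.pos).ne'

/-- The part of a family of disjoint pieces which lies in the range of a parametrization has bounded
volume. -/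
lemma IsSliceParam.sum_volume_le (he : e ∈ IsManifold.maximalAtlas (𝓡 4) ∞ M)
    (h : IsSliceParam e.target (g.comp e) (inChart t e) y δ c π N m C) (hy : inChart t e y = τ)
    {l : ℕ} (P : Fin l → Piece (slice t τ))
    (hdisj : Pairwise fun i j => Disjoint ((P i).ψ '' (P i).K) ((P j).ψ '' (P j).K)) :
    ∑ i, ∫⁻ x in (P i).K ∩ (P i).ψ ⁻¹' (e.source ∩ e ⁻¹' N),
      ENNReal.ofReal (√(pullbackGram g (P i).ψ x).det) ≤
      ENNReal.ofReal (√C) * MeasureTheory.volume (Metric.ball (0 : E3) δ) := by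
  set W : Set M := e.source ∩ e ⁻¹' N with hW
  have hWopen : IsOpen W := e.isOpen_inter_preimage h.isOpen
  -- `θ i` is the change of parameters from the `i`-th piece to the reference parametrization `c`.
  -- It is injective on `A i`, and different pieces have disjoint images in the ball of radius `δ`.
  -- The change of variables formula thus bounds the total volume by `√C` times the volume of that
  -- ball, whatever the family.
  set θ : Fin l → E3 → E3 := fun i x => π (e ((P i).ψ x)) with hθ
  set A : Fin l → Set E3 := fun i => (P i).K ∩ (P i).ψ ⁻¹' W with hA
  have hOopen : ∀ i, IsOpen ((P i).U ∩ (P i).ψ ⁻¹' W) := fun i =>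
    (P i).contMDiffOn.continuousOn.isOpen_inter_preimage (P i).isOpen hWopen
  have hAO : ∀ i, A i ⊆ (P i).U ∩ (P i).ψ ⁻¹' W := fun i x hx => ⟨(P i).subset hx.1, hx.2⟩
  have hAm : ∀ i, MeasurableSet (A i) := fun i => by
    have : A i = (P i).K ∩ ((P i).U ∩ (P i).ψ ⁻¹' W) := by
      ext x
      exact ⟨fun hx => ⟨hx.1, hAO i hx⟩, fun hx => ⟨hx.1, hx.2.2⟩⟩
    rw [this]
    exact (P i).measurable.inter (hOopen i).measurableSet
  have hcθ : ∀ i, ∀ x ∈ (P i).U ∩ (P i).ψ ⁻¹' W,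
      θ i x ∈ Metric.ball 0 δ ∧ c (θ i x) = e ((P i).ψ x) := fun i x hx => by
    refine h.right_inv _ hx.2.2 ?_
    rw [hy, inChart, e.left_inv hx.2.1]
    exact (P i).mapsTo hx.1
  have heψ : ∀ i, ∀ x ∈ (P i).U ∩ (P i).ψ ⁻¹' W, DifferentiableAt ℝ (e ∘ (P i).ψ) x :=
    fun i x hx => (exists_chart_param he ((P i).mdifferentiableAt hx.1) hx.2.1).2
  have hθd : ∀ i, ∀ x ∈ (P i).U ∩ (P i).ψ ⁻¹' W, DifferentiableAt ℝ (θ i) x := fun i x hx =>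
    DifferentiableAt.comp x h.differentiable.differentiableAt (heψ i x hx)
  have heq : ∀ i j, ∀ x ∈ A i, ∀ x' ∈ A j, θ i x = θ j x' → (P i).ψ x = (P j).ψ x' := by
    intro i j x hx x' hx' hxx'
    have h1 := (hcθ i x (hAO i hx)).2
    rw [hxx', (hcθ j x' (hAO j hx')).2] at h1
    exact e.injOn hx.2.1 hx'.2.1 h1.symm
  have hinj : ∀ i, Set.InjOn (θ i) (A i) := fun i x hx x' hx' hxx' =>
    (P i).injOn ((P i).subset hx.1) ((P i).subset hx'.1) (heq i i x hx x' hx' hxx')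
  have hder : ∀ i, ∀ x ∈ A i, HasFDerivWithinAt (θ i) (fderiv ℝ (θ i) x) (A i) x := fun i x hx =>
    (hθd i x (hAO i hx)).hasFDerivAt.hasFDerivWithinAt
  have hgram : ∀ i, ∀ x ∈ A i, (pullbackGram g (P i).ψ x).det ≤ (fderiv ℝ (θ i) x).det ^ 2 * C := by
    intro i x hx
    have hxO := hAO i hx
    obtain ⟨hx1, hx2⟩ := hcθ i x hxO
    obtain ⟨h1, h2⟩ := exists_chart_param he ((P i).mdifferentiableAt hxO.1) hxO.2.1
    have hc : DifferentiableAt ℝ c (θ i x) :=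
      (h.contDiffOn.contDiffAt (Metric.isOpen_ball.mem_nhds hx1)).differentiableAt (by simp)
    have h3 : HasFDerivAt (e ∘ (P i).ψ) ((fderiv ℝ c (θ i x)).comp (fderiv ℝ (θ i) x)) x := by
      refine (HasFDerivAt.comp x hc.hasFDerivAt (hθd i x hxO).hasFDerivAt).congr_of_eventuallyEq ?_
      filter_upwards [(hOopen i).mem_nhds hxO] with z hz
      exact (hcθ i z hz).2.symm
    rw [pullbackGram_eq he h1 h3 (e.map_source hxO.2.1), det_gramMatrix_comp, Function.comp_apply,
      ← hx2]
    exact mul_le_mul_of_nonneg_left (h.gram_bounds _ hx1).2 (sq_nonneg _)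
  have hbound : ∀ i, ∫⁻ x in A i, ENNReal.ofReal (√(pullbackGram g (P i).ψ x).det) ≤
      ENNReal.ofReal (√C) * MeasureTheory.volume (θ i '' A i) := by
    intro i
    rw [← MeasureTheory.lintegral_abs_det_fderiv_eq_addHaar_image _ (hAm i) (hder i) (hinj i),
      ← MeasureTheory.lintegral_const_mul' _ _ ENNReal.ofReal_ne_top]
    refine MeasureTheory.setLIntegral_mono' (hAm i) fun x hx => ?_
    rw [← ENNReal.ofReal_mul (Real.sqrt_nonneg _)]
    refine ENNReal.ofReal_le_ofReal ((Real.sqrt_le_sqrt (hgram i x hx)).trans_eq ?_)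
    rw [Real.sqrt_mul (sq_nonneg _), Real.sqrt_sq_eq_abs, mul_comm]
  have hdisjθ : Pairwise (Function.onFun Disjoint fun i => θ i '' A i) := by
    intro i j hij
    rw [Function.onFun, Set.disjoint_left]
    rintro _ ⟨x, hx, rfl⟩ ⟨x', hx', hxx'⟩
    have h1 := heq j i x' hx' x hx hxx'
    exact Set.disjoint_left.1 (hdisj hij) ⟨x, hx.1, rfl⟩ ⟨x', hx'.1, h1⟩
  have hmeas : ∀ i, MeasurableSet (θ i '' A i) := fun i =>
    MeasureTheory.measurable_image_of_fderivWithin (hAm i) (hder i) (hinj i)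
  calc _ ≤ ∑ i, ENNReal.ofReal (√C) * MeasureTheory.volume (θ i '' A i) :=
        Finset.sum_le_sum fun i _ => hbound i
    _ = ENNReal.ofReal (√C) * MeasureTheory.volume (⋃ i, θ i '' A i) := by
        rw [MeasureTheory.measure_iUnion hdisjθ hmeas, tsum_fintype, Finset.mul_sum]
    _ ≤ _ := by
        gcongr
        refine Set.iUnion_subset fun i => Set.image_subset_iff.2 fun x hx => ?_
        exact (hcθ i x (hAO i hx)).1

/-- Finitely many parametrizations cover the compact slice. In each of them any disjoint family has
volume at most a constant independent of the family, so the supremum is bounded by a finite sum. -/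
lemma IsTimeFunction.hypersurfaceVolume_lt_top (ht : IsTimeFunction g t)
    (hcomp : IsCompact (slice t τ)) : hypersurfaceVolume g (slice t τ) < ⊤ := by
  have he := fun p : M => IsManifold.chart_mem_maximalAtlas (I := 𝓡 4) (n := ∞) p
  choose δ c π N m C h using fun p : M => (ht.isTimeOn (he p)).exists_isSliceParam
    ((chartAt E4 p).map_source (mem_chart_source E4 p))
  set W : M → Set M := fun p => (chartAt E4 p).source ∩ (chartAt E4 p) ⁻¹' N p with hW
  obtain ⟨F, hF, hcover⟩ := hcomp.elim_nhds_subcover W fun p _ =>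
    ((chartAt E4 p).isOpen_inter_preimage (h p).isOpen).mem_nhds
      ⟨mem_chart_source E4 p, (h p).mem⟩
  refine lt_of_le_of_lt (b := ∑ p ∈ F, ENNReal.ofReal (√(C p)) *
    MeasureTheory.volume (Metric.ball (0 : E3) (δ p))) ?_ ?_
  · refine iSup_le fun l => iSup_le fun P => iSup_le fun hdisj => ?_
    have h1 : ∀ i, (P i).volume g ≤ ∑ p ∈ F, ∫⁻ x in (P i).K ∩ (P i).ψ ⁻¹' W p,
        ENNReal.ofReal (√(pullbackGram g (P i).ψ x).det) := by
      intro i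
      have hsub : (P i).K ⊆ ⋃ p : F, (P i).K ∩ (P i).ψ ⁻¹' W p := by
        intro x hx
        obtain ⟨p, hp, hxp⟩ := Set.mem_iUnion₂.1 (hcover ((P i).mapsTo ((P i).subset hx)))
        exact Set.mem_iUnion.2 ⟨⟨p, hp⟩, hx, hxp⟩
      refine (MeasureTheory.lintegral_mono_set hsub).trans
        ((MeasureTheory.lintegral_iUnion_le _ _).trans_eq ?_)
      rw [tsum_fintype]
      exact Finset.sum_coe_sort F fun p => ∫⁻ x in (P i).K ∩ (P i).ψ ⁻¹' W p,
        ENNReal.ofReal (√(pullbackGram g (P i).ψ x).det)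
    refine (Finset.sum_le_sum fun i _ => h1 i).trans ?_
    rw [Finset.sum_comm]
    refine Finset.sum_le_sum fun p hp => (h p).sum_volume_le (he p) ?_ P hdisj
    rw [inChart, (chartAt E4 p).left_inv (mem_chart_source E4 p)]
    exact hF p hp
  · refine ENNReal.sum_lt_top.2 fun p _ => ENNReal.mul_lt_top ENNReal.ofReal_lt_top ?_
    exact MeasureTheory.measure_ball_lt_top

end CompactSlice

end

end CMCFoliation

end

/-! ### Assembly of the lapse and volume bounds. -/

theorem proposition4p1 (t₁ C₀ : ℝ) (V₀ : ℝ≥0∞) (ht₁ : t₁ < 0) (hC₀ : 0 < C₀) :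
    ∃ C : ℝ, 0 < C ∧
      ∀ (M : Type*) [TopologicalSpace M] [T2Space M] [SecondCountableTopology M]
        [ConnectedSpace M] [ChartedSpace CMCFoliation.E4 M] [IsManifold (𝓡 4) ∞ M]
        (g : CMCFoliation.LorentzMetric M) (Φ : CMCFoliation.MatterField M)
        (t : M → ℝ) (t₀ τ₀ : ℝ),
        CMCFoliation.IsEinsteinSpacetime g Φ →
        CMCFoliation.IsCMC g t t₀ t₁ →
        CMCFoliation.BreakdownCriterion g t Φ C₀ →
        max t₀ (2 * t₁) < τ₀ → τ₀ < t₁ →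
        CMCFoliation.hypersurfaceVolume g (CMCFoliation.slice t τ₀) = V₀ →
        ∀ τ : ℝ, τ₀ ≤ τ → τ < t₁ →
          (∀ p ∈ CMCFoliation.slice t τ,
            C⁻¹ ≤ |CMCFoliation.lapse g t p| ∧ |CMCFoliation.lapse g t p| ≤ C) ∧
          ENNReal.ofReal C⁻¹ ≤ CMCFoliation.hypersurfaceVolume g (CMCFoliation.slice t τ) ∧
          CMCFoliation.hypersurfaceVolume g (CMCFoliation.slice t τ) ≤ ENNReal.ofReal C := by
  -- For `V₀ = ∞` this gives `v = 0`, and then `v⁻¹ = 0` by convention. The cases `V₀ = 0` and `V₀ =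
  -- ∞` do not occur for a nonempty compact slice, so these default values are harmless.
  set v := V₀.toReal with hv
  have hv0 : 0 ≤ v := ENNReal.toReal_nonneg
  have h1 : 0 ≤ 4 / t₁ ^ 2 := by positivity
  have h2 : 0 ≤ 2 * C₀ ^ 2 := by positivity
  have h3 : 0 ≤ Real.exp 8 * v := by positivity
  have h4 : 0 ≤ v⁻¹ := by positivity
  -- The summands bound, in order after the `1`, the lapse, its inverse, the volume and the inverse
  -- of the volume. The `1` makes the constant positive in all cases.
  refine ⟨1 + 4 / t₁ ^ 2 + 2 * C₀ ^ 2 + Real.exp 8 * v + v⁻¹, by linarith, ?_⟩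
  intro M _ _ _ _ _ _ g Φ t t₀ τ₀ hE hcmc hB hτ₀ hτ₀₁ hV τ hτ hτ₁
  set C := 1 + 4 / t₁ ^ 2 + 2 * C₀ ^ 2 + Real.exp 8 * v + v⁻¹ with hC
  have hC0 : 0 < C := by linarith
  have ht := hcmc.timeFunction
  obtain ⟨h5, h6⟩ := max_lt_iff.1 hτ₀
  obtain ⟨Ψ, hΨ⟩ := ht.exists_isTimeFlow hcmc.range_eq
  obtain ⟨hV1, hV2⟩ := hΨ.volume_bounds ht₁ hcmc.cmc
    (fun p => ⟨(ht.lapse_pos p).le, hcmc.lapse_le hE p⟩) h5 hτ hτ₁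
  rw [hV] at hV1 hV2
  refine ⟨fun p hp => ?_, ?_, ?_⟩
  · have hpos := ht.lapse_pos p
    have htp : t p = τ := hp
    rw [abs_of_pos hpos]
    constructor
    · rw [inv_le_comm₀ hC0 hpos]
      have := hcmc.inv_lapse_le hE hB hC₀ p
      linarith
    · have h7 := hcmc.lapse_le hE p
      -- The bound `4/t²` is worst at the largest time, since `τ < t₁ < 0`.
      have h8 : 4 / t p ^ 2 ≤ 4 / t₁ ^ 2 := by
        refine div_le_div_of_nonneg_left (by norm_num) (sq_pos_of_neg ht₁) ?_
        rw [htp]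
        nlinarith
      linarith
  · have hVtop : V₀ ≠ ⊤ := hV ▸ (ht.hypersurfaceVolume_lt_top (hcmc.compact_slice τ₀)).ne
    obtain ⟨p, hp⟩ : τ₀ ∈ Set.range t := by rw [hcmc.range_eq]; exact ⟨h5, hτ₀₁⟩
    have hVpos : 0 < v := ENNReal.toReal_pos (hV ▸ (ht.hypersurfaceVolume_pos hp).ne') hVtop
    refine le_trans ?_ hV1
    rw [← ENNReal.ofReal_toReal hVtop]
    refine ENNReal.ofReal_le_ofReal ?_
    rw [inv_le_comm₀ hC0 hVpos]
    linarith
  · have hVtop : V₀ ≠ ⊤ := hV ▸ (ht.hypersurfaceVolume_lt_top (hcmc.compact_slice τ₀)).ne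
    refine hV2.trans ?_
    rw [← ENNReal.ofReal_toReal hVtop, ← ENNReal.ofReal_mul (Real.exp_pos _).le]
    refine ENNReal.ofReal_le_ofReal ?_
    -- From `2t₁ < τ₀` and `τ < t₁` the elapsed time `τ - τ₀` is less than `-t₁`.
    have h7 : Real.exp (8 / -t₁ * (τ - τ₀)) ≤ Real.exp 8 := by
      refine Real.exp_le_exp.2 ?_
      rw [div_mul_eq_mul_div, div_le_iff₀ (by linarith)]
      linarith
    have h8 : Real.exp (8 / -t₁ * (τ - τ₀)) * v ≤ Real.exp 8 * v := by gcongr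
    linarith
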